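/- \textbf{Setting.} The finite types are $0$ (natural numbers) and, with $\rho,\tau$, the type $\rho\to\tau$; write $1$ for $0\to0$ (sets are identified with characteristic functions). The language $\mathcal L(\widehat{\mathsf{E}\text{-}\mathsf{HA}}{}^\omega_{\upharpoonright})$ has variables of all finite types, the constants $0$, successor, $+$, $\cdot$, the combinators $\Pi_{\rho,\tau}$, $\Sigma_{\delta,\rho,\tau}$, the recursor $R_0$ for primitive recursion of type $0$, application, the prime formulas $s=_0t$ (for terms of type $0$) and $\bot$, and $\land,\lor,\to,\forall,\exists$; equality of higher type is defined pointwise and $\lnot A$ is $A\to\bot$. The theory $\widehat{\mathsf{E}\text{-}\mathsf{HA}}{}^\omega_{\upharpoonright}$ is based on intuitionistic logic and has the equality axioms for $=_0$, the extensionality scheme $\forall x^\rho\forall y^\rho\forall z^{\rho\to\tau}(x=_\rho y\to z(x)=_\tau z(y))$, the usual axioms for $0$, successor, $+$, $\cdot$, the defining equations of $\Pi,\Sigma,R_0$, and induction for quantifier-free formulas. A formula is $\exists$-free if it is built from prime formulas with $\land,\to,\forall$ only. $\mathsf{AC}$ is the scheme $\forall x\,\exists y\,A(x,y)\to\exists Y\,\forall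 x\,A(x,Y(x))$ for all formulas $A$ and all finite types. $\mathsf{IP}^\omega_{\mathrm{ef}}$ is the scheme $(A\to\exists x\,B(x))\to\exists x\,(A\to B(x))$ for $x$ of any finite type and $A$ an $\exists$-free formula not containing $x$. Let $I_0=\widehat{\mathsf{E}\text{-}\mathsf{HA}}{}^\omega_{\upharpoonright}+\mathsf{AC}+\mathsf{IP}^\omega_{\mathrm{ef}}$. $\Gamma_1$ is the least class of formulas that contains the prime formulas, is closed under $\land,\lor,\forall,\exists$, and contains $(\exists x_1\cdots\exists x_k\,A)\to B$ whenever $k\ge0$, $A$ is $\exists$-free and $B\in\Gamma_1$. $\mathsf{QF\text{-}AC}^{\rho,\tau}$ is $\mathsf{AC}$ restricted to quantifier-free $A$, $x$ of type $\rho$ and $y$ of type $\tau$. $\mathsf{RCA}_0^\omega$ is $\widehat{\mathsf{E}\text{-}\mathsf{HA}}{}^\omega_{\upharpoonright}+\mathsf{QF\text{-}AC}^{1,0}$ plus the law of the excluded middle. $\mathcal L(\mathsf{RCA}_0)$ consists of the formulas in which all variables have type $0$ or $1$, and $\mathsf{RCA}_0$ is the restriction of $\widehat{\mathsf{E}\text{-}\mathsf{HA}}{}^\omega_{\upharpoonright}$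 to this language (with axioms taken in the form in which arbitrary terms of the language replace the universally quantified variables) plus $\mathsf{QF\text{-}AC}^{0,0}$ and the law of the excluded middle. \textbf{Theorem.} Let $\forall x^\rho\,\exists y^\tau A(x,y)$ be a sentence of $\mathcal L(\widehat{\mathsf{E}\text{-}\mathsf{HA}}{}^\omega_{\upharpoonright})$ in $\Gamma_1$, where $\rho,\tau$ are arbitrary finite types. If \[ I_0\vdash\forall x\,\exists y\,A(x,y), \] then \[ \mathsf{RCA}_0^\omega\vdash\forall\langle x_n\mid n\in\mathbb N\rangle\,\exists\langle y_n\mid n\in\mathbb N\rangle\,\forall n\,A(x_n,y_n), \] where sequences are objects of type $0\to\rho$ and $0\to\tau$. Furthermore, if $\rho=\tau=1$ and $\forall x\,\exists y\,A(x,y)$ is a sentence of $\mathcal L(\mathsf{RCA}_0)$, then the same implication holds with $\mathsf{RCA}_0$ in place of $\mathsf{RCA}_0^\omega$, where a sequence $\langle x_n\rangle$ of type $1$ objects is coded by one type $1$ object $X$ through $x_n=\lambda m.\,X((n,m))$ with the pairing $(n,m)=(n+m)^2+n$. -/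

import Mathlib

namespace FiniteType

/-! ### Types, terms and formulas of arithmetic in all finite types -/

/-- The finite types: `nat` is the type `0` of natural numbers, `arr ρ τ` is `ρ → τ`. -/
inductive Ty : Type
  | nat : Ty
  | arr : Ty → Ty → Ty

/-- The type `1 = 0 → 0` of number-theoretic functions (and of sets, given by their
characteristic functions). -/
abbrev Ty.one : Ty := Ty.arr Ty.nat Ty.nat

/-- Typed de Bruijn variables: `Var Γ σ` is the set of variables of type `σ` in the list `Γ` of
the types of the free variables (the most recently bound variable comes first). -/
inductive Var : List Ty → Ty → Type
  | zero {Γ : List Ty} {σ : Ty} : Var (σ :: Γ) σ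
  | succ {Γ : List Ty} {σ τ : Ty} : Var Γ σ → Var (τ :: Γ) σ

/-- Terms: variables, `0`, successor, addition, multiplication, the projectors `Π_{ρ,τ}`
(`proj`), the substitution combinators `Σ_{δ,ρ,τ}` (`comb`), the recursor `R₀` of type `0`
(`recr`), and application. -/
inductive Tm (Γ : List Ty) : Ty → Type
  | var {σ : Ty} : Var Γ σ → Tm Γ σ
  | zero : Tm Γ Ty.nat
  | succ : Tm Γ (Ty.arr Ty.nat Ty.nat)
  | add : Tm Γ (Ty.arr Ty.nat (Ty.arr Ty.nat Ty.nat))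
  | mul : Tm Γ (Ty.arr Ty.nat (Ty.arr Ty.nat Ty.nat))
  | proj (ρ τ : Ty) : Tm Γ (Ty.arr ρ (Ty.arr τ ρ))
  | comb (δ ρ τ : Ty) :
      Tm Γ (Ty.arr (Ty.arr δ (Ty.arr ρ τ)) (Ty.arr (Ty.arr δ ρ) (Ty.arr δ τ)))
  | recr : Tm Γ (Ty.arr Ty.nat (Ty.arr Ty.nat
      (Ty.arr (Ty.arr Ty.nat (Ty.arr Ty.nat Ty.nat)) Ty.nat)))
  | app {σ τ : Ty} : Tm Γ (Ty.arr σ τ) → Tm Γ σ → Tm Γ τ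

/-- Substitutions of terms over `Δ` for the variables of `Γ`. -/
abbrev Sub (Γ Δ : List Ty) : Type := ∀ σ : Ty, Var Γ σ → Tm Δ σ

/-- The substitution that regards each variable of `Γ` as a variable of `σ :: Γ`. -/
def Sub.shift (Γ : List Ty) (σ : Ty) : Sub Γ (σ :: Γ) := fun _ v => Tm.var (Var.succ v)

/-- Extend a substitution by a term for the most recent variable. -/
def Sub.cons {Γ Δ : List Ty} {ρ : Ty} (s : Sub Γ Δ) (t : Tm Δ ρ) : Sub (ρ :: Γ) Δ
  | _, Var.zero => t
  | _, Var.succ v => s _ v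

/-- The substitution with empty domain. -/
def Sub.nil (Δ : List Ty) : Sub [] Δ := fun _ v => nomatch v

/-- Simultaneous substitution in terms. -/
def Tm.subst {Γ Δ : List Ty} (s : Sub Γ Δ) : {σ : Ty} → Tm Γ σ → Tm Δ σ
  | _, Tm.var v => s _ v
  | _, Tm.zero => Tm.zero
  | _, Tm.succ => Tm.succ
  | _, Tm.add => Tm.add
  | _, Tm.mul => Tm.mul
  | _, Tm.proj ρ τ => Tm.proj ρ τ
  | _, Tm.comb δ ρ τ => Tm.comb δ ρ τ
  | _, Tm.recr => Tm.recr
  | _, Tm.app f a => Tm.app (f.subst s) (a.subst s)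

/-- Weakening of a term by a variable of type `ρ`. -/
def Tm.weaken {Γ : List Ty} {σ : Ty} (ρ : Ty) (t : Tm Γ σ) : Tm (ρ :: Γ) σ :=
  t.subst (Sub.shift Γ ρ)

/-- Extend a substitution under a binder. -/
def Sub.lift {Γ Δ : List Ty} (s : Sub Γ Δ) (ρ : Ty) : Sub (ρ :: Γ) (ρ :: Δ) :=
  Sub.cons (fun σ v => (s σ v).weaken ρ) (Tm.var Var.zero)

/-- The variable bound last, the one before it, and the third-last one, as terms. -/
abbrev Tm.v0 {Γ : List Ty} {σ : Ty} : Tm (σ :: Γ) σ := Tm.var Var.zero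
abbrev Tm.v1 {Γ : List Ty} {ρ σ : Ty} : Tm (ρ :: σ :: Γ) σ := Tm.var (Var.succ Var.zero)
abbrev Tm.v2 {Γ : List Ty} {δ ρ σ : Ty} : Tm (δ :: ρ :: σ :: Γ) σ :=
  Tm.var (Var.succ (Var.succ Var.zero))

/-- `λ`-abstraction of the most recent variable, defined from the combinators:
`λx.x = ΣΠΠ`, `λx.c = Πc` if `c` is a constant or another variable, and
`λx.fa = Σ(λx.f)(λx.a)`. -/
def Tm.lam {Γ : List Ty} {σ : Ty} : {τ : Ty} → Tm (σ :: Γ) τ → Tm Γ (Ty.arr σ τ)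
  | _, Tm.var Var.zero =>
      Tm.app (Tm.app (Tm.comb σ (Ty.arr σ σ) σ) (Tm.proj σ (Ty.arr σ σ))) (Tm.proj σ σ)
  | _, Tm.var (Var.succ v) => Tm.app (Tm.proj _ σ) (Tm.var v)
  | _, Tm.zero => Tm.app (Tm.proj _ σ) Tm.zero
  | _, Tm.succ => Tm.app (Tm.proj _ σ) Tm.succ
  | _, Tm.add => Tm.app (Tm.proj _ σ) Tm.add
  | _, Tm.mul => Tm.app (Tm.proj _ σ) Tm.mul
  | _, Tm.proj ρ τ => Tm.app (Tm.proj _ σ) (Tm.proj ρ τ)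
  | _, Tm.comb δ ρ τ => Tm.app (Tm.proj _ σ) (Tm.comb δ ρ τ)
  | _, Tm.recr => Tm.app (Tm.proj _ σ) Tm.recr
  | _, Tm.app f a => Tm.app (Tm.app (Tm.comb σ _ _) f.lam) a.lam

/-- `s + t`, `s · t` and `S t`. -/
def Tm.plus {Γ : List Ty} (s t : Tm Γ Ty.nat) : Tm Γ Ty.nat := Tm.app (Tm.app Tm.add s) t
def Tm.times {Γ : List Ty} (s t : Tm Γ Ty.nat) : Tm Γ Ty.nat := Tm.app (Tm.app Tm.mul s) t
def Tm.suc {Γ : List Ty} (t : Tm Γ Ty.nat) : Tm Γ Ty.nat := Tm.app Tm.succ t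

/-- `R₀ n y z`. -/
def Tm.rec0 {Γ : List Ty} (n y : Tm Γ Ty.nat)
    (z : Tm Γ (Ty.arr Ty.nat (Ty.arr Ty.nat Ty.nat))) : Tm Γ Ty.nat :=
  Tm.app (Tm.app (Tm.app Tm.recr n) y) z

/-- The number pairing of second order arithmetic, `(m, n) = (m + n)² + m`. -/
def Tm.pair {Γ : List Ty} (m n : Tm Γ Ty.nat) : Tm Γ Ty.nat :=
  ((m.plus n).times (m.plus n)).plus m

/-- Lists of arguments that bring a term of the given type down to type `0`. -/
inductive Args (Γ : List Ty) : Ty → Type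
  | nil : Args Γ Ty.nat
  | cons {σ τ : Ty} : Tm Γ σ → Args Γ τ → Args Γ (Ty.arr σ τ)

/-- `t u₁ … u_k`. -/
def Tm.applyArgs {Γ : List Ty} : {τ : Ty} → Tm Γ τ → Args Γ τ → Tm Γ Ty.nat
  | _, t, Args.nil => t
  | _, t, Args.cons u us => (Tm.app t u).applyArgs us

/-- Formulas over `Γ` in which all bound variables have a type in `V`. Prime formulas are the
equations of type `0` and `⊥`. Negation is an abbreviation. -/
inductive Fm (V : Ty → Prop) : List Ty → Type
  | eq {Γ : List Ty} : Tm Γ Ty.nat → Tm Γ Ty.nat → Fm V Γ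
  | bot {Γ : List Ty} : Fm V Γ
  | and {Γ : List Ty} : Fm V Γ → Fm V Γ → Fm V Γ
  | or {Γ : List Ty} : Fm V Γ → Fm V Γ → Fm V Γ
  | imp {Γ : List Ty} : Fm V Γ → Fm V Γ → Fm V Γ
  | all {Γ : List Ty} {σ : Ty} : V σ → Fm V (σ :: Γ) → Fm V Γ
  | ex {Γ : List Ty} {σ : Ty} : V σ → Fm V (σ :: Γ) → Fm V Γ

/-- All finite types are allowed for variables: the language of arithmetic in all finite types. -/
def AnyType : Ty → Prop := fun _ => True

/-- Only the types `0` and `1` are allowed for variables: the second order language. -/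
def SecondOrder : Ty → Prop := fun σ => σ = Ty.nat ∨ σ = Ty.one

theorem anyType (σ : Ty) : AnyType σ := trivial
theorem secondOrder_nat : SecondOrder Ty.nat := Or.inl rfl
theorem secondOrder_one : SecondOrder Ty.one := Or.inr rfl

namespace Fm

variable {V W : Ty → Prop}

def neg {Γ : List Ty} (A : Fm V Γ) : Fm V Γ := imp A bot

/-- Simultaneous (capture-avoiding) substitution in formulas. -/
def subst : {Γ Δ : List Ty} → Sub Γ Δ → Fm V Γ → Fm V Δ
  | _, _, s, eq a b => eq (a.subst s) (b.subst s)
  | _, _, _, bot => bot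
  | _, _, s, and A B => and (A.subst s) (B.subst s)
  | _, _, s, or A B => or (A.subst s) (B.subst s)
  | _, _, s, imp A B => imp (A.subst s) (B.subst s)
  | _, _, s, all h A => all h (A.subst (s.lift _))
  | _, _, s, ex h A => ex h (A.subst (s.lift _))

/-- Weakening of a formula by a variable of type `ρ`. -/
def weaken {Γ : List Ty} (ρ : Ty) (A : Fm V Γ) : Fm V (ρ :: Γ) := A.subst (Sub.shift Γ ρ)

/-- `A(t)`: substitution for the most recent variable. -/
def inst {Γ : List Ty} {σ : Ty} (A : Fm V (σ :: Γ)) (t : Tm Γ σ) : Fm V Γ :=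
  A.subst (Sub.cons (fun _ v => Tm.var v) t)

/-- A formula with variables of fewer types, read in a larger language. -/
def mono (h : ∀ σ, V σ → W σ) : {Γ : List Ty} → Fm V Γ → Fm W Γ
  | _, eq a b => eq a b
  | _, bot => bot
  | _, and A B => and (A.mono h) (B.mono h)
  | _, or A B => or (A.mono h) (B.mono h)
  | _, imp A B => imp (A.mono h) (B.mono h)
  | _, all hσ A => all (h _ hσ) (A.mono h)
  | _, ex hσ A => ex (h _ hσ) (A.mono h)

/-- Quantifier-free formulas. -/
def QFree : {Γ : List Ty} → Fm V Γ → Prop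
  | _, eq _ _ => True
  | _, bot => True
  | _, and A B => A.QFree ∧ B.QFree
  | _, or A B => A.QFree ∧ B.QFree
  | _, imp A B => A.QFree ∧ B.QFree
  | _, all _ _ => False
  | _, ex _ _ => False

/-- `∃`-free formulas: built from prime formulas by `∧`, `→` and `∀`. -/
def ExFree : {Γ : List Ty} → Fm V Γ → Prop
  | _, eq _ _ => True
  | _, bot => True
  | _, and A B => A.ExFree ∧ B.ExFree
  | _, or _ _ => False
  | _, imp A B => A.ExFree ∧ B.ExFree
  | _, all _ A => A.ExFree
  | _, ex _ _ => False

/-- Formulas `∃x₁ … ∃x_k A` with `A` an `∃`-free formula and `k ≥ 0`. -/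
def ExBlock : {Γ : List Ty} → Fm V Γ → Prop
  | _, ex _ A => A.ExBlock
  | _, A => A.ExFree

/-- The class `Γ₁`: it contains the prime formulas, is closed under `∧`, `∨`, `∀`, `∃`, and
contains `∃x₁ … ∃x_k A → B` for `A` an `∃`-free formula and `B` in `Γ₁`. -/
def Gamma1 : {Γ : List Ty} → Fm V Γ → Prop
  | _, eq _ _ => True
  | _, bot => True
  | _, and A B => A.Gamma1 ∧ B.Gamma1
  | _, or A B => A.Gamma1 ∧ B.Gamma1
  | _, imp A B => A.ExBlock ∧ B.Gamma1
  | _, all _ A => A.Gamma1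
  | _, ex _ A => A.Gamma1

end Fm

/-- All argument types of the given type are in `V`. -/
def ArgsIn (V : Ty → Prop) : Ty → Prop
  | Ty.nat => True
  | Ty.arr σ τ => V σ ∧ ArgsIn V τ

/-- Pointwise equality `s =_τ t` of higher type. It is a formula of the language with variables
of types in `V` when all argument types of `τ` are in `V`. -/
def Fm.eqAt {V : Ty → Prop} : {Γ : List Ty} → (τ : Ty) → ArgsIn V τ → Tm Γ τ → Tm Γ τ → Fm V Γ
  | _, Ty.nat, _, s, t => Fm.eq s t
  | _, Ty.arr σ τ, h, s, t =>
      Fm.all h.1 (Fm.eqAt τ h.2 (Tm.app (s.weaken σ) Tm.v0) (Tm.app (t.weaken σ) Tm.v0))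

/-! ### Derivations -/

/-- A set of axioms: formulas with free variables, read as universally quantified. -/
abbrev Theory (V : Ty → Prop) : Type := ∀ Γ : List Ty, Set (Fm V Γ)

/-- Natural deduction for many-sorted intuitionistic predicate logic, with axioms `T`:
`Der T Γ Δ A` says that `A` is derivable from the assumptions `Δ`, where all free variables are
among `Γ`. -/
inductive Der {V : Ty → Prop} (T : Theory V) :
    (Γ : List Ty) → List (Fm V Γ) → Fm V Γ → Prop
  | ax {Γ : List Ty} {Δ : List (Fm V Γ)} {A : Fm V Γ} : A ∈ T Γ → Der T Γ Δ A
  | hyp {Γ : List Ty} {Δ : List (Fm V Γ)} {A : Fm V Γ} : A ∈ Δ → Der T Γ Δ A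
  | botE {Γ : List Ty} {Δ : List (Fm V Γ)} {A : Fm V Γ} : Der T Γ Δ Fm.bot → Der T Γ Δ A
  | andI {Γ : List Ty} {Δ : List (Fm V Γ)} {A B : Fm V Γ} :
      Der T Γ Δ A → Der T Γ Δ B → Der T Γ Δ (Fm.and A B)
  | andE1 {Γ : List Ty} {Δ : List (Fm V Γ)} {A B : Fm V Γ} :
      Der T Γ Δ (Fm.and A B) → Der T Γ Δ A
  | andE2 {Γ : List Ty} {Δ : List (Fm V Γ)} {A B : Fm V Γ} :
      Der T Γ Δ (Fm.and A B) → Der T Γ Δ B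
  | orI1 {Γ : List Ty} {Δ : List (Fm V Γ)} {A B : Fm V Γ} :
      Der T Γ Δ A → Der T Γ Δ (Fm.or A B)
  | orI2 {Γ : List Ty} {Δ : List (Fm V Γ)} {A B : Fm V Γ} :
      Der T Γ Δ B → Der T Γ Δ (Fm.or A B)
  | orE {Γ : List Ty} {Δ : List (Fm V Γ)} {A B C : Fm V Γ} :
      Der T Γ Δ (Fm.or A B) → Der T Γ (A :: Δ) C → Der T Γ (B :: Δ) C → Der T Γ Δ C
  | impI {Γ : List Ty} {Δ : List (Fm V Γ)} {A B : Fm V Γ} :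
      Der T Γ (A :: Δ) B → Der T Γ Δ (Fm.imp A B)
  | impE {Γ : List Ty} {Δ : List (Fm V Γ)} {A B : Fm V Γ} :
      Der T Γ Δ (Fm.imp A B) → Der T Γ Δ A → Der T Γ Δ B
  | allI {Γ : List Ty} {Δ : List (Fm V Γ)} {σ : Ty} (h : V σ) {A : Fm V (σ :: Γ)} :
      Der T (σ :: Γ) (Δ.map (Fm.weaken σ)) A → Der T Γ Δ (Fm.all h A)
  | allE {Γ : List Ty} {Δ : List (Fm V Γ)} {σ : Ty} {h : V σ} {A : Fm V (σ :: Γ)}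
      (t : Tm Γ σ) : Der T Γ Δ (Fm.all h A) → Der T Γ Δ (A.inst t)
  | exI {Γ : List Ty} {Δ : List (Fm V Γ)} {σ : Ty} (h : V σ) {A : Fm V (σ :: Γ)}
      (t : Tm Γ σ) : Der T Γ Δ (A.inst t) → Der T Γ Δ (Fm.ex h A)
  | exE {Γ : List Ty} {Δ : List (Fm V Γ)} {σ : Ty} {h : V σ} {A : Fm V (σ :: Γ)}
      {B : Fm V Γ} : Der T Γ Δ (Fm.ex h A) →
      Der T (σ :: Γ) (A :: Δ.map (Fm.weaken σ)) (B.weaken σ) → Der T Γ Δ B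

/-- The sentence `A` is provable from the axioms `T`. -/
def Provable {V : Ty → Prop} (T : Theory V) (A : Fm V []) : Prop := Der T [] [] A

/-! ### Axioms -/

/-- The axioms of extensional Heyting arithmetic in the finite types with primitive recursion of
type `0` and quantifier-free induction, in the language with variables of types in `V`.
Each axiom is given with arbitrary terms in place of its universally quantified variables. The
axioms for the combinators are the equations `Π s t = s` and `Σ r s t = r t (s t)`, where equality
is pointwise, hence applied to arbitrary arguments that bring both sides down to type `0`. -/
inductive HA (V : Ty → Prop) : (Γ : List Ty) → Fm V Γ → Prop
  | eq_refl {Γ : List Ty} (s : Tm Γ Ty.nat) : HA V Γ (Fm.eq s s)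
  | eq_symm {Γ : List Ty} (s t : Tm Γ Ty.nat) : HA V Γ (Fm.imp (Fm.eq s t) (Fm.eq t s))
  | eq_trans {Γ : List Ty} (r s t : Tm Γ Ty.nat) :
      HA V Γ (Fm.imp (Fm.and (Fm.eq r s) (Fm.eq s t)) (Fm.eq r t))
  /-- The extensionality scheme. -/
  | ext {Γ : List Ty} {ρ τ : Ty} (hρ : ArgsIn V ρ) (hτ : ArgsIn V τ)
      (s t : Tm Γ ρ) (r : Tm Γ (Ty.arr ρ τ)) :
      HA V Γ (Fm.imp (Fm.eqAt ρ hρ s t) (Fm.eqAt τ hτ (Tm.app r s) (Tm.app r t)))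
  | succ_ne_zero {Γ : List Ty} (s : Tm Γ Ty.nat) : HA V Γ (Fm.neg (Fm.eq s.suc Tm.zero))
  | succ_inj {Γ : List Ty} (s t : Tm Γ Ty.nat) :
      HA V Γ (Fm.imp (Fm.eq s.suc t.suc) (Fm.eq s t))
  | add_zero {Γ : List Ty} (s : Tm Γ Ty.nat) : HA V Γ (Fm.eq (s.plus Tm.zero) s)
  | add_succ {Γ : List Ty} (s t : Tm Γ Ty.nat) :
      HA V Γ (Fm.eq (s.plus t.suc) (s.plus t).suc)
  | mul_zero {Γ : List Ty} (s : Tm Γ Ty.nat) : HA V Γ (Fm.eq (s.times Tm.zero) Tm.zero)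
  | mul_succ {Γ : List Ty} (s t : Tm Γ Ty.nat) :
      HA V Γ (Fm.eq (s.times t.suc) ((s.times t).plus s))
  | proj {Γ : List Ty} {ρ τ : Ty} (s : Tm Γ ρ) (t : Tm Γ τ) (u : Args Γ ρ) :
      HA V Γ (Fm.eq ((Tm.app (Tm.app (Tm.proj ρ τ) s) t).applyArgs u) (s.applyArgs u))
  | comb {Γ : List Ty} {δ ρ τ : Ty} (r : Tm Γ (Ty.arr δ (Ty.arr ρ τ))) (s : Tm Γ (Ty.arr δ ρ))
      (t : Tm Γ δ) (u : Args Γ τ) :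
      HA V Γ (Fm.eq ((Tm.app (Tm.app (Tm.app (Tm.comb δ ρ τ) r) s) t).applyArgs u)
        ((Tm.app (Tm.app r t) (Tm.app s t)).applyArgs u))
  | rec_zero {Γ : List Ty} (y : Tm Γ Ty.nat) (z : Tm Γ (Ty.arr Ty.nat (Ty.arr Ty.nat Ty.nat))) :
      HA V Γ (Fm.eq (Tm.rec0 Tm.zero y z) y)
  | rec_succ {Γ : List Ty} (n y : Tm Γ Ty.nat)
      (z : Tm Γ (Ty.arr Ty.nat (Ty.arr Ty.nat Ty.nat))) :
      HA V Γ (Fm.eq (Tm.rec0 n.suc y z) (Tm.app (Tm.app z (Tm.rec0 n y z)) n))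
  /-- Induction `A(0) ∧ ∀n (A(n) → A(n+1)) → ∀n A(n)` for quantifier-free formulas. -/
  | induction {Γ : List Ty} (h : V Ty.nat) (A : Fm V (Ty.nat :: Γ)) (hA : A.QFree) :
      HA V Γ (Fm.imp
        (Fm.and (A.inst Tm.zero)
          (Fm.all h (Fm.imp A (A.subst (Sub.cons (Sub.shift Γ Ty.nat) Tm.v0.suc)))))
        (Fm.all h A))

/-- For `A(x, y)` with the variables `x : ρ`, `y : τ` in this order, the formula `A(x, Y(x))`
with the variables `Y : ρ → τ`, `x : ρ` in this order. -/
def Fm.choiceInst {V : Ty → Prop} {Γ : List Ty} {ρ τ : Ty} (A : Fm V (τ :: ρ :: Γ)) :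
    Fm V (ρ :: Ty.arr ρ τ :: Γ) :=
  A.subst (Sub.cons (Sub.cons (fun _ v => Tm.var (Var.succ (Var.succ v))) Tm.v0)
    (Tm.app Tm.v1 Tm.v0))

/-- The axiom of choice `∀x ∃y A(x,y) → ∃Y ∀x A(x,Y(x))` in all finite types. -/
inductive AC (V : Ty → Prop) : (Γ : List Ty) → Fm V Γ → Prop
  | mk {Γ : List Ty} {ρ τ : Ty} (hρ : V ρ) (hτ : V τ) (hY : V (Ty.arr ρ τ))
      (A : Fm V (τ :: ρ :: Γ)) :
      AC V Γ (Fm.imp (Fm.all hρ (Fm.ex hτ A)) (Fm.ex hY (Fm.all hρ A.choiceInst)))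

/-- The axiom of choice for quantifier-free formulas, `x` of type `ρ` and `y` of type `τ`. -/
inductive QFAC (V : Ty → Prop) (ρ τ : Ty) : (Γ : List Ty) → Fm V Γ → Prop
  | mk {Γ : List Ty} (hρ : V ρ) (hτ : V τ) (hY : V (Ty.arr ρ τ))
      (A : Fm V (τ :: ρ :: Γ)) (hA : A.QFree) :
      QFAC V ρ τ Γ (Fm.imp (Fm.all hρ (Fm.ex hτ A)) (Fm.ex hY (Fm.all hρ A.choiceInst)))

/-- Independence of premise `(A → ∃x B(x)) → ∃x (A → B(x))` for `∃`-free `A` without `x`. -/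
inductive IPef (V : Ty → Prop) : (Γ : List Ty) → Fm V Γ → Prop
  | mk {Γ : List Ty} {σ : Ty} (h : V σ) (A : Fm V Γ) (hA : A.ExFree) (B : Fm V (σ :: Γ)) :
      IPef V Γ (Fm.imp (Fm.imp A (Fm.ex h B)) (Fm.ex h (Fm.imp (A.weaken σ) B)))

/-- The law of the excluded middle. -/
inductive LEM (V : Ty → Prop) : (Γ : List Ty) → Fm V Γ → Prop
  | mk {Γ : List Ty} (A : Fm V Γ) : LEM V Γ (Fm.or A A.neg)

/-- The intuitionistic system `I₀`: extensional Heyting arithmetic in all finite types with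
restricted recursion and induction, plus choice and independence of premise. -/
def I0 : Theory AnyType := fun Γ => {A | HA AnyType Γ A ∨ AC AnyType Γ A ∨ IPef AnyType Γ A}

/-- The classical system `RCA₀^ω`. -/
def RCA0omega : Theory AnyType :=
  fun Γ => {A | HA AnyType Γ A ∨ QFAC AnyType Ty.one Ty.nat Γ A ∨ LEM AnyType Γ A}

/-- The classical second order system `RCA₀` (in its version with functions). -/
def RCA0 : Theory SecondOrder :=
  fun Γ => {A | HA SecondOrder Γ A ∨ QFAC SecondOrder Ty.nat Ty.nat Γ A ∨ LEM SecondOrder Γ A}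

/-! ### Sequential forms -/

/-- The sentence `∀x^ρ ∃y^τ A(x,y)`. -/
def allEx {ρ τ : Ty} (A : Fm AnyType [τ, ρ]) : Fm AnyType [] :=
  Fm.all (anyType ρ) (Fm.ex (anyType τ) A)

/-- `∀⟨xₙ⟩ ∃⟨yₙ⟩ ∀n A(xₙ, yₙ)`, where sequences are objects of type `0 → ρ` and `0 → τ`. -/
def seqForm {ρ τ : Ty} (A : Fm AnyType [τ, ρ]) : Fm AnyType [] :=
  Fm.all (anyType (Ty.arr Ty.nat ρ)) (Fm.ex (anyType (Ty.arr Ty.nat τ)) (Fm.all (anyType Ty.nat)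
    (A.subst (Sub.cons (Sub.cons (Sub.nil _) (Tm.app Tm.v2 Tm.v0)) (Tm.app Tm.v1 Tm.v0)))))

/-- The `n`-th member `λm. X((n, m))` of the sequence of functions (sets) coded by `X`. -/
def Tm.row {Γ : List Ty} (X : Tm Γ Ty.one) (n : Tm Γ Ty.nat) : Tm Γ Ty.one :=
  Tm.lam (Tm.app (X.weaken Ty.nat) (Tm.pair (n.weaken Ty.nat) Tm.v0))

/-- The sentence `∀x¹ ∃y¹ A(x,y)` of the second order language. -/
def allEx2 (A : Fm SecondOrder [Ty.one, Ty.one]) : Fm SecondOrder [] :=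
  Fm.all secondOrder_one (Fm.ex secondOrder_one A)

/-- `∀⟨xₙ⟩ ∃⟨yₙ⟩ ∀n A(xₙ, yₙ)` in the second order language, where a sequence of functions (sets)
is coded by a single one. -/
def seqForm2 (A : Fm SecondOrder [Ty.one, Ty.one]) : Fm SecondOrder [] :=
  Fm.all secondOrder_one (Fm.ex secondOrder_one (Fm.all secondOrder_nat
    (A.subst (Sub.cons (Sub.cons (Sub.nil _) (Tm.row Tm.v2 Tm.v0)) (Tm.row Tm.v1 Tm.v0)))))

/-- A formula of the second order language, read in the language of all finite types. -/
def Fm.toAny {Γ : List Ty} (A : Fm SecondOrder Γ) : Fm AnyType Γ := A.mono fun σ _ => anyType σ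

end FiniteType

/-!
Suppose that a classical theory containing the axioms of arithmetic does not prove the sequential
form. By completeness for many-sorted logic (a Henkin chain and its term model) it has a model in
which the sequential form fails. This model can be taken extensional. In the language of all finite
types, one identifies pointwise equal objects. In the second order language, one replaces the higher
types by functionals over the numbers of the model that preserve *plots*, where the plots of type
`0` are the number functions of the model; this leaves its objects of types `0` and `1`, hence
second order truth, unchanged.

In an extensional model, modified realizability by the objects of the model is sound for `I₀`:
choice and independence of premise have realizers, and quantifier-free formulas are decided by
objects of the model. An `∃`-free formula is true exactly if a canonical object realizes it, hence
realizable formulas of `Γ₁` are true. A proof of `∀x ∃y A(x, y)` in `I₀` therefore yields a single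
object `t` with `A(x, t x)` for all `x`, and `λn. t (xₙ)` is the required sequence of witnesses.
-/

namespace FiniteType

variable {V W : Ty → Prop} {Γ Δ Θ : List Ty} {δ ρ σ τ : Ty}

/-! ### Substitution -/

/-- The identity substitution. -/
abbrev Sub.id (Γ : List Ty) : Sub Γ Γ := fun _ v => Tm.var v

/-- Composition of substitutions: first `s`, then `r`. -/
abbrev Sub.comp (s : Sub Γ Δ) (r : Sub Δ Θ) : Sub Γ Θ := fun σ v => (s σ v).subst r

theorem Sub.eq_nil (s : Sub [] Δ) : s = Sub.nil Δ := by
  funext σ v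
  cases v

theorem Tm.subst_subst (s : Sub Γ Δ) (r : Sub Δ Θ) (t : Tm Γ σ) :
    (t.subst s).subst r = t.subst (s.comp r) := by
  induction t with
  | app f a hf ha => simp only [Tm.subst, hf, ha]
  | _ => rfl

theorem Tm.subst_id (t : Tm Γ σ) : t.subst (Sub.id Γ) = t := by
  induction t with
  | app f a hf ha => simp only [Tm.subst, hf, ha]
  | _ => rfl

theorem Tm.weaken_subst_lift (t : Tm Γ σ) (s : Sub Γ Δ) :
    (t.weaken ρ).subst (s.lift ρ) = (t.subst s).weaken ρ := by
  rw [Tm.weaken, Tm.weaken, Tm.subst_subst, Tm.subst_subst]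
  rfl

theorem Sub.lift_comp_lift (s : Sub Γ Δ) (r : Sub Δ Θ) (ρ : Ty) :
    (s.lift ρ).comp (r.lift ρ) = (s.comp r).lift ρ := by
  funext σ v
  cases v with
  | zero => rfl
  | succ v => exact Tm.weaken_subst_lift (s _ v) r

theorem Sub.lift_id (Γ : List Ty) (ρ : Ty) : (Sub.id Γ).lift ρ = Sub.id (ρ :: Γ) := by
  funext σ v
  cases v <;> rfl

theorem Sub.shift_cons_v0 (Γ : List Ty) (ρ : Ty) :
    (Sub.shift Γ ρ).cons Tm.v0 = Sub.id (ρ :: Γ) := by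
  funext σ v
  cases v <;> rfl

theorem Fm.subst_subst (A : Fm V Γ) (s : Sub Γ Δ) (r : Sub Δ Θ) :
    (A.subst s).subst r = A.subst (s.comp r) := by
  induction A generalizing Δ Θ <;>
    simp only [Fm.subst, Tm.subst_subst, Sub.lift_comp_lift, *]

theorem Fm.subst_id (A : Fm V Γ) : A.subst (Sub.id Γ) = A := by
  induction A <;> simp only [Fm.subst, Tm.subst_id, Sub.lift_id, *]

theorem Fm.eqAt_subst (h : ArgsIn V τ) (s t : Tm Γ τ) (r : Sub Γ Δ) :
    (Fm.eqAt τ h s t).subst r = Fm.eqAt τ h (s.subst r) (t.subst r) := by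
  induction τ generalizing Γ Δ with
  | nat => rfl
  | arr σ τ _ ih =>
    simp only [Fm.eqAt, Fm.subst, ih, Tm.subst, Tm.weaken_subst_lift]
    rfl

/-! ### Type structures -/

/-- The data of a structure for the language of arithmetic in all finite types. The objects of
type `0` are names of numbers: `val` maps them to the numbers `N` of the structure, and two of
them are equal in the sense of `=₀` when they name the same number. -/
structure TypeStructure where
  D : Ty → Type
  N : Type
  val : D Ty.nat → N
  app : {σ τ : Ty} → D (Ty.arr σ τ) → D σ → D τ
  zero : D Ty.nat
  succ : D (Ty.arr Ty.nat Ty.nat)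
  add : D (Ty.arr Ty.nat (Ty.arr Ty.nat Ty.nat))
  mul : D (Ty.arr Ty.nat (Ty.arr Ty.nat Ty.nat))
  proj : (ρ τ : Ty) → D (Ty.arr ρ (Ty.arr τ ρ))
  comb : (δ ρ τ : Ty) → D (Ty.arr (Ty.arr δ (Ty.arr ρ τ)) (Ty.arr (Ty.arr δ ρ) (Ty.arr δ τ)))
  recr : D (Ty.arr Ty.nat (Ty.arr Ty.nat (Ty.arr (Ty.arr Ty.nat (Ty.arr Ty.nat Ty.nat)) Ty.nat)))

namespace TypeStructure

/-- Objects of functional type are written as functions: `f a` is `M.app f a`. -/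
instance {M : TypeStructure} {σ τ : Ty} : CoeFun (M.D (Ty.arr σ τ)) fun _ => M.D σ → M.D τ :=
  ⟨M.app⟩

/-- The equality `=_σ` of a structure, defined pointwise from `=₀`. -/
def PtEq (M : TypeStructure) : (σ : Ty) → M.D σ → M.D σ → Prop
  | Ty.nat, a, b => M.val a = M.val b
  | Ty.arr σ τ, f, g => ∀ a : M.D σ, M.PtEq τ (f a) (g a)

/-- The laws of arithmetic in all finite types, with extensionality for the types allowed by `V`,
which include the type `0`. A structure is only considered for one `V` at a time. Quantifier-free
induction is only kept for disjunctions of two equations `f n = g n ∨ f' n = g' n` between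
functions of the structure; this is enough to develop primitive recursive arithmetic. -/
class IsModel (V : outParam (Ty → Prop)) (M : TypeStructure) : Prop where
  nat_mem : V Ty.nat
  val_surj : Function.Surjective M.val
  ext : ∀ {ρ τ : Ty}, ArgsIn V ρ → ArgsIn V τ → ∀ (s t : M.D ρ) (r : M.D (Ty.arr ρ τ)),
    M.PtEq ρ s t → M.PtEq τ (r s) (r t)
  succ_ne_zero : ∀ a, M.val (M.succ a) ≠ M.val M.zero
  succ_inj : ∀ a b, M.val (M.succ a) = M.val (M.succ b) → M.val a = M.val b
  add_zero : ∀ a, M.val (M.add a M.zero) = M.val a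
  add_succ : ∀ a b, M.val (M.add a (M.succ b)) = M.val (M.succ (M.add a b))
  mul_zero : ∀ a, M.val (M.mul a M.zero) = M.val M.zero
  mul_succ : ∀ a b, M.val (M.mul a (M.succ b)) = M.val (M.add (M.mul a b) a)
  proj_eq : ∀ {ρ τ : Ty} (s : M.D ρ) (t : M.D τ), M.PtEq ρ (M.proj ρ τ s t) s
  comb_eq : ∀ {δ ρ τ : Ty} (r : M.D (Ty.arr δ (Ty.arr ρ τ))) (s : M.D (Ty.arr δ ρ)) (t : M.D δ),
    M.PtEq τ (M.comb δ ρ τ r s t) (r t (s t))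
  rec_zero : ∀ y z, M.val (M.recr M.zero y z) = M.val y
  rec_succ : ∀ n y z, M.val (M.recr (M.succ n) y z) = M.val (z (M.recr n y z) n)
  ind : ∀ f g f' g' : M.D Ty.one,
    (M.val (f M.zero) = M.val (g M.zero) ∨ M.val (f' M.zero) = M.val (g' M.zero)) →
    (∀ a, (M.val (f a) = M.val (g a) ∨ M.val (f' a) = M.val (g' a)) →
      (M.val (f (M.succ a)) = M.val (g (M.succ a)) ∨
        M.val (f' (M.succ a)) = M.val (g' (M.succ a)))) →
    ∀ a, M.val (f a) = M.val (g a) ∨ M.val (f' a) = M.val (g' a)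

variable {M : TypeStructure}

theorem PtEq.refl : ∀ {σ : Ty} (a : M.D σ), M.PtEq σ a a
  | Ty.nat, _ => rfl
  | Ty.arr _ _, f => fun a => PtEq.refl (f a)

theorem PtEq.symm : ∀ {σ : Ty} {a b : M.D σ}, M.PtEq σ a b → M.PtEq σ b a
  | Ty.nat, _, _, h => Eq.symm h
  | Ty.arr _ _, _, _, h => fun a => PtEq.symm (h a)

theorem PtEq.trans : ∀ {σ : Ty} {a b c : M.D σ}, M.PtEq σ a b → M.PtEq σ b c → M.PtEq σ a c
  | Ty.nat, _, _, _, h, h' => Eq.trans h h'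
  | Ty.arr _ _, _, _, _, h, h' => fun a => PtEq.trans (h a) (h' a)

/-- Environments: objects of the structure for the variables of `Γ`. -/
abbrev Env (M : TypeStructure) (Γ : List Ty) : Type := ∀ σ : Ty, Var Γ σ → M.D σ

namespace Env

/-- The environment with empty domain. -/
def nil (M : TypeStructure) : M.Env [] := fun _ v => nomatch v

/-- Extend an environment by an object for the most recent variable. -/
def cons (e : M.Env Γ) (d : M.D ρ) : M.Env (ρ :: Γ)
  | _, Var.zero => d
  | _, Var.succ v => e _ v

/-- Forget the object for the most recent variable. -/
def tail (e : M.Env (ρ :: Γ)) : M.Env Γ := fun _ v => e _ (Var.succ v)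

/-- The object for the most recent variable. -/
def head (e : M.Env (ρ :: Γ)) : M.D ρ := e _ Var.zero

@[simp] theorem cons_zero (e : M.Env Γ) (d : M.D ρ) : e.cons d ρ Var.zero = d := rfl

@[simp] theorem cons_succ (e : M.Env Γ) (d : M.D ρ) (v : Var Γ σ) :
    e.cons d σ (Var.succ v) = e σ v := rfl

@[simp] theorem tail_cons (e : M.Env Γ) (d : M.D ρ) : (e.cons d).tail = e := rfl

@[simp] theorem cons_head_tail (e : M.Env (ρ :: Γ)) : e.tail.cons e.head = e := by
  funext σ v
  cases v <;> rfl

theorem eq_nil (e : M.Env []) : e = nil M := by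
  funext σ v
  cases v

end Env

/-- The value of a term. -/
def eval (M : TypeStructure) (e : M.Env Γ) : {σ : Ty} → Tm Γ σ → M.D σ
  | _, Tm.var v => e _ v
  | _, Tm.zero => M.zero
  | _, Tm.succ => M.succ
  | _, Tm.add => M.add
  | _, Tm.mul => M.mul
  | _, Tm.proj ρ τ => M.proj ρ τ
  | _, Tm.comb δ ρ τ => M.comb δ ρ τ
  | _, Tm.recr => M.recr
  | _, Tm.app f a => (M.eval e f) (M.eval e a)

/-- The environment for `Γ` that a substitution `s` induces from one for `Δ`: the variables of `Γ`
denote the values of the terms which `s` puts in their place. -/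
def Env.sub (e : M.Env Δ) (s : Sub Γ Δ) : M.Env Γ := fun σ v => M.eval e (s σ v)

theorem eval_subst (s : Sub Γ Δ) (e : M.Env Δ) (t : Tm Γ σ) :
    M.eval e (t.subst s) = M.eval (e.sub s) t := by
  induction t with
  | app f a hf ha => simp only [Tm.subst, eval, hf, ha]
  | _ => rfl

theorem eval_weaken (e : M.Env (ρ :: Γ)) (t : Tm Γ σ) :
    M.eval e (t.weaken ρ) = M.eval e.tail t :=
  eval_subst _ _ _

theorem Env.sub_lift (s : Sub Γ Δ) (e : M.Env Δ) (d : M.D ρ) :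
    (e.cons d).sub (s.lift ρ) = (e.sub s).cons d := by
  funext σ v
  cases v with
  | zero => rfl
  | succ v => exact eval_weaken _ _

theorem Env.sub_cons (s : Sub Γ Δ) (t : Tm Δ ρ) (e : M.Env Δ) :
    e.sub (s.cons t) = (e.sub s).cons (M.eval e t) := by
  funext σ v
  cases v <;> rfl

@[simp] theorem Env.sub_id (e : M.Env Γ) : e.sub (Sub.id Γ) = e := rfl

/-- Truth of a formula under an environment. -/
def Sat (M : TypeStructure) : {Γ : List Ty} → M.Env Γ → Fm V Γ → Prop
  | _, e, Fm.eq a b => M.val (M.eval e a) = M.val (M.eval e b)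
  | _, _, Fm.bot => False
  | _, e, Fm.and A B => M.Sat e A ∧ M.Sat e B
  | _, e, Fm.or A B => M.Sat e A ∨ M.Sat e B
  | _, e, Fm.imp A B => M.Sat e A → M.Sat e B
  | _, e, Fm.all (σ := σ) _ A => ∀ d : M.D σ, M.Sat (e.cons d) A
  | _, e, Fm.ex (σ := σ) _ A => ∃ d : M.D σ, M.Sat (e.cons d) A

theorem sat_subst (A : Fm V Γ) (s : Sub Γ Δ) (e : M.Env Δ) :
    M.Sat e (A.subst s) ↔ M.Sat (e.sub s) A := by
  induction A generalizing Δ <;> simp only [Fm.subst, Sat, eval_subst, Env.sub_lift, *]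

theorem sat_mono (h : ∀ σ, V σ → W σ) (A : Fm V Γ) (e : M.Env Γ) :
    M.Sat e (A.mono h) ↔ M.Sat e A := by
  induction A <;> simp only [Fm.mono, Sat, *]

theorem sat_eqAt (h : ArgsIn V τ) (e : M.Env Γ) (s t : Tm Γ τ) :
    M.Sat e (Fm.eqAt τ h s t) ↔ M.PtEq τ (M.eval e s) (M.eval e t) := by
  induction τ generalizing Γ with
  | nat => rfl
  | arr σ τ _ ih =>
    simp only [Fm.eqAt, Sat, ih, eval, eval_weaken, Env.tail_cons, PtEq, Env.cons_zero]

end TypeStructure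

/-! ### Primitive recursive arithmetic -/

/-- Numbers with classes `Fun₁`, `Fun₂` of unary and binary functions that are closed under
composition and primitive recursion and satisfy induction for disjunctions of two equations. -/
class PrimRecArith (N : Type) extends Zero N, Add N, Mul N where
  succ : N → N
  Fun₁ : (N → N) → Prop
  Fun₂ : (N → N → N) → Prop
  succ_ne_zero : ∀ x, succ x ≠ 0
  succ_inj : ∀ x y, succ x = succ y → x = y
  protected add_zero : ∀ x : N, x + 0 = x
  add_succ : ∀ x y, x + succ y = succ (x + y)
  protected mul_zero : ∀ x : N, x * 0 = 0
  mul_succ : ∀ x y, x * succ y = x * y + x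
  fun₁_id : Fun₁ fun x => x
  fun₁_const : ∀ c, Fun₁ fun _ => c
  fun₁_succ : Fun₁ succ
  fun₂_add : Fun₂ fun x y => x + y
  fun₂_mul : Fun₂ fun x y => x * y
  fun₂_fst : Fun₂ fun x _ => x
  fun₂_snd : Fun₂ fun _ y => y
  fun₁_comp₂ : ∀ {h f g}, Fun₂ h → Fun₁ f → Fun₁ g → Fun₁ fun x => h (f x) (g x)
  fun₂_comp₁ : ∀ {f g}, Fun₁ f → Fun₂ g → Fun₂ fun x y => f (g x y)
  fun₂_comp₂ : ∀ {h f g}, Fun₂ h → Fun₂ f → Fun₂ g → Fun₂ fun x y => h (f x y) (g x y)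
  exists_rec_succ : ∀ {h}, Fun₂ h →
    ∃ R, Fun₂ R ∧ (∀ y, R 0 y = y) ∧ ∀ n y, R (succ n) y = h (R n y) n
  ind_or : ∀ {f g f' g'}, Fun₁ f → Fun₁ g → Fun₁ f' → Fun₁ g' → (f 0 = g 0 ∨ f' 0 = g' 0) →
    (∀ x, (f x = g x ∨ f' x = g' x) → (f (succ x) = g (succ x) ∨ f' (succ x) = g' (succ x))) →
    ∀ x, f x = g x ∨ f' x = g' x

namespace PrimRecArith

variable {N : Type} [PrimRecArith N] {f g : N → N}

theorem Fun₁.comp (hf : Fun₁ f) (hg : Fun₁ g) : Fun₁ fun x => f (g x) :=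
  fun₁_comp₂ (fun₂_comp₁ hf fun₂_fst) hg hg

theorem Fun₁.add (hf : Fun₁ f) (hg : Fun₁ g) : Fun₁ fun x => f x + g x :=
  fun₁_comp₂ fun₂_add hf hg

theorem Fun₁.mul (hf : Fun₁ f) (hg : Fun₁ g) : Fun₁ fun x => f x * g x :=
  fun₁_comp₂ fun₂_mul hf hg

theorem Fun₁.succ (hf : Fun₁ f) : Fun₁ fun x => PrimRecArith.succ (f x) :=
  fun₁_succ.comp hf

theorem ind_succ (hf : Fun₁ f) (hg : Fun₁ g) (h0 : f 0 = g 0)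
    (h : ∀ x, f x = g x → f (succ x) = g (succ x)) (x : N) : f x = g x :=
  or_self_iff.1 (ind_or hf hg hf hg (Or.inl h0) (fun x hx => Or.inl (h x (or_self_iff.1 hx))) x)

protected theorem zero_add (x : N) : 0 + x = x :=
  ind_succ ((fun₁_const 0).add fun₁_id) fun₁_id (PrimRecArith.add_zero 0)
    (fun x h => by rw [add_succ, h]) x

theorem succ_add (x y : N) : succ x + y = succ (x + y) :=
  ind_succ ((fun₁_const (succ x)).add fun₁_id) ((fun₁_const x).add fun₁_id).succ
    (by simp only [PrimRecArith.add_zero]) (fun y h => by simp only [add_succ, h]) y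

protected theorem add_comm (x y : N) : x + y = y + x :=
  ind_succ ((fun₁_const x).add fun₁_id) (fun₁_id.add (fun₁_const x))
    (by simp only [PrimRecArith.add_zero, PrimRecArith.zero_add])
    (fun y h => by simp only [add_succ, succ_add, h]) y

protected theorem add_assoc (x y z : N) : x + y + z = x + (y + z) :=
  ind_succ ((fun₁_const (x + y)).add fun₁_id) ((fun₁_const x).add ((fun₁_const y).add fun₁_id))
    (by simp only [PrimRecArith.add_zero]) (fun z h => by simp only [add_succ, h]) z

protected theorem zero_mul (x : N) : 0 * x = 0 :=
  ind_succ ((fun₁_const 0).mul fun₁_id) (fun₁_const 0) (PrimRecArith.mul_zero 0)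
    (fun x h => by rw [mul_succ, h, PrimRecArith.add_zero]) x

theorem succ_mul (x y : N) : succ x * y = x * y + y :=
  ind_succ ((fun₁_const (succ x)).mul fun₁_id) (((fun₁_const x).mul fun₁_id).add fun₁_id)
    (by simp only [PrimRecArith.mul_zero, PrimRecArith.add_zero])
    (fun y h => by
      simp only [mul_succ, h, add_succ, PrimRecArith.add_assoc]
      rw [PrimRecArith.add_comm y x]) y

protected theorem mul_comm (x y : N) : x * y = y * x :=
  ind_succ ((fun₁_const x).mul fun₁_id) (fun₁_id.mul (fun₁_const x))
    (by simp only [PrimRecArith.mul_zero, PrimRecArith.zero_mul])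
    (fun y h => by simp only [mul_succ, succ_mul, h]) y

protected theorem mul_add (x y z : N) : x * (y + z) = x * y + x * z :=
  ind_succ ((fun₁_const x).mul ((fun₁_const y).add fun₁_id))
    ((fun₁_const (x * y)).add ((fun₁_const x).mul fun₁_id))
    (by simp only [PrimRecArith.mul_zero, PrimRecArith.add_zero])
    (fun z h => by simp only [add_succ, mul_succ, h, PrimRecArith.add_assoc]) z

protected theorem mul_assoc (x y z : N) : x * y * z = x * (y * z) :=
  ind_succ ((fun₁_const (x * y)).mul fun₁_id) ((fun₁_const x).mul ((fun₁_const y).mul fun₁_id))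
    (by simp only [PrimRecArith.mul_zero])
    (fun z h => by simp only [mul_succ, h, PrimRecArith.mul_add]) z

protected theorem mul_one (x : N) : x * succ 0 = x := by
  rw [mul_succ, PrimRecArith.mul_zero, PrimRecArith.zero_add]

noncomputable instance : CommSemiring N where
  add_assoc := PrimRecArith.add_assoc
  zero_add := PrimRecArith.zero_add
  add_zero := PrimRecArith.add_zero
  nsmul := nsmulRec
  npow := @npowRec N ⟨succ 0⟩ _
  add_comm := PrimRecArith.add_comm
  left_distrib := PrimRecArith.mul_add
  right_distrib x y z := by
    rw [PrimRecArith.mul_comm, PrimRecArith.mul_add, PrimRecArith.mul_comm z x,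
      PrimRecArith.mul_comm z y]
  zero_mul := PrimRecArith.zero_mul
  mul_zero := PrimRecArith.mul_zero
  mul_assoc := PrimRecArith.mul_assoc
  one := succ 0
  one_mul x := (PrimRecArith.mul_comm _ _).trans (PrimRecArith.mul_one x)
  mul_one := PrimRecArith.mul_one
  mul_comm := PrimRecArith.mul_comm

theorem succ_eq_add_one (x : N) : succ x = x + 1 := by
  change succ x = x + succ 0
  rw [add_succ, add_zero]

theorem add_one_ne_zero (x : N) : x + 1 ≠ 0 :=
  succ_eq_add_one x ▸ succ_ne_zero x

theorem add_one_inj {x y : N} (h : x + 1 = y + 1) : x = y := by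
  rw [← succ_eq_add_one, ← succ_eq_add_one] at h
  exact succ_inj _ _ h

theorem induct (hf : Fun₁ f) (hg : Fun₁ g) (h0 : f 0 = g 0)
    (h : ∀ x, f x = g x → f (x + 1) = g (x + 1)) (x : N) : f x = g x :=
  ind_succ hf hg h0 (fun x hx => by rw [succ_eq_add_one]; exact h x hx) x

theorem fun₂_const (c : N) : Fun₂ fun _ _ : N => c :=
  fun₂_comp₁ (fun₁_const c) fun₂_fst

theorem Fun₂.add {f g : N → N → N} (hf : Fun₂ f) (hg : Fun₂ g) : Fun₂ fun x y => f x y + g x y :=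
  fun₂_comp₂ fun₂_add hf hg

theorem Fun₂.mul {f g : N → N → N} (hf : Fun₂ f) (hg : Fun₂ g) : Fun₂ fun x y => f x y * g x y :=
  fun₂_comp₂ fun₂_mul hf hg

theorem Fun₂.left {f : N → N → N} (hf : Fun₂ f) (y : N) : Fun₁ fun x => f x y :=
  fun₁_comp₂ hf fun₁_id (fun₁_const y)

theorem exists_rec {h : N → N → N} (hh : Fun₂ h) :
    ∃ R : N → N → N, Fun₂ R ∧ (∀ y, R 0 y = y) ∧ ∀ n y, R (n + 1) y = h (R n y) n := by
  obtain ⟨R, hR, h0, hs⟩ := exists_rec_succ hh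
  exact ⟨R, hR, h0, fun n y => by rw [← succ_eq_add_one, hs]⟩

/-! ### Truncated subtraction and distance -/

theorem exists_pred : ∃ p : N → N, Fun₁ p ∧ p 0 = 0 ∧ ∀ x, p (x + 1) = x := by
  obtain ⟨R, hR, h0, hs⟩ := exists_rec (N := N) fun₂_snd
  exact ⟨fun x => R x 0, hR.left 0, h0 0, fun x => hs x 0⟩

/-- The predecessor, with `pred 0 = 0`. -/
noncomputable def pred : N → N := exists_pred.choose

theorem fun₁_pred : Fun₁ (pred : N → N) := exists_pred.choose_spec.1

@[simp] theorem pred_zero : pred (0 : N) = 0 := exists_pred.choose_spec.2.1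

@[simp] theorem pred_add_one (x : N) : pred (x + 1) = x := exists_pred.choose_spec.2.2 x

theorem exists_monus : ∃ d : N → N → N, Fun₂ d ∧ (∀ x, d x 0 = x) ∧
    ∀ x y, d x (y + 1) = pred (d x y) := by
  obtain ⟨R, hR, h0, hs⟩ := exists_rec (N := N) (fun₂_comp₁ fun₁_pred fun₂_fst)
  exact ⟨fun x y => R y x, fun₂_comp₂ hR fun₂_snd fun₂_fst, h0, fun x y => hs y x⟩

/-- Truncated subtraction. -/
noncomputable def monus : N → N → N := exists_monus.choose

theorem fun₂_monus : Fun₂ (monus : N → N → N) := exists_monus.choose_spec.1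

@[simp] theorem monus_zero (x : N) : monus x 0 = x := exists_monus.choose_spec.2.1 x

theorem monus_add_one (x y : N) : monus x (y + 1) = pred (monus x y) :=
  exists_monus.choose_spec.2.2 x y

theorem Fun₁.monus (hf : Fun₁ f) (hg : Fun₁ g) :
    Fun₁ fun x => PrimRecArith.monus (f x) (g x) :=
  fun₁_comp₂ fun₂_monus hf hg

theorem Fun₂.monus {f g : N → N → N} (hf : Fun₂ f) (hg : Fun₂ g) :
    Fun₂ fun x y => PrimRecArith.monus (f x y) (g x y) :=
  fun₂_comp₂ fun₂_monus hf hg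

@[simp] theorem monus_add_one_add_one (x y : N) : monus (x + 1) (y + 1) = monus x y :=
  induct ((fun₁_const (x + 1)).monus (fun₁_id.add (fun₁_const 1)))
    ((fun₁_const x).monus fun₁_id)
    (by rw [monus_add_one, monus_zero, monus_zero, pred_add_one])
    (fun y h => by rw [monus_add_one, h, monus_add_one]) y

@[simp] theorem monus_self (x : N) : monus x x = 0 :=
  induct (fun₁_id.monus fun₁_id) (fun₁_const 0) (monus_zero 0)
    (fun x h => by rw [monus_add_one_add_one, h]) x

@[simp] theorem zero_monus (x : N) : monus 0 x = 0 :=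
  induct ((fun₁_const 0).monus fun₁_id) (fun₁_const 0) (monus_zero 0)
    (fun x h => by rw [monus_add_one, h, pred_zero]) x

@[simp] theorem add_monus (x y : N) : monus (x + y) y = x :=
  induct (((fun₁_const x).add fun₁_id).monus fun₁_id) (fun₁_const x)
    (by rw [add_zero, monus_zero]) (fun y h => by rw [← add_assoc, monus_add_one_add_one, h]) y

@[simp] theorem monus_add (x y : N) : monus x (x + y) = 0 :=
  induct ((fun₁_const x).monus ((fun₁_const x).add fun₁_id)) (fun₁_const 0)
    (by rw [add_zero, monus_self])
    (fun y h => by rw [← add_assoc, monus_add_one, h, pred_zero]) y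

theorem eq_of_add_eq_add_right {x y z : N} (h : x + z = y + z) : x = y := by
  rw [← add_monus x z, h, add_monus]

theorem eq_zero_or_eq_pred_add_one (x : N) : x = 0 ∨ x = pred x + 1 :=
  ind_or fun₁_id (fun₁_const 0) fun₁_id ((fun₁_pred.comp fun₁_id).add (fun₁_const 1))
    (Or.inl rfl) (fun x _ => Or.inr (by rw [succ_eq_add_one, pred_add_one])) x

theorem eq_zero_or_exists_add_one (x : N) : x = 0 ∨ ∃ y, x = y + 1 :=
  (eq_zero_or_eq_pred_add_one x).imp id fun h => ⟨_, h⟩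

theorem eq_zero_of_add_eq_zero_left {x y : N} (h : x + y = 0) : y = 0 := by
  rcases eq_zero_or_exists_add_one y with rfl | ⟨z, rfl⟩
  · rfl
  · exact absurd ((add_assoc x z 1).trans h) (add_one_ne_zero _)

theorem eq_zero_of_add_eq_zero_right {x y : N} (h : x + y = 0) : x = 0 :=
  eq_zero_of_add_eq_zero_left ((add_comm y x).trans h)

theorem eq_zero_or_eq_zero_of_mul_eq_zero {x y : N} (h : x * y = 0) : x = 0 ∨ y = 0 := by
  rcases eq_zero_or_exists_add_one y with rfl | ⟨z, rfl⟩
  · exact Or.inr rfl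
  · rw [mul_add, mul_one] at h
    exact Or.inl (eq_zero_of_add_eq_zero_left h)

section DoubleInduction

variable {f g : N → N → N}

theorem eq_of_eq_pred_pred (h0 : ∀ y, f 0 y = g 0 y) (h0' : ∀ x, f x 0 = g x 0)
    (hs : ∀ x y, f x y = g x y → f (x + 1) (y + 1) = g (x + 1) (y + 1)) (x y : N)
    (h : f (pred x) (pred y) = g (pred x) (pred y)) : f x y = g x y := by
  rcases eq_zero_or_eq_pred_add_one x with hx | hx
  · rw [hx, h0]
  rcases eq_zero_or_eq_pred_add_one y with hy | hy
  · rw [hy, h0']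
  rw [hx, hy]
  exact hs _ _ h

/- Induction is only available for unary equations: it is applied, upwards in `k ≤ x`, to the
equation at the point `(x ∸ (x ∸ k), y ∸ (x ∸ k))` of the diagonal through `(x, y)`. -/
theorem induct₂ (hf : Fun₂ f) (hg : Fun₂ g) (h0 : ∀ y, f 0 y = g 0 y) (h0' : ∀ x, f x 0 = g x 0)
    (hs : ∀ x y, f x y = g x y → f (x + 1) (y + 1) = g (x + 1) (y + 1)) (x y : N) :
    f x y = g x y := by
  have hdiag (z : N) : Fun₁ fun k => monus z (monus x k) :=
    (fun₁_const z).monus ((fun₁_const x).monus fun₁_id)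
  have key := induct (fun₁_comp₂ hf (hdiag x) (hdiag y)) (fun₁_comp₂ hg (hdiag x) (hdiag y))
    (by simp only [monus_zero, monus_self, h0])
    (fun k hk => by
      rcases eq_zero_or_eq_pred_add_one (monus x k) with hx | hx
      · rw [hx] at hk
        rw [monus_add_one, hx, pred_zero, hk]
      · rw [hx, monus_add_one, monus_add_one] at hk
        rw [monus_add_one]
        exact eq_of_eq_pred_pred h0 h0' hs _ _ hk) x
  simpa only [monus_self, monus_zero] using key

end DoubleInduction

theorem add_monus_comm (x y : N) : x + monus y x = y + monus x y :=
  induct₂ (fun₂_fst.add (fun₂_snd.monus fun₂_fst)) (fun₂_snd.add (fun₂_fst.monus fun₂_snd))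
    (fun y => by rw [monus_zero, zero_add, zero_monus, add_zero])
    (fun x => by rw [monus_zero, zero_add, zero_monus, add_zero])
    (fun x y h => by
      rw [monus_add_one_add_one, monus_add_one_add_one, add_right_comm, h, add_right_comm]) x y

/-- The distance of two numbers. -/
noncomputable def dist (x y : N) : N := monus x y + monus y x

theorem dist_eq_zero {x y : N} : dist x y = 0 ↔ x = y := by
  constructor
  · intro h
    have h' := add_monus_comm x y
    rwa [eq_zero_of_add_eq_zero_left h, eq_zero_of_add_eq_zero_right h, add_zero, add_zero] at h'
  · rintro rfl
    rw [dist, monus_self, add_zero]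

theorem Fun₁.dist (hf : Fun₁ f) (hg : Fun₁ g) : Fun₁ fun x => PrimRecArith.dist (f x) (g x) :=
  (hf.monus hg).add (hg.monus hf)

theorem Fun₂.dist {f g : N → N → N} (hf : Fun₂ f) (hg : Fun₂ g) :
    Fun₂ fun x y => PrimRecArith.dist (f x y) (g x y) :=
  (hf.monus hg).add (hg.monus hf)

theorem one_monus_of_ne_zero {x : N} (h : x ≠ 0) : monus 1 x = 0 := by
  rcases eq_zero_or_exists_add_one x with rfl | ⟨y, rfl⟩
  · exact absurd rfl h
  · rw [add_comm]
    exact monus_add 1 y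

theorem one_ne_zero : (1 : N) ≠ 0 :=
  succ_ne_zero 0

theorem one_monus_mul_eq_zero {x y : N} : monus 1 x * y = 0 ↔ (x = 0 → y = 0) := by
  constructor
  · rintro h rfl
    rwa [monus_zero, one_mul] at h
  · intro h
    by_cases hx : x = 0
    · rw [h hx, mul_zero]
    · rw [one_monus_of_ne_zero hx, zero_mul]

/-! ### Inverting the pairing function -/

theorem exists_sqrt : ∃ r : N → N, Fun₁ r ∧ r 0 = 0 ∧
    ∀ k, r (k + 1) = r k + monus 1 (dist (k + 1) ((r k + 1) * (r k + 1))) := by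
  have hroot : Fun₂ fun r _ : N => r + 1 := fun₂_fst.add (fun₂_const 1)
  have hstep : Fun₂ fun r k : N => r + monus 1 (dist (k + 1) ((r + 1) * (r + 1))) :=
    fun₂_fst.add ((fun₂_const 1).monus ((fun₂_snd.add (fun₂_const 1)).dist (hroot.mul hroot)))
  obtain ⟨R, hR, h0, hs⟩ := exists_rec hstep
  exact ⟨fun k => R k 0, hR.left 0, h0 0, fun k => hs k 0⟩

/-- The integer square root. -/
noncomputable def sqrt : N → N := exists_sqrt.choose

theorem fun₁_sqrt : Fun₁ (sqrt : N → N) := exists_sqrt.choose_spec.1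

theorem sqrt_zero : sqrt (0 : N) = 0 := exists_sqrt.choose_spec.2.1

theorem sqrt_add_one (k : N) :
    sqrt (k + 1) = sqrt k + monus 1 (dist (k + 1) ((sqrt k + 1) * (sqrt k + 1))) :=
  exists_sqrt.choose_spec.2.2 k

theorem ne_sq_add_one_of_monus_eq_zero {q n : N} (h : monus (n + 1) (q + q) = 0) :
    q * q + n + 1 ≠ (q + 1) * (q + 1) := by
  intro heq
  have hn : n = q + q := by
    refine eq_of_add_eq_add_right (z := q * q + 1) ?_
    calc n + (q * q + 1) = q * q + n + 1 := by ring
      _ = (q + 1) * (q + 1) := heq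
      _ = q + q + (q * q + 1) := by ring
  rw [hn, add_comm, add_monus] at h
  exact one_ne_zero h

theorem sqrt_sq_add_of_sqrt_sq {q : N} (hq : sqrt (q * q) = q) (n : N)
    (hn : monus n (q + q) = 0) : sqrt (q * q + n) = q := by
  have hfun : Fun₁ fun n => monus 1 (monus n (q + q)) * dist (sqrt (q * q + n)) q :=
    ((fun₁_const 1).monus (fun₁_id.monus (fun₁_const _))).mul
      ((fun₁_sqrt.comp ((fun₁_const _).add fun₁_id)).dist (fun₁_const _))
  have key := induct hfun (fun₁_const 0)
    (by
      rw [one_monus_mul_eq_zero, dist_eq_zero, add_zero]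
      exact fun _ => hq)
    (fun n ih => by
      rw [one_monus_mul_eq_zero, dist_eq_zero] at ih ⊢
      intro hn
      have hn' : monus n (q + q) = 0 := by
        rw [← monus_add_one_add_one, monus_add_one, hn, pred_zero]
      have hd : dist (q * q + n + 1) ((q + 1) * (q + 1)) ≠ 0 :=
        mt dist_eq_zero.1 (ne_sq_add_one_of_monus_eq_zero hn)
      rw [← add_assoc, sqrt_add_one, ih hn', one_monus_of_ne_zero hd, add_zero]) n
  rw [one_monus_mul_eq_zero, dist_eq_zero] at key
  exact key hn

theorem sqrt_sq (q : N) : sqrt (q * q) = q :=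
  induct (fun₁_sqrt.comp (fun₁_id.mul fun₁_id)) fun₁_id (by rw [mul_zero, sqrt_zero])
    (fun q hq => by
      have h := sqrt_sq_add_of_sqrt_sq hq (q + q) (monus_self _)
      have e : (q + 1) * (q + 1) = q * q + (q + q) + 1 := by ring
      rw [e, sqrt_add_one, h, ← e, dist_eq_zero.2 rfl, monus_zero]) q

/-- The pairing of second order arithmetic. -/
noncomputable def pair (m n : N) : N := (m + n) * (m + n) + m

/-- The first component of a coded pair. -/
noncomputable def unpairFst (k : N) : N := monus k (sqrt k * sqrt k)

/-- The second component of a coded pair. -/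
noncomputable def unpairSnd (k : N) : N := monus (sqrt k) (unpairFst k)

theorem fun₁_unpairFst : Fun₁ (unpairFst : N → N) :=
  fun₁_id.monus (fun₁_sqrt.mul fun₁_sqrt)

theorem fun₁_unpairSnd : Fun₁ (unpairSnd : N → N) := fun₁_sqrt.monus fun₁_unpairFst

theorem sqrt_pair (m n : N) : sqrt (pair m n) = m + n :=
  sqrt_sq_add_of_sqrt_sq (sqrt_sq _) _ (by rw [add_assoc, monus_add])

@[simp] theorem unpairFst_pair (m n : N) : unpairFst (pair m n) = m := by
  rw [unpairFst, sqrt_pair, pair, add_comm, add_monus]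

@[simp] theorem unpairSnd_pair (m n : N) : unpairSnd (pair m n) = n := by
  rw [unpairSnd, sqrt_pair, unpairFst_pair, add_comm, add_monus]

theorem fun₂_pair : Fun₂ (pair : N → N → N) :=
  ((fun₂_fst.add fun₂_snd).mul (fun₂_fst.add fun₂_snd)).add fun₂_fst

end PrimRecArith

/-! ### The arithmetic of a model -/

namespace TypeStructure

variable {M : TypeStructure}

section Arithmetic

open IsModel

/-- The unary number functions that objects of the structure represent. -/
def Fun₁ (M : TypeStructure) (f : M.N → M.N) : Prop :=
  ∃ t : M.D Ty.one, ∀ a, M.val (t a) = f (M.val a)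

/-- The binary number functions that objects of the structure represent. -/
def Fun₂ (M : TypeStructure) (f : M.N → M.N → M.N) : Prop :=
  ∃ t : M.D (Ty.arr Ty.nat Ty.one), ∀ a b, M.val (t a b) = f (M.val a) (M.val b)

/-- The function on numbers that is represented by an object of type `0 → 0`. -/
noncomputable def toFun₁ [IsModel V M] (t : M.D Ty.one) (x : M.N) : M.N :=
  M.val (t (Function.surjInv val_surj x))

/-- The function on numbers that is represented by an object of type `0 → (0 → 0)`. -/
noncomputable def toFun₂ [IsModel V M] (t : M.D (Ty.arr Ty.nat Ty.one)) (x y : M.N) :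
    M.N :=
  M.val (t (Function.surjInv val_surj x) (Function.surjInv val_surj y))

theorem val_app [IsModel V M] (t : M.D Ty.one) (a : M.D Ty.nat) :
    M.val (t a) = toFun₁ t (M.val a) :=
  ext (ρ := Ty.nat) (τ := Ty.nat) trivial trivial a _ t
    (Function.surjInv_eq val_surj (M.val a)).symm

theorem val_app_app [IsModel V M] (t : M.D (Ty.arr Ty.nat Ty.one)) (a b : M.D Ty.nat) :
    M.val (t a b) = toFun₂ t (M.val a) (M.val b) :=
  (ext (ρ := Ty.nat) (τ := Ty.one) trivial ⟨nat_mem M, trivial⟩ a _ t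
    (Function.surjInv_eq val_surj (M.val a)).symm b).trans
  (ext (ρ := Ty.nat) (τ := Ty.nat) trivial trivial b _ _
    (Function.surjInv_eq val_surj (M.val b)).symm)

theorem fun₁_toFun₁ [IsModel V M] (t : M.D Ty.one) : M.Fun₁ (toFun₁ t) := ⟨t, val_app t⟩

theorem fun₂_toFun₂ [IsModel V M] (t : M.D (Ty.arr Ty.nat Ty.one)) : M.Fun₂ (toFun₂ t) :=
  ⟨t, val_app_app t⟩

theorem exists_comp [IsModel V M] (h : M.D (Ty.arr σ τ)) (f : M.D (Ty.arr ρ σ)) :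
    ∃ k : M.D (Ty.arr ρ τ), ∀ a, M.PtEq τ (k a) (h (f a)) :=
  ⟨M.comb _ _ _ (M.proj _ _ h) f, fun a => (comb_eq _ _ a).trans (proj_eq h a (f a))⟩

theorem Fun₁.comp₂ [IsModel V M] {h : M.N → M.N → M.N} {f g : M.N → M.N} (hh : M.Fun₂ h)
    (hf : M.Fun₁ f) (hg : M.Fun₁ g) : M.Fun₁ fun x => h (f x) (g x) := by
  obtain ⟨h', hh⟩ := hh
  obtain ⟨f', hf⟩ := hf
  obtain ⟨g', hg⟩ := hg
  obtain ⟨k, hk⟩ := exists_comp h' f'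
  refine ⟨M.comb _ _ _ k g', fun a => ?_⟩
  calc M.val (M.comb _ _ _ k g' a) = M.val (k a (g' a)) := comb_eq k g' a
    _ = M.val (h' (f' a) (g' a)) := hk a (g' a)
    _ = _ := by rw [hh, hf, hg]

theorem Fun₂.comp₂ [IsModel V M] {h f g : M.N → M.N → M.N} (hh : M.Fun₂ h) (hf : M.Fun₂ f)
    (hg : M.Fun₂ g) :
    M.Fun₂ fun x y => h (f x y) (g x y) := by
  obtain ⟨h', hh⟩ := hh
  obtain ⟨f', hf⟩ := hf
  obtain ⟨g', hg⟩ := hg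
  obtain ⟨k, hk⟩ := exists_comp (M.comb Ty.nat Ty.nat (Ty.arr Ty.nat Ty.nat) (M.proj _ _ h')) f'
  obtain ⟨l, hl⟩ := exists_comp (M.comb _ _ _) k
  refine ⟨M.comb _ _ _ l g', fun a b => ?_⟩
  calc M.val (M.comb _ _ _ l g' a b) = M.val (l a (g' a) b) := comb_eq l g' a b
    _ = M.val (M.comb _ _ _ (k a) (g' a) b) := hl a (g' a) b
    _ = M.val (k a b (g' a b)) := comb_eq (k a) (g' a) b
    _ = M.val (M.comb _ _ _ (M.proj _ _ h') (f' a) b (g' a b)) := hk a b (g' a b)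
    _ = M.val (M.proj _ _ h' b (f' a b) (g' a b)) := comb_eq (τ := Ty.one) _ (f' a) b (g' a b)
    _ = M.val (h' (f' a b) (g' a b)) := proj_eq h' b (f' a b) (g' a b)
    _ = _ := by rw [hh, hf, hg]

theorem fun₂_fst [IsModel V M] : M.Fun₂ fun x _ => x := ⟨M.proj _ _, fun a b => proj_eq a b⟩

theorem fun₁_id [IsModel V M] : M.Fun₁ fun x => x :=
  ⟨M.comb _ (Ty.arr Ty.nat Ty.nat) _ (M.proj _ _) (M.proj _ _),
    fun a => (comb_eq _ _ a).trans (proj_eq a (M.proj _ _ a))⟩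

theorem fun₁_const [IsModel V M] (c : M.N) : M.Fun₁ fun _ => c := by
  obtain ⟨a, rfl⟩ := val_surj (M := M) c
  exact ⟨M.proj _ _ a, fun b => proj_eq a b⟩

theorem fun₂_snd [IsModel V M] : M.Fun₂ fun _ y => y := by
  obtain ⟨i, hi⟩ := fun₁_id (M := M)
  exact ⟨M.proj _ _ i, fun a b => (proj_eq i a b).trans (hi b)⟩

theorem Fun₂.comp₁ [IsModel V M] {f : M.N → M.N} {g : M.N → M.N → M.N} (hf : M.Fun₁ f)
    (hg : M.Fun₂ g) : M.Fun₂ fun x y => f (g x y) := by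
  have hfst : M.Fun₂ fun x _ => f x := by
    obtain ⟨f', hf⟩ := hf
    obtain ⟨k, hk⟩ := exists_comp (M.proj Ty.nat Ty.nat) f'
    exact ⟨k, fun a b => Eq.trans (hk a b) (Eq.trans (proj_eq (f' a) b) (hf a))⟩
  exact hfst.comp₂ hg hg

theorem fun₂_recr [IsModel V M] (z : M.D (Ty.arr Ty.nat Ty.one)) :
    ∃ R : M.N → M.N → M.N, M.Fun₂ R ∧
      ∀ a b, M.val (M.recr a b z) = R (M.val a) (M.val b) := by
  obtain ⟨k, hk⟩ := exists_comp (M.comb _ _ _) M.recr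
  let r := M.comb _ _ _ k (M.proj _ _ (M.proj _ _ z))
  have hr (a b : M.D Ty.nat) : M.val (r a b) = M.val (M.recr a b z) := by
    have hz : M.PtEq _ (M.proj _ _ (M.proj _ _ z) a b) z := fun c =>
      (proj_eq (M.proj _ _ z) a b c).trans (proj_eq z b c)
    calc M.val (r a b) = M.val (k a (M.proj _ _ (M.proj _ _ z) a) b) := comb_eq k _ a b
      _ = M.val (M.comb _ _ _ (M.recr a) (M.proj _ _ (M.proj _ _ z) a) b) := hk a _ b
      _ = M.val (M.recr a b (M.proj _ _ (M.proj _ _ z) a b)) := comb_eq (M.recr a) _ b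
      _ = M.val (M.recr a b z) :=
        ext (ρ := Ty.arr Ty.nat Ty.one) (τ := Ty.nat) ⟨nat_mem M, nat_mem M, trivial⟩ trivial
          _ _ _ hz
  exact ⟨toFun₂ r, fun₂_toFun₂ r, fun a b => by rw [← val_app_app, hr]⟩

theorem exists_fun₂_rec [IsModel V M] {h : M.N → M.N → M.N} (hh : M.Fun₂ h) :
    ∃ R : M.N → M.N → M.N, M.Fun₂ R ∧ (∀ y, R (M.val M.zero) y = y) ∧
      ∀ x y, R (toFun₁ M.succ x) y = h (R x y) x := by
  obtain ⟨z, hz⟩ := hh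
  obtain ⟨R, hR, hR'⟩ := fun₂_recr z
  refine ⟨R, hR, val_surj.forall.2 fun b => ?_,
    val_surj.forall.2 fun a => val_surj.forall.2 fun b => ?_⟩
  · rw [← hR', rec_zero]
  · rw [← val_app, ← hR', ← hR', rec_succ, hz]

theorem fun₁_ind_or [IsModel V M] {f g f' g' : M.N → M.N} (hf : M.Fun₁ f) (hg : M.Fun₁ g)
    (hf' : M.Fun₁ f') (hg' : M.Fun₁ g') (h0 : f (M.val M.zero) = g (M.val M.zero) ∨
      f' (M.val M.zero) = g' (M.val M.zero))
    (hs : ∀ x, (f x = g x ∨ f' x = g' x) →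
      (f (toFun₁ M.succ x) = g (toFun₁ M.succ x) ∨ f' (toFun₁ M.succ x) = g' (toFun₁ M.succ x))) :
    ∀ x, f x = g x ∨ f' x = g' x := by
  obtain ⟨tf, hf⟩ := hf
  obtain ⟨tg, hg⟩ := hg
  obtain ⟨tf', hf'⟩ := hf'
  obtain ⟨tg', hg'⟩ := hg'
  refine val_surj.forall.2 fun a => ?_
  have key := ind tf tg tf' tg'
  simp only [hf, hg, hf', hg', val_app M.succ] at key
  exact key h0 (fun a => hs (M.val a)) a

noncomputable instance [IsModel V M] : PrimRecArith M.N where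
  zero := M.val M.zero
  add := toFun₂ M.add
  mul := toFun₂ M.mul
  succ := toFun₁ M.succ
  Fun₁ := M.Fun₁
  Fun₂ := M.Fun₂
  succ_ne_zero := val_surj.forall.2 fun a h => succ_ne_zero a ((val_app M.succ a).trans h)
  succ_inj := val_surj.forall.2 fun a => val_surj.forall.2 fun b h =>
    succ_inj a b (by rw [val_app M.succ, h, val_app M.succ])
  add_zero := val_surj.forall.2 fun a => (val_app_app M.add a _).symm.trans (IsModel.add_zero a)
  add_succ := val_surj.forall.2 fun a => val_surj.forall.2 fun b => by
    have h := add_succ a b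
    simp only [val_app_app M.add, val_app M.succ] at h
    exact h
  mul_zero := val_surj.forall.2 fun a => (val_app_app M.mul a _).symm.trans (IsModel.mul_zero a)
  mul_succ := val_surj.forall.2 fun a => val_surj.forall.2 fun b => by
    have h := mul_succ a b
    simp only [val_app_app M.mul, val_app_app M.add, val_app M.succ] at h
    exact h
  fun₁_id := fun₁_id
  fun₁_const := fun₁_const
  fun₁_succ := fun₁_toFun₁ M.succ
  fun₂_add := fun₂_toFun₂ M.add
  fun₂_mul := fun₂_toFun₂ M.mul
  fun₂_fst := fun₂_fst
  fun₂_snd := fun₂_snd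
  fun₁_comp₂ := Fun₁.comp₂
  fun₂_comp₁ := Fun₂.comp₁
  fun₂_comp₂ := Fun₂.comp₂
  exists_rec_succ := exists_fun₂_rec
  ind_or := fun₁_ind_or

theorem val_zero [IsModel V M] : M.val M.zero = 0 := rfl

theorem val_succ [IsModel V M] (a : M.D Ty.nat) : M.val (M.succ a) = M.val a + 1 :=
  (val_app M.succ a).trans (PrimRecArith.succ_eq_add_one _)

theorem val_add [IsModel V M] (a b : M.D Ty.nat) : M.val (M.add a b) = M.val a + M.val b :=
  val_app_app M.add a b

theorem val_mul [IsModel V M] (a b : M.D Ty.nat) : M.val (M.mul a b) = M.val a * M.val b :=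
  val_app_app M.mul a b

end Arithmetic

/-! ### Extensional models -/

/-- Extensional models: the law of extensionality holds in all types, and pointwise equal objects
are identical. -/
class IsExtModel (M : TypeStructure) : Prop extends IsModel AnyType M where
  eq_of_ptEq : ∀ {σ : Ty} {f g : M.D σ}, M.PtEq σ f g → f = g

theorem nonempty (M : TypeStructure) : ∀ τ, Nonempty (M.D τ)
  | Ty.nat => ⟨M.zero⟩
  | Ty.arr σ τ => (nonempty M τ).map (M.proj τ σ)

section Extensional

variable [IsExtModel M]

theorem val_inj {a b : M.D Ty.nat} (h : M.val a = M.val b) : a = b :=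
  IsExtModel.eq_of_ptEq h

theorem fun_ext {f g : M.D (Ty.arr σ τ)} (h : ∀ a, f a = g a) : f = g :=
  IsExtModel.eq_of_ptEq fun a => h a ▸ PtEq.refl (f a)

theorem proj_app (s : M.D ρ) (t : M.D τ) : M.proj ρ τ s t = s :=
  IsExtModel.eq_of_ptEq (IsModel.proj_eq s t)

theorem comb_app (r : M.D (Ty.arr δ (Ty.arr ρ τ))) (s : M.D (Ty.arr δ ρ)) (t : M.D δ) :
    M.comb δ ρ τ r s t = r t (s t) :=
  IsExtModel.eq_of_ptEq (IsModel.comb_eq r s t)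

theorem eq_zero_or_exists_eq_succ (a : M.D Ty.nat) : a = M.zero ∨ ∃ b, a = M.succ b := by
  obtain h | ⟨y, h⟩ := PrimRecArith.eq_zero_or_exists_add_one (M.val a)
  · exact Or.inl (val_inj h)
  · obtain ⟨b, rfl⟩ := IsModel.val_surj y
    exact Or.inr ⟨b, val_inj (h.trans (val_succ b).symm)⟩

theorem eval_lam (t : Tm (σ :: Γ) τ) (e : M.Env Γ) (d : M.D σ) :
    M.eval e t.lam d = M.eval (e.cons d) t := by
  induction t with
  | var v =>
    cases v with
    | zero => exact (comb_app _ _ _).trans (proj_app _ _)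
    | succ v => exact proj_app _ _
  | app f a hf ha =>
    refine (comb_app _ _ _).trans ?_
    rw [hf, ha]
    rfl
  | _ => exact proj_app _ _

end Extensional

/-! ### Definability with parameters -/

/-- Functions of environments that are given by terms with parameters from the structure. They
serve as the realizers of formulas with free variables. -/
inductive Definable (M : TypeStructure) : {τ : Ty} → (M.Env Γ → M.D τ) → Prop
  | var {σ : Ty} (v : Var Γ σ) : Definable M fun e => e σ v
  | const {τ : Ty} (d : M.D τ) : Definable M fun _ => d
  | app {σ τ : Ty} {f : M.Env Γ → M.D (Ty.arr σ τ)} {g : M.Env Γ → M.D σ} :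
      Definable M f → Definable M g → Definable M fun e => f e (g e)

namespace Definable

theorem eval (t : Tm Γ τ) : M.Definable fun e : M.Env Γ => M.eval e t := by
  induction t with
  | var v => exact var v
  | app f a hf ha => exact hf.app ha
  | _ => exact const _

theorem comp {f : M.Env Γ → M.D τ} (hf : M.Definable f) {s : M.Env Δ → M.Env Γ}
    (hs : ∀ σ v, M.Definable fun e => s e σ v) : M.Definable fun e => f (s e) := by
  induction hf with
  | var v => exact hs _ v
  | const d => exact const d
  | app _ _ hf hg => exact hf.app hg

theorem head : M.Definable fun e : M.Env (ρ :: Γ) => e.head := var Var.zero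

theorem tail {f : M.Env Γ → M.D τ} (hf : M.Definable f) :
    M.Definable fun e : M.Env (ρ :: Γ) => f e.tail :=
  hf.comp fun _ v => var v.succ

theorem cons {f : M.Env (ρ :: Γ) → M.D τ} (hf : M.Definable f) {s : M.Env Δ → M.Env Γ}
    (hs : ∀ σ v, M.Definable fun e => s e σ v) {g : M.Env Δ → M.D ρ} (hg : M.Definable g) :
    M.Definable fun e => f ((s e).cons (g e)) :=
  hf.comp fun σ v => by
    cases v with
    | zero => exact hg
    | succ v => exact hs σ v

theorem comp_tail {f : M.Env Γ → M.D ρ → M.D τ}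
    (hf : M.Definable fun e : M.Env (ρ :: Γ) => f e.tail e.head) {g : M.Env (σ :: Γ) → M.D ρ}
    (hg : M.Definable g) : M.Definable fun e : M.Env (σ :: Γ) => f e.tail (g e) :=
  hf.cons (s := Env.tail) (fun _ v => var v.succ) hg

theorem exists_curry [IsExtModel M] {f : M.Env (σ :: Γ) → M.D τ} (hf : M.Definable f) :
    ∃ g : M.Env Γ → M.D (Ty.arr σ τ), M.Definable g ∧ ∀ e d, g e d = f (e.cons d) := by
  induction hf with
  | var v => exact ⟨_, eval (Tm.var v).lam, fun e d => eval_lam _ e d⟩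
  | const d => exact ⟨fun _ => M.proj _ _ d, const _, fun _ a => proj_app d a⟩
  | app _ _ hf hg =>
    obtain ⟨f', hf, hf'⟩ := hf
    obtain ⟨g', hg, hg'⟩ := hg
    refine ⟨fun e => M.comb _ _ _ (f' e) (g' e), ((const _).app hf).app hg, fun e d => ?_⟩
    rw [comb_app, hf', hg']

end Definable

/-! ### Pairs and definition by cases -/

/-- A type of codes for pairs: the pair of `a` and `b` is the functional `λk. k a b`. -/
abbrev prodTy (ρ τ : Ty) : Ty := Ty.arr (Ty.arr ρ (Ty.arr τ Ty.nat)) Ty.nat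

/-- The pair of two objects, as the object `λk. k a b`. -/
def pair (a : M.D ρ) (b : M.D τ) : M.D (prodTy ρ τ) :=
  M.eval (((Env.nil M).cons a).cons b) (Tm.app (Tm.app Tm.v0 Tm.v2) Tm.v1).lam

theorem Definable.pair {f : M.Env Γ → M.D ρ} {g : M.Env Γ → M.D τ} (hf : M.Definable f)
    (hg : M.Definable g) : M.Definable fun e => pair (f e) (g e) :=
  (eval (Γ := [τ, ρ]) _).cons (s := fun e => (Env.nil M).cons (f e)) (fun σ v => by
    cases v with
    | zero => exact hf
    | succ v => cases v) hg

section Split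

variable [IsExtModel M]

/-- Pairs only apply to functions with values of type `0`; elimination into higher types is by
recursion on the type. -/
theorem exists_split (ρ τ σ : Ty) :
    ∃ L : M.D (Ty.arr (Ty.arr ρ (Ty.arr τ σ)) (Ty.arr (prodTy ρ τ) σ)),
      ∀ f a b, L f (pair a b) = f a b := by
  induction σ with
  | nat =>
    refine ⟨M.eval (Env.nil M) (Tm.app Tm.v0 Tm.v1).lam.lam, fun f a b => ?_⟩
    rw [eval_lam, eval_lam]
    exact eval_lam _ _ _
  | arr σ₁ σ₂ _ ih =>
    obtain ⟨L, hL⟩ := ih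
    -- The witness is `λf p r. L (λa b. f a b r) p`.
    refine ⟨M.eval ((Env.nil M).cons L) (Tm.app (Tm.app (Tm.var Var.zero.succ.succ.succ)
      (Tm.app (Tm.app (Tm.app (Tm.var Var.zero.succ.succ.succ.succ) Tm.v1) Tm.v0)
        Tm.v2).lam.lam) Tm.v1).lam.lam.lam, fun f a b => fun_ext fun r => ?_⟩
    simp only [eval_lam, TypeStructure.eval, Env.cons_zero, Env.cons_succ, hL]

theorem exists_fst (ρ τ : Ty) :
    ∃ p : M.D (Ty.arr (prodTy ρ τ) ρ), ∀ (a : M.D ρ) (b : M.D τ), p (pair a b) = a := by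
  obtain ⟨L, hL⟩ := exists_split (M := M) ρ τ ρ
  exact ⟨L (M.proj _ _), fun a b => by rw [hL, proj_app]⟩

theorem exists_snd (ρ τ : Ty) :
    ∃ p : M.D (Ty.arr (prodTy ρ τ) τ), ∀ (a : M.D ρ) (b : M.D τ), p (pair a b) = b := by
  obtain ⟨L, hL⟩ := exists_split (M := M) ρ τ τ
  exact ⟨L (M.eval (Env.nil M) Tm.v0.lam.lam), fun a b => by rw [hL, eval_lam, eval_lam]; rfl⟩

/-- The first component of a pair. -/
noncomputable def fst (d : M.D (prodTy ρ τ)) : M.D ρ := (exists_fst ρ τ).choose d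

/-- The second component of a pair. -/
noncomputable def snd (d : M.D (prodTy ρ τ)) : M.D τ := (exists_snd ρ τ).choose d

@[simp] theorem fst_pair (a : M.D ρ) (b : M.D τ) : fst (pair a b) = a :=
  (exists_fst ρ τ).choose_spec a b

@[simp] theorem snd_pair (a : M.D ρ) (b : M.D τ) : snd (pair a b) = b :=
  (exists_snd ρ τ).choose_spec a b

theorem Definable.fst {f : M.Env Γ → M.D (prodTy ρ τ)} (hf : M.Definable f) :
    M.Definable fun e => fst (f e) :=
  (const _).app hf

theorem Definable.snd {f : M.Env Γ → M.D (prodTy ρ τ)} (hf : M.Definable f) :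
    M.Definable fun e => snd (f e) :=
  (const _).app hf

theorem exists_cond (M : TypeStructure) [IsExtModel M] (σ : Ty) :
    ∃ c : M.D (Ty.arr Ty.nat (Ty.arr σ (Ty.arr σ σ))), ∀ a b : M.D σ,
      c M.zero a b = a ∧ ∀ n, n ≠ M.zero → c n a b = b := by
  induction σ with
  | nat =>
    let c := M.eval (Env.nil M)
      (Tm.rec0 Tm.v2 Tm.v1 (Tm.app (Tm.proj _ _) (Tm.app (Tm.proj _ _) Tm.v0))).lam.lam.lam
    have hc (n a b) : c n a b = M.recr n a (M.proj _ _ (M.proj _ _ b)) := by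
      simp only [c, eval_lam]
      rfl
    refine ⟨c, fun a b => ⟨?_, fun n hn => ?_⟩⟩
    · rw [hc]
      exact val_inj (IsModel.rec_zero _ _)
    · obtain ⟨n, rfl⟩ := (eq_zero_or_exists_eq_succ n).resolve_left hn
      rw [hc, val_inj (IsModel.rec_succ _ _ _), proj_app, proj_app]
  | arr σ₁ σ₂ _ ih =>
    obtain ⟨c, hc⟩ := ih
    let c' := M.eval ((Env.nil M).cons c) (Tm.app (Tm.app (Tm.app
      (Tm.var Var.zero.succ.succ.succ.succ) (Tm.var Var.zero.succ.succ.succ))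
      (Tm.app Tm.v2 Tm.v0)) (Tm.app Tm.v1 (Tm.v0 (σ := σ₁)))).lam.lam.lam.lam
    have hc' (n f g r) : c' n f g r = c n (f r) (g r) := by
      simp only [c', eval_lam]
      rfl
    refine ⟨c', fun f g => ⟨fun_ext fun r => ?_, fun n hn => fun_ext fun r => ?_⟩⟩
    · rw [hc', (hc _ _).1]
    · rw [hc', (hc _ _).2 n hn]

end Split

/-! ### Modified realizability -/

/-- Propositions depending on a parameter from `X`, given by their realizers: the objects of a
fixed type `ty` that stand in the relation `rel` to the parameter. -/
structure RealizerPred (M : TypeStructure) (X : Type) where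
  ty : Ty
  rel : X → M.D ty → Prop

namespace RealizerPred

variable {X Y : Type}

/-- Change of parameters along a function. -/
def reindex (A : M.RealizerPred X) (f : Y → X) : M.RealizerPred Y where
  ty := A.ty
  rel y d := A.rel (f y) d

/-- A proposition whose realizers carry no information. -/
def prime (p : X → Prop) : M.RealizerPred X where
  ty := Ty.nat
  rel x _ := p x

/-- Functions that map realizers of `A` to realizers of `B`. -/
def imp (A B : M.RealizerPred X) : M.RealizerPred X where
  ty := Ty.arr A.ty B.ty
  rel x d := ∀ a, A.rel x a → B.rel x (d a)

/-- Functions that map every object `a` to a realizer of `A` at `a`. -/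
def all (A : M.RealizerPred (M.Env (σ :: Γ))) : M.RealizerPred (M.Env Γ) where
  ty := Ty.arr σ A.ty
  rel e d := ∀ a, A.rel (e.cons a) (d a)

theorem rel_congr {A : M.RealizerPred X} {x y : X} {a b : M.D A.ty} (hx : x = y) (ha : a = b)
    (h : A.rel y b) : A.rel x a := by
  rwa [hx, ha]

section Connectives

variable [IsExtModel M]

/-- Pairs of a realizer of `A` and a realizer of `B`. -/
noncomputable def and (A B : M.RealizerPred X) : M.RealizerPred X where
  ty := prodTy A.ty B.ty
  rel x d := A.rel x (fst d) ∧ B.rel x (snd d)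

/-- Triples `(n, a, b)` such that `a` realizes `A` if `n = 0` and `b` realizes `B` otherwise. -/
noncomputable def or (A B : M.RealizerPred X) : M.RealizerPred X where
  ty := prodTy Ty.nat (prodTy A.ty B.ty)
  rel x d := (fst d = M.zero ∧ A.rel x (fst (snd d))) ∨
    (fst d ≠ M.zero ∧ B.rel x (snd (snd d)))

/-- Pairs of an object `a` and a realizer of `A` at `a`. -/
noncomputable def ex (A : M.RealizerPred (M.Env (σ :: Γ))) : M.RealizerPred (M.Env Γ) where
  ty := prodTy σ A.ty
  rel e d := A.rel (e.cons (fst d)) (snd d)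

/-- The conjunction of a list of propositions. -/
noncomputable def conj : List (M.RealizerPred X) → M.RealizerPred X
  | [] => prime fun _ => True
  | A :: Δ => and A (conj Δ)

theorem rel_proj_app {A : M.RealizerPred X} {x : X} {a : M.D A.ty} (h : A.rel x a) (d : M.D τ) :
    A.rel x (M.proj _ _ a d) := by
  rwa [proj_app]

theorem and_rel_pair {A B : M.RealizerPred X} {x : X} {a : M.D A.ty} {b : M.D B.ty}
    (ha : A.rel x a) (hb : B.rel x b) : (and A B).rel x (pair a b) :=
  ⟨by rwa [fst_pair], by rwa [snd_pair]⟩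

theorem ex_rel_pair {A : M.RealizerPred (M.Env (σ :: Γ))} {e : M.Env Γ} {a : M.D σ}
    {b : M.D A.ty} (h : A.rel (e.cons a) b) : (ex A).rel e (pair a b) := by
  change A.rel (e.cons (fst (pair a b))) (snd (pair a b))
  rwa [fst_pair, snd_pair]

theorem or_rel_pair_zero {A B : M.RealizerPred X} {x : X} {n : M.D Ty.nat} {a : M.D A.ty}
    {b : M.D B.ty} (hn : n = M.zero) (ha : A.rel x a) :
    (or A B).rel x (pair n (pair a b)) :=
  Or.inl ⟨by rwa [fst_pair], by rwa [snd_pair, fst_pair]⟩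

theorem or_rel_pair_ne_zero {A B : M.RealizerPred X} {x : X} {n : M.D Ty.nat} {a : M.D A.ty}
    {b : M.D B.ty} (hn : n ≠ M.zero) (hb : B.rel x b) :
    (or A B).rel x (pair n (pair a b)) :=
  Or.inr ⟨by rwa [fst_pair], by rwa [snd_pair, snd_pair]⟩

theorem conj_map_reindex (f : Y → X) (Δ : List (M.RealizerPred X)) :
    conj (Δ.map fun A => A.reindex f) = (conj Δ).reindex f := by
  induction Δ with
  | nil => rfl
  | cons A Δ ih =>
    rw [List.map_cons, conj, ih]
    rfl

end Connectives

/-- `A` follows from `C` by a definable transformation of realizers. -/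
def Entails (C A : M.RealizerPred (M.Env Γ)) : Prop :=
  ∃ f : M.Env Γ → M.D C.ty → M.D A.ty,
    (M.Definable fun e : M.Env (C.ty :: Γ) => f e.tail e.head) ∧
    ∀ e d, C.rel e d → A.rel e (f e d)

namespace Entails

variable {A B C D : M.RealizerPred (M.Env Γ)}

theorem refl : Entails C C := ⟨fun _ d => d, Definable.head, fun _ _ h => h⟩

theorem of_definable {g : M.Env (C.ty :: Γ) → M.D A.ty} (hg : M.Definable g)
    (h : ∀ e d, C.rel e d → A.rel e (g (e.cons d))) : Entails C A :=
  ⟨fun e d => g (e.cons d), by simpa only [Env.cons_head_tail] using hg, h⟩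

theorem of_realizer {g : M.Env Γ → M.D A.ty} (hg : M.Definable g) (h : ∀ e, A.rel e (g e)) :
    Entails C A :=
  of_definable hg.tail fun e _ _ => h e

theorem trans (h : Entails C A) (h' : Entails A B) : Entails C B := by
  obtain ⟨f, f_def, hf⟩ := h
  obtain ⟨g, g_def, hg⟩ := h'
  exact ⟨fun e d => g e (f e d), g_def.comp_tail f_def, fun e d h => hg _ _ (hf _ _ h)⟩

theorem botE (h : Entails C (prime fun _ => False)) : Entails C A := by
  obtain ⟨f, -, hf⟩ := h
  exact ⟨fun _ _ => (M.nonempty A.ty).some, Definable.const _, fun e d h => (hf e d h).elim⟩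

theorem impE (h : Entails C (imp A B)) (h' : Entails C A) : Entails C B := by
  obtain ⟨f, f_def, hf⟩ := h
  obtain ⟨g, g_def, hg⟩ := h'
  exact ⟨fun e d => M.app (f e d) (g e d), f_def.app g_def, fun e d h => hf e d h _ (hg e d h)⟩

theorem allE {A : M.RealizerPred (M.Env (σ :: Γ))} {t : M.Env Γ → M.D σ} (ht : M.Definable t)
    (h : Entails C (all A)) : Entails C (A.reindex fun e => e.cons (t e)) := by
  obtain ⟨f, f_def, hf⟩ := h
  exact ⟨fun e d => M.app (f e d) (t e), f_def.app ht.tail, fun e d h => hf e d h _⟩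

variable [IsExtModel M]

theorem andI (h : Entails C A) (h' : Entails C B) : Entails C (and A B) := by
  obtain ⟨f, f_def, hf⟩ := h
  obtain ⟨g, g_def, hg⟩ := h'
  exact ⟨fun e d => pair (f e d) (g e d), f_def.pair g_def,
    fun e d h => and_rel_pair (hf e d h) (hg e d h)⟩

theorem andE1 (h : Entails C (and A B)) : Entails C A := by
  obtain ⟨f, f_def, hf⟩ := h
  exact ⟨fun e d => fst (f e d), f_def.fst, fun e d h => (hf e d h).1⟩

theorem andE2 (h : Entails C (and A B)) : Entails C B := by
  obtain ⟨f, f_def, hf⟩ := h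
  exact ⟨fun e d => snd (f e d), f_def.snd, fun e d h => (hf e d h).2⟩

theorem orI1 (h : Entails C A) : Entails C (or A B) := by
  obtain ⟨f, f_def, hf⟩ := h
  exact ⟨fun e d => pair M.zero (pair (f e d) (M.nonempty B.ty).some),
    (Definable.const _).pair (f_def.pair (Definable.const _)),
    fun e d h => or_rel_pair_zero rfl (hf e d h)⟩

theorem orI2 (h : Entails C B) : Entails C (or A B) := by
  obtain ⟨f, f_def, hf⟩ := h
  have one_ne_zero : M.succ M.zero ≠ M.zero := fun h =>
    IsModel.succ_ne_zero M.zero (congrArg M.val h)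
  exact ⟨fun e d => pair (M.succ M.zero) (pair (M.nonempty A.ty).some (f e d)),
    (Definable.const _).pair ((Definable.const _).pair f_def),
    fun e d h => or_rel_pair_ne_zero one_ne_zero (hf e d h)⟩

theorem orE (h : Entails C (or A B)) (hA : Entails (and A C) D) (hB : Entails (and B C) D) :
    Entails C D := by
  obtain ⟨f, f_def, hf⟩ := h
  obtain ⟨g, g_def, hg⟩ := hA
  obtain ⟨k, k_def, hk⟩ := hB
  obtain ⟨c, hc⟩ := M.exists_cond D.ty
  have rel_cond (e n a b) (ha : n = M.zero → D.rel e a) (hb : n ≠ M.zero → D.rel e b) :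
      D.rel e (c n a b) := by
    by_cases h0 : n = M.zero
    · rw [h0, (hc a b).1]
      exact ha h0
    · rw [(hc a b).2 n h0]
      exact hb h0
  refine ⟨fun e d => c (fst (f e d)) (g e (pair (fst (snd (f e d))) d))
      (k e (pair (snd (snd (f e d))) d)),
    (((Definable.const c).app f_def.fst).app
      (g_def.comp_tail (f_def.snd.fst.pair Definable.head))).app
      (k_def.comp_tail (f_def.snd.snd.pair Definable.head)), fun e d h => ?_⟩
  refine rel_cond _ _ _ _ (fun h0 => hg _ _ (and_rel_pair ?_ h))
    fun h0 => hk _ _ (and_rel_pair ?_ h)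
  · exact ((hf e d h).resolve_right fun h' => h'.1 h0).2
  · exact ((hf e d h).resolve_left fun h' => h0 h'.1).2

theorem impI (h : Entails (and A C) B) : Entails C (imp A B) := by
  obtain ⟨f, f_def, hf⟩ := h
  obtain ⟨g, g_def, hg⟩ := (f_def.cons (s := fun e : M.Env (A.ty :: C.ty :: Γ) => e.tail.tail)
    (fun _ v => Definable.var v.succ.succ) (Definable.head.pair Definable.head.tail)).exists_curry
  refine of_definable g_def fun e d h a ha => ?_
  rw [hg]
  exact hf _ _ (and_rel_pair ha h)

theorem allI {A : M.RealizerPred (M.Env (σ :: Γ))} (h : Entails (C.reindex Env.tail) A) :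
    Entails C (all A) := by
  obtain ⟨f, f_def, hf⟩ := h
  obtain ⟨g, g_def, hg⟩ := (f_def.cons
    (s := fun e : M.Env (σ :: C.ty :: Γ) => e.tail.tail.cons e.head)
    (fun _ v => by
      cases v with
      | zero => exact Definable.head
      | succ v => exact Definable.var v.succ.succ) Definable.head.tail).exists_curry
  refine of_definable g_def fun e d h a => ?_
  rw [hg]
  exact hf (e.cons a) d h

theorem exI {A : M.RealizerPred (M.Env (σ :: Γ))} {t : M.Env Γ → M.D σ} (ht : M.Definable t)
    (h : Entails C (A.reindex fun e => e.cons (t e))) : Entails C (ex A) := by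
  obtain ⟨f, f_def, hf⟩ := h
  exact ⟨fun e d => pair (t e) (f e d), ht.tail.pair f_def, fun e d h => ex_rel_pair (hf e d h)⟩

theorem exE {A : M.RealizerPred (M.Env (σ :: Γ))} (h : Entails C (ex A))
    (h' : Entails (and A (C.reindex Env.tail)) (B.reindex Env.tail)) : Entails C B := by
  obtain ⟨f, f_def, hf⟩ := h
  obtain ⟨g, g_def, hg⟩ := h'
  refine ⟨fun e d => g (e.cons (fst (f e d))) (pair (snd (f e d)) d),
    g_def.cons (s := fun e : M.Env (C.ty :: Γ) => e.tail.cons (fst (f e.tail e.head)))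
      (fun _ v => by
        cases v with
        | zero => exact f_def.fst
        | succ v => exact Definable.var v.succ) (f_def.snd.pair Definable.head), fun e d h => ?_⟩
  exact hg (e.cons (fst (f e d))) _ (and_rel_pair (hf e d h) h)

theorem hyp {Δ : List (M.RealizerPred (M.Env Γ))} (h : A ∈ Δ) : Entails (conj Δ) A := by
  induction h with
  | head => exact andE1 refl
  | tail _ _ ih => exact (andE2 refl).trans ih

end Entails

end RealizerPred

open RealizerPred

variable [IsExtModel M]

/-- The modified realizability interpretation of formulas in an extensional model. -/
noncomputable def interp (M : TypeStructure) [IsExtModel M] :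
    {Γ : List Ty} → Fm V Γ → M.RealizerPred (M.Env Γ)
  | _, Fm.eq a b => prime fun e => M.eval e a = M.eval e b
  | _, Fm.bot => prime fun _ => False
  | _, Fm.and A B => RealizerPred.and (M.interp A) (M.interp B)
  | _, Fm.or A B => RealizerPred.or (M.interp A) (M.interp B)
  | _, Fm.imp A B => RealizerPred.imp (M.interp A) (M.interp B)
  | _, Fm.all _ A => RealizerPred.all (M.interp A)
  | _, Fm.ex _ A => RealizerPred.ex (M.interp A)

theorem interp_subst (A : Fm V Γ) (s : Sub Γ Δ) :
    M.interp (A.subst s) = (M.interp A).reindex fun e => e.sub s := by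
  induction A generalizing Δ with
  | eq a b => simp only [Fm.subst, interp, eval_subst]; rfl
  | bot => rfl
  | and A B hA hB | or A B hA hB | imp A B hA hB => simp only [Fm.subst, interp, hA, hB]; rfl
  | all h A hA =>
    simp only [Fm.subst, interp, hA]
    simp only [RealizerPred.all, reindex, Env.sub_lift]
  | ex h A hA =>
    simp only [Fm.subst, interp, hA]
    simp only [RealizerPred.ex, reindex, Env.sub_lift]

theorem exists_rel_subst (A : Fm V Γ) (s : Sub Γ Δ) (e : M.Env Δ) :
    (∃ d, (M.interp (A.subst s)).rel e d) ↔ ∃ d, (M.interp A).rel (e.sub s) d := by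
  rw [interp_subst]
  rfl

theorem interp_weaken (A : Fm V Γ) (σ : Ty) :
    M.interp (A.weaken σ) = (M.interp A).reindex Env.tail :=
  interp_subst A _

theorem interp_inst (A : Fm V (σ :: Γ)) (t : Tm Γ σ) :
    M.interp (A.inst t) = (M.interp A).reindex fun e => e.cons (M.eval e t) := by
  rw [Fm.inst, interp_subst]
  simp only [Env.sub_cons, Env.sub_id]

theorem conj_map_interp_weaken (Δ : List (Fm V Γ)) (σ : Ty) :
    conj ((Δ.map (Fm.weaken σ)).map M.interp) = (conj (Δ.map M.interp)).reindex Env.tail := by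
  rw [← conj_map_reindex, List.map_map, List.map_map]
  congr 2
  funext A
  exact interp_weaken A σ

theorem entails_of_der {T : Theory V}
    (hT : ∀ (Γ : List Ty) (A : Fm V Γ), A ∈ T Γ → ∀ C, Entails C (M.interp A))
    {Δ : List (Fm V Γ)} {A : Fm V Γ} (h : Der T Γ Δ A) :
    Entails (conj (Δ.map M.interp)) (M.interp A) := by
  induction h with
  | ax h => exact hT _ _ h _
  | hyp h => exact Entails.hyp (List.mem_map_of_mem h)
  | botE _ ih => exact Entails.botE ih
  | andI _ _ h h' => exact Entails.andI h h'
  | andE1 _ h => exact Entails.andE1 h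
  | andE2 _ h => exact Entails.andE2 h
  | orI1 _ h => exact Entails.orI1 h
  | orI2 _ h => exact Entails.orI2 h
  | orE _ _ _ h h' h'' => exact Entails.orE h h' h''
  | impI _ h => exact Entails.impI h
  | impE _ _ h h' => exact Entails.impE h h'
  | allI _ _ h =>
    rw [conj_map_interp_weaken] at h
    exact Entails.allI h
  | allE t _ h =>
    rw [interp_inst]
    exact Entails.allE (Definable.eval t) h
  | exI _ t _ h =>
    rw [interp_inst] at h
    exact Entails.exI (Definable.eval t) h
  | exE _ _ h h' =>
    rw [List.map_cons, conj, conj_map_interp_weaken, interp_weaken] at h'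
    exact Entails.exE h h'

end TypeStructure

theorem Fm.eqAt_exFree (h : ArgsIn V τ) (s t : Tm Γ τ) : (Fm.eqAt τ h s t).ExFree := by
  induction τ generalizing Γ with
  | nat => trivial
  | arr σ τ _ ih => exact ih _ _ _

namespace TypeStructure

open RealizerPred

variable {M : TypeStructure}

theorem eval_applyArgs (e : M.Env Γ) {s t : Tm Γ τ} (u : Args Γ τ) (h : M.eval e s = M.eval e t) :
    M.eval e (s.applyArgs u) = M.eval e (t.applyArgs u) := by
  induction u with
  | nil => exact h
  | cons a _ ih => exact ih (by rw [eval, eval, h])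

variable [IsExtModel M]

/-! ### Truth and realizability -/

theorem sat_eq {e : M.Env Γ} {a b : Tm Γ Ty.nat} :
    M.Sat (V := V) e (Fm.eq a b) ↔ M.eval e a = M.eval e b :=
  ⟨fun h => val_inj h, fun h => congrArg M.val h⟩

/-- The formula `A` has the same truth value as its realizability interpretation, and if true, it
is realized by `q`. -/
structure RealizesTruth (A : Fm V Γ) (q : M.Env Γ → M.D (M.interp A).ty) : Prop where
  rel : ∀ {e}, M.Sat e A → (M.interp A).rel e (q e)
  sat : ∀ {e d}, (M.interp A).rel e d → M.Sat e A

namespace RealizesTruth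

variable {A B : Fm V Γ} {q : M.Env Γ → M.D (M.interp A).ty} {r : M.Env Γ → M.D (M.interp B).ty}

theorem eq (a b : Tm Γ Ty.nat) (q : M.Env Γ → M.D Ty.nat) :
    RealizesTruth (Fm.eq (V := V) a b) q :=
  ⟨fun h => sat_eq.1 h, fun h => sat_eq.2 h⟩

theorem bot (q : M.Env Γ → M.D Ty.nat) : RealizesTruth (Fm.bot (V := V)) q :=
  ⟨fun h => h, fun h => h⟩

theorem and (hA : RealizesTruth A q) (hB : RealizesTruth B r) :
    RealizesTruth (Fm.and A B) fun e => pair (q e) (r e) :=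
  ⟨fun h => and_rel_pair (hA.rel h.1) (hB.rel h.2), fun h => ⟨hA.sat h.1, hB.sat h.2⟩⟩

theorem or (hA : RealizesTruth A q) (hB : RealizesTruth B r) {χ : M.Env Γ → M.D Ty.nat}
    (hχ : ∀ e, χ e = M.zero ↔ M.Sat e A) :
    RealizesTruth (Fm.or A B) fun e => pair (χ e) (pair (q e) (r e)) := by
  refine ⟨fun {e} h => ?_, Or.imp (fun h => hA.sat h.2) fun h => hB.sat h.2⟩
  by_cases h0 : χ e = M.zero
  · exact or_rel_pair_zero h0 (hA.rel ((hχ e).1 h0))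
  · exact or_rel_pair_ne_zero h0 (hB.rel (h.resolve_left fun h => h0 ((hχ e).2 h)))

theorem imp (hA : RealizesTruth A q) (hB : RealizesTruth B r) :
    RealizesTruth (Fm.imp A B) fun e => M.proj _ _ (r e) := by
  exact ⟨fun h a ha => rel_proj_app (hB.rel (h (hA.sat ha))) a,
    fun h hs => hB.sat (h _ (hA.rel hs))⟩

theorem all {h : V σ} {A : Fm V (σ :: Γ)} {c : M.D (M.interp A).ty}
    (hA : RealizesTruth A fun _ => c) :
    RealizesTruth (Fm.all h A) fun _ => M.proj _ _ c := by
  exact ⟨fun h a => rel_proj_app (hA.rel (h a)) a, fun h a => hA.sat (h a)⟩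

end RealizesTruth

theorem exists_realizesTruth_const {A : Fm V Γ} (hA : A.ExFree) :
    ∃ c : M.D (M.interp A).ty, RealizesTruth A fun _ => c := by
  induction A with
  | eq a b => exact ⟨M.zero, RealizesTruth.eq a b _⟩
  | bot => exact ⟨M.zero, RealizesTruth.bot _⟩
  | and A B ihA ihB =>
    obtain ⟨c, hc⟩ := ihA hA.1
    obtain ⟨d, hd⟩ := ihB hA.2
    exact ⟨_, hc.and hd⟩
  | imp A B ihA ihB =>
    obtain ⟨c, hc⟩ := ihA hA.1
    obtain ⟨d, hd⟩ := ihB hA.2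
    exact ⟨_, hc.imp hd⟩
  | all h A ih =>
    obtain ⟨c, hc⟩ := ih hA
    exact ⟨_, hc.all⟩
  | or | ex => exact hA.elim

theorem exists_rel_of_exBlock {A : Fm V Γ} (hA : A.ExBlock) {e : M.Env Γ} (h : M.Sat e A) :
    ∃ d, (M.interp A).rel e d := by
  induction A with
  | ex _ A ih =>
    obtain ⟨a, ha⟩ := h
    obtain ⟨d, hd⟩ := ih hA ha
    exact ⟨pair a d, ex_rel_pair hd⟩
  | _ =>
    obtain ⟨c, hc⟩ := exists_realizesTruth_const (M := M) hA
    exact ⟨c, hc.rel h⟩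

theorem sat_of_rel_of_gamma1 {A : Fm V Γ} (hA : A.Gamma1) {e : M.Env Γ}
    {d : M.D (M.interp A).ty} (h : (M.interp A).rel e d) : M.Sat e A := by
  induction A with
  | eq a b => exact sat_eq.2 h
  | bot => exact h
  | and A B ihA ihB => exact ⟨ihA hA.1 h.1, ihB hA.2 h.2⟩
  | or A B ihA ihB => exact h.imp (fun h => ihA hA.1 h.2) fun h => ihB hA.2 h.2
  | imp A B _ ihB =>
    intro hs
    obtain ⟨a, ha⟩ := exists_rel_of_exBlock hA.1 hs
    exact ihB hA.2 (h a ha)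
  | all _ A ih => exact fun a => ih hA (h a)
  | ex _ A ih => exact ⟨_, ih hA h⟩

/-! ### Decidability of quantifier-free formulas -/

theorem eq_zero_iff {a : M.D Ty.nat} : a = M.zero ↔ M.val a = 0 :=
  ⟨congrArg M.val, val_inj⟩

theorem exists_eq_zero_iff_eq (M : TypeStructure) [IsExtModel M] :
    ∃ t : M.D (Ty.arr Ty.nat Ty.one), ∀ a b, t a b = M.zero ↔ a = b := by
  obtain ⟨t, ht⟩ := PrimRecArith.Fun₂.dist (N := M.N) PrimRecArith.fun₂_fst PrimRecArith.fun₂_snd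
  refine ⟨t, fun a b => ?_⟩
  rw [eq_zero_iff, ht]
  exact PrimRecArith.dist_eq_zero.trans ⟨val_inj, congrArg M.val⟩

theorem exists_eq_zero_iff_imp (M : TypeStructure) [IsExtModel M] :
    ∃ t : M.D (Ty.arr Ty.nat Ty.one), ∀ a b, t a b = M.zero ↔ (a = M.zero → b = M.zero) := by
  obtain ⟨t, ht⟩ := PrimRecArith.Fun₂.mul (N := M.N)
    (PrimRecArith.Fun₂.monus (PrimRecArith.fun₂_const 1) PrimRecArith.fun₂_fst)
    PrimRecArith.fun₂_snd
  refine ⟨t, fun a b => ?_⟩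
  rw [eq_zero_iff, eq_zero_iff, eq_zero_iff, ht]
  exact PrimRecArith.one_monus_mul_eq_zero

theorem add_eq_zero_iff {a b : M.D Ty.nat} : M.add a b = M.zero ↔ a = M.zero ∧ b = M.zero := by
  rw [eq_zero_iff, eq_zero_iff, eq_zero_iff, val_add]
  refine ⟨fun h => ⟨PrimRecArith.eq_zero_of_add_eq_zero_right h,
    PrimRecArith.eq_zero_of_add_eq_zero_left h⟩, ?_⟩
  rintro ⟨ha, hb⟩
  rw [ha, hb, add_zero]

theorem mul_eq_zero_iff {a b : M.D Ty.nat} : M.mul a b = M.zero ↔ a = M.zero ∨ b = M.zero := by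
  rw [eq_zero_iff, eq_zero_iff, eq_zero_iff, val_mul]
  refine ⟨PrimRecArith.eq_zero_or_eq_zero_of_mul_eq_zero, ?_⟩
  rintro (h | h) <;> rw [h]
  exacts [zero_mul _, mul_zero _]

theorem succ_zero_ne_zero : M.succ M.zero ≠ M.zero := fun h =>
  IsModel.succ_ne_zero M.zero (congrArg M.val h)

theorem exists_definable_char {A : Fm V Γ} (hA : A.QFree) :
    ∃ χ : M.Env Γ → M.D Ty.nat, M.Definable χ ∧ ∀ e, χ e = M.zero ↔ M.Sat e A := by
  induction A with
  | eq a b =>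
    obtain ⟨t, ht⟩ := M.exists_eq_zero_iff_eq
    exact ⟨_, ((Definable.const t).app (Definable.eval a)).app (Definable.eval b),
      fun e => (ht _ _).trans sat_eq.symm⟩
  | bot => exact ⟨_, Definable.const (M.succ M.zero), fun _ => iff_of_false succ_zero_ne_zero id⟩
  | and A B ihA ihB =>
    obtain ⟨χ, hχ, h⟩ := ihA hA.1
    obtain ⟨ψ, hψ, h'⟩ := ihB hA.2
    exact ⟨_, ((Definable.const M.add).app hχ).app hψ,
      fun e => add_eq_zero_iff.trans (and_congr (h e) (h' e))⟩
  | or A B ihA ihB =>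
    obtain ⟨χ, hχ, h⟩ := ihA hA.1
    obtain ⟨ψ, hψ, h'⟩ := ihB hA.2
    exact ⟨_, ((Definable.const M.mul).app hχ).app hψ,
      fun e => mul_eq_zero_iff.trans (or_congr (h e) (h' e))⟩
  | imp A B ihA ihB =>
    obtain ⟨χ, hχ, h⟩ := ihA hA.1
    obtain ⟨ψ, hψ, h'⟩ := ihB hA.2
    obtain ⟨t, ht⟩ := M.exists_eq_zero_iff_imp
    exact ⟨_, ((Definable.const t).app hχ).app hψ,
      fun e => (ht _ _).trans (imp_congr (h e) (h' e))⟩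
  | all | ex => exact hA.elim

theorem exists_realizesTruth_definable {A : Fm V Γ} (hA : A.QFree) :
    ∃ q : M.Env Γ → M.D (M.interp A).ty, M.Definable q ∧ RealizesTruth A q := by
  induction A with
  | eq a b => exact ⟨fun _ => M.zero, Definable.const _, RealizesTruth.eq a b _⟩
  | bot => exact ⟨fun _ => M.zero, Definable.const _, RealizesTruth.bot _⟩
  | and A B ihA ihB =>
    obtain ⟨q, hq, h⟩ := ihA hA.1
    obtain ⟨r, hr, h'⟩ := ihB hA.2
    exact ⟨_, hq.pair hr, h.and h'⟩
  | or A B ihA ihB =>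
    obtain ⟨q, hq, h⟩ := ihA hA.1
    obtain ⟨r, hr, h'⟩ := ihB hA.2
    obtain ⟨χ, hχ, h_char⟩ := exists_definable_char (M := M) hA.1
    exact ⟨_, hχ.pair (hq.pair hr), h.or h' h_char⟩
  | imp A B ihA ihB =>
    obtain ⟨q, -, h⟩ := ihA hA.1
    obtain ⟨r, hr, h'⟩ := ihB hA.2
    exact ⟨_, (Definable.const _).app hr, h.imp h'⟩
  | all | ex => exact hA.elim

theorem induct_of_definable {χ : M.Env (Ty.nat :: Γ) → M.D Ty.nat} (hχ : M.Definable χ)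
    (e : M.Env Γ) (h0 : χ (e.cons M.zero) = M.zero)
    (h : ∀ a, χ (e.cons a) = M.zero → χ (e.cons (M.succ a)) = M.zero) (a : M.D Ty.nat) :
    χ (e.cons a) = M.zero := by
  obtain ⟨f, -, hf⟩ := hχ.exists_curry
  let g : M.D Ty.one := M.proj _ _ M.zero
  have hg (a) : g a = M.zero := proj_app _ a
  have key := IsModel.ind (f e) g (f e) g (by rw [hf, hg, h0]; exact Or.inl rfl)
    (fun a ha => by
      rw [hf, hg, or_self_iff] at ha
      rw [hf, hg, h a (val_inj ha)]
      exact Or.inl rfl) a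
  rw [hf, hg, or_self_iff] at key
  exact val_inj key

theorem sat_induct {A : Fm V (Ty.nat :: Γ)} (hA : A.QFree) {e : M.Env Γ}
    (h0 : M.Sat (e.cons M.zero) A)
    (h : ∀ a, M.Sat (e.cons a) A → M.Sat (e.cons (M.succ a)) A) (a : M.D Ty.nat) :
    M.Sat (e.cons a) A := by
  obtain ⟨χ, hχ, h_char⟩ := exists_definable_char (M := M) hA
  refine (h_char _).1 (induct_of_definable hχ e ((h_char _).2 h0) (fun b hb => ?_) a)
  exact (h_char _).2 (h b ((h_char _).1 hb))

/-! ### Realizers of the axioms -/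

theorem entails_of_exFree {A : Fm V Γ} {C : M.RealizerPred (M.Env Γ)} (hA : A.ExFree)
    (h : ∀ e, M.Sat e A) : Entails C (M.interp A) := by
  obtain ⟨c, hc⟩ := exists_realizesTruth_const (M := M) hA
  exact Entails.of_realizer (Definable.const c) fun e => hc.rel (h e)

theorem entails_induction (h : V Ty.nat) (A : Fm V (Ty.nat :: Γ)) (hA : A.QFree)
    (C : M.RealizerPred (M.Env Γ)) :
    Entails C (M.interp (Fm.imp
      (Fm.and (A.inst Tm.zero)
        (Fm.all h (Fm.imp A (A.subst (Sub.cons (Sub.shift Γ Ty.nat) Tm.v0.suc)))))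
      (Fm.all h A))) := by
  obtain ⟨q, q_def, hq⟩ := exists_realizesTruth_definable (M := M) hA
  obtain ⟨g, g_def, hg⟩ := q_def.exists_curry
  refine Entails.of_realizer (g := fun e => M.proj _ _ (g e)) ((Definable.const _).app g_def)
    fun e d hd => ?_
  have sat_zero : M.Sat (e.cons M.zero) A := by
    obtain ⟨d', hd'⟩ := (exists_rel_subst A _ e).1 ⟨_, hd.1⟩
    rw [Env.sub_cons] at hd'
    exact hq.sat hd'
  have sat_succ (a) (ha : M.Sat (e.cons a) A) : M.Sat (e.cons (M.succ a)) A := by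
    obtain ⟨d', hd'⟩ := (exists_rel_subst A _ (e.cons a)).1 ⟨_, hd.2 a _ (hq.rel ha)⟩
    rw [Env.sub_cons] at hd'
    exact hq.sat hd'
  refine rel_proj_app (fun a => ?_) d
  rw [hg]
  exact hq.rel (sat_induct hA sat_zero sat_succ a)

theorem entails_of_HA {A : Fm V Γ} (h : HA V Γ A) (C : M.RealizerPred (M.Env Γ)) :
    Entails C (M.interp A) := by
  cases h with
  | eq_refl s => exact entails_of_exFree trivial fun _ => rfl
  | eq_symm s t => exact entails_of_exFree ⟨trivial, trivial⟩ fun _ h => Eq.symm h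
  | eq_trans r s t =>
    exact entails_of_exFree ⟨⟨trivial, trivial⟩, trivial⟩ fun _ h => Eq.trans h.1 h.2
  | ext hρ hτ s t r =>
    refine entails_of_exFree ⟨Fm.eqAt_exFree _ _ _, Fm.eqAt_exFree _ _ _⟩ fun e h => ?_
    rw [sat_eqAt] at h ⊢
    rw [eval, eval, IsExtModel.eq_of_ptEq h]
    exact PtEq.refl _
  | succ_ne_zero s =>
    exact entails_of_exFree ⟨trivial, trivial⟩ fun _ h => IsModel.succ_ne_zero _ h
  | succ_inj s t =>
    exact entails_of_exFree ⟨trivial, trivial⟩ fun _ h => IsModel.succ_inj _ _ h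
  | add_zero s => exact entails_of_exFree trivial fun _ => IsModel.add_zero _
  | add_succ s t => exact entails_of_exFree trivial fun _ => IsModel.add_succ _ _
  | mul_zero s => exact entails_of_exFree trivial fun _ => IsModel.mul_zero _
  | mul_succ s t => exact entails_of_exFree trivial fun _ => IsModel.mul_succ _ _
  | proj s t u =>
    exact entails_of_exFree trivial fun e => sat_eq.2 (eval_applyArgs e u (proj_app _ _))
  | comb r s t u =>
    exact entails_of_exFree trivial fun e => sat_eq.2 (eval_applyArgs e u (comb_app _ _ _))
  | rec_zero y z => exact entails_of_exFree trivial fun _ => IsModel.rec_zero _ _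
  | rec_succ n y z => exact entails_of_exFree trivial fun _ => IsModel.rec_succ _ _ _
  | induction h A hA => exact entails_induction h A hA C

theorem entails_of_AC {A : Fm V Γ} (h : AC V Γ A) (C : M.RealizerPred (M.Env Γ)) :
    Entails C (M.interp A) := by
  obtain @⟨ρ, τ, hρ, hτ, hY, A⟩ := h
  refine Entails.impI ((Entails.andE1 Entails.refl).trans ?_)
  -- A realizer `d` of `∀x ∃y A` yields the function `λa. fst (d a)`, realized by `λa. snd (d a)`.
  have app_def : M.Definable fun e : M.Env (ρ :: Ty.arr ρ (prodTy τ (M.interp A).ty) :: Γ) =>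
      e.tail.head e.head :=
    (Definable.var Var.zero.succ).app (Definable.var Var.zero)
  obtain ⟨f, f_def, hf⟩ := app_def.fst.exists_curry
  obtain ⟨g, g_def, hg⟩ := app_def.snd.exists_curry
  change Entails (all (ex (M.interp A))) (ex (all (M.interp A.choiceInst)))
  rw [Fm.choiceInst, interp_subst]
  refine Entails.of_definable (f_def.pair g_def) fun e d hd => ex_rel_pair fun a => ?_
  change (M.interp A).rel (Env.sub _ _) _
  rw [Env.sub_cons, Env.sub_cons]
  exact rel_congr (congrArg (Env.cons (e.cons a)) (hf _ _)) (hg _ _) (hd a)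

theorem entails_of_IPef {A : Fm V Γ} (h : IPef V Γ A) (C : M.RealizerPred (M.Env Γ)) :
    Entails C (M.interp A) := by
  obtain @⟨σ, h, A, hA, B⟩ := h
  -- The realizer `c` of `A` does not depend on whether `A` is true.
  obtain ⟨c, hc⟩ := exists_realizesTruth_const (M := M) hA
  refine Entails.impI ((Entails.andE1 Entails.refl).trans ?_)
  change Entails (imp (M.interp A) (ex (M.interp B)))
    (ex (imp (M.interp (A.weaken σ)) (M.interp B)))
  rw [interp_weaken]
  have app_def := (Definable.head (M := M) (Γ := Γ)
    (ρ := Ty.arr (M.interp A).ty (prodTy σ (M.interp B).ty))).app (Definable.const c)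
  refine Entails.of_definable (app_def.fst.pair
    ((Definable.const (M.proj _ (M.interp A).ty)).app app_def.snd))
    fun e d hd => ex_rel_pair fun a ha => ?_
  exact rel_proj_app (A := M.interp B) (hd c (hc.rel (hc.sat ha))) a

theorem exists_choice (M : TypeStructure) [IsExtModel M] {A : Fm AnyType [τ, ρ]}
    (hA : (allEx A).Gamma1) (h : Provable I0 (allEx A)) :
    ∃ t : M.D (Ty.arr ρ τ), ∀ a, M.Sat (((Env.nil M).cons a).cons (t a)) A := by
  have axiom_entails (Γ : List Ty) (B : Fm AnyType Γ) (hB : B ∈ I0 Γ) (C) :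
      Entails C (M.interp B) := by
    rcases hB with hB | hB | hB
    exacts [entails_of_HA hB C, entails_of_AC hB C, entails_of_IPef hB C]
  obtain ⟨f, -, hf⟩ := entails_of_der axiom_entails h
  let d : M.D (Ty.arr ρ (prodTy τ (M.interp A).ty)) := f (Env.nil M) M.zero
  have hd (a) : (M.interp A).rel (((Env.nil M).cons a).cons (fst (d a))) (snd (d a)) :=
    hf (Env.nil M) M.zero trivial a
  obtain ⟨g, -, hg⟩ :=
    ((Definable.const (Γ := [ρ]) d).app (Definable.var Var.zero)).fst.exists_curry
  refine ⟨g (Env.nil M), fun a => ?_⟩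
  rw [hg]
  exact sat_of_rel_of_gamma1 (A := A) hA (hd a)

end TypeStructure

/-! ### Countability of the language -/

/-- The Gödel number of a type. -/
def Ty.code : Ty → ℕ
  | Ty.nat => 0
  | Ty.arr σ τ => Nat.pair σ.code τ.code + 1

theorem Ty.code_injective : Function.Injective Ty.code := by
  intro σ
  induction σ with
  | nat => rintro (_ | _) h <;> trivial
  | arr σ₁ σ₂ h₁ h₂ =>
    rintro (_ | ⟨τ₁, τ₂⟩) h
    · trivial
    · simp only [Ty.code, Nat.add_right_cancel_iff, Nat.pair_eq_pair] at h
      rw [h₁ h.1, h₂ h.2]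

instance : Countable Ty := Ty.code_injective.countable

/-- The de Bruijn index of a variable. -/
def Var.code : {Γ : List Ty} → {σ : Ty} → Var Γ σ → ℕ
  | _, _, Var.zero => 0
  | _, _, Var.succ v => v.code + 1

theorem Var.sigma_eq_of_code_eq {v : Var Γ σ} {σ' : Ty} {v' : Var Γ σ'}
    (h : v.code = v'.code) : (⟨σ, v⟩ : Σ σ, Var Γ σ) = ⟨σ', v'⟩ := by
  induction v with
  | zero => cases v' <;> trivial
  | succ v ih =>
    cases v' with
    | zero => trivial
    | succ v' =>
      cases ih (Nat.succ_injective h)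
      rfl

/-- The Gödel number of a term. The type of the term can be read off from it. -/
def Tm.code : {σ : Ty} → Tm Γ σ → ℕ
  | _, Tm.var v => Nat.pair 0 v.code
  | _, Tm.zero => Nat.pair 1 0
  | _, Tm.succ => Nat.pair 2 0
  | _, Tm.add => Nat.pair 3 0
  | _, Tm.mul => Nat.pair 4 0
  | _, Tm.proj ρ τ => Nat.pair 5 (Nat.pair ρ.code τ.code)
  | _, Tm.comb δ ρ τ => Nat.pair 6 (Nat.pair δ.code (Nat.pair ρ.code τ.code))
  | _, Tm.recr => Nat.pair 7 0
  | _, Tm.app f a => Nat.pair 8 (Nat.pair f.code a.code)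

theorem Tm.sigma_eq_of_code_eq {t : Tm Γ σ} {σ' : Ty} {t' : Tm Γ σ'}
    (h : t.code = t'.code) : (⟨σ, t⟩ : Σ σ, Tm Γ σ) = ⟨σ', t'⟩ := by
  induction t generalizing σ' <;> cases t' <;>
    simp only [Tm.code, Nat.pair_eq_pair, Nat.reduceEqDiff, false_and, true_and,
      Ty.code_injective.eq_iff, OfNat.zero_ne_ofNat, OfNat.ofNat_ne_zero, zero_ne_one, one_ne_zero,
      OfNat.one_ne_ofNat, OfNat.ofNat_ne_one] at h
  case var.var => cases Var.sigma_eq_of_code_eq h; rfl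
  case proj.proj => obtain ⟨rfl, rfl⟩ := h; rfl
  case comb.comb => obtain ⟨rfl, rfl, rfl⟩ := h; rfl
  case app.app hf ha _ _ _ => cases hf h.1; cases ha h.2; rfl
  all_goals rfl

theorem Tm.code_injective : Function.Injective (Tm.code (Γ := Γ) (σ := σ)) := fun _ _ h => by
  cases Tm.sigma_eq_of_code_eq h
  rfl

/-- The Gödel number of a formula. -/
def Fm.code : {Γ : List Ty} → Fm V Γ → ℕ
  | _, Fm.eq a b => Nat.pair 0 (Nat.pair a.code b.code)
  | _, Fm.bot => Nat.pair 1 0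
  | _, Fm.and A B => Nat.pair 2 (Nat.pair A.code B.code)
  | _, Fm.or A B => Nat.pair 3 (Nat.pair A.code B.code)
  | _, Fm.imp A B => Nat.pair 4 (Nat.pair A.code B.code)
  | _, Fm.all (σ := σ) _ A => Nat.pair 5 (Nat.pair σ.code A.code)
  | _, Fm.ex (σ := σ) _ A => Nat.pair 6 (Nat.pair σ.code A.code)

theorem Fm.code_injective : Function.Injective (Fm.code (V := V) (Γ := Γ)) := by
  intro A B h
  induction A <;> cases B <;>
    simp only [Fm.code, Nat.pair_eq_pair, Nat.reduceEqDiff, false_and, true_and,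
      Ty.code_injective.eq_iff, Tm.code_injective.eq_iff, OfNat.zero_ne_ofNat,
      OfNat.ofNat_ne_zero, zero_ne_one, one_ne_zero, OfNat.one_ne_ofNat, OfNat.ofNat_ne_one] at h
  case eq.eq => rw [h.1, h.2]
  case bot.bot => rfl
  case all.all ih _ _ _ => obtain ⟨rfl, h⟩ := h; rw [ih h]
  case ex.ex ih _ _ _ => obtain ⟨rfl, h⟩ := h; rw [ih h]
  all_goals rename_i ih ih' _ _; rw [ih h.1, ih' h.2]

instance : Countable (Fm V Γ) := Fm.code_injective.countable

section Completeness

open Filter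

/-! ### Henkin chains -/

/-- `A n` is eventually the same formula, up to the substitutions `s n` that connect the contexts
`C n`. -/
def EventuallyStable {C : ℕ → List Ty} (s : ∀ n, Sub (C n) (C (n + 1)))
    (A : ∀ n, Fm V (C n)) : Prop :=
  ∀ᶠ n in atTop, A (n + 1) = (A n).subst (s n)

/-- An increasing chain of consistent finite sets of formulas over increasing contexts that decides
all formulas and has witnesses for existential formulas. -/
structure HenkinChain (T : Theory V) where
  ctx : ℕ → List Ty
  hyps : ∀ n, List (Fm V (ctx n))
  shift : ∀ n, Sub (ctx n) (ctx (n + 1))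
  consistent : ∀ n, ¬ Der T (ctx n) (hyps n) Fm.bot
  subst_mem : ∀ {n} {A : Fm V (ctx n)}, A ∈ hyps n → A.subst (shift n) ∈ hyps (n + 1)
  decides : ∀ {A : ∀ n, Fm V (ctx n)}, EventuallyStable shift A →
    ∃ᶠ n in atTop, (A n).subst (shift n) ∈ hyps (n + 1) ∨ (A n).neg.subst (shift n) ∈ hyps (n + 1)
  witness : ∀ {σ : Ty} {h : V σ} {A : ∀ n, Fm V (σ :: ctx n)},
    EventuallyStable shift (fun n => Fm.ex h (A n)) → (∀ᶠ n in atTop, Fm.ex h (A n) ∈ hyps n) →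
    ∃ᶠ n in atTop, ∃ t, (A n).subst ((shift n).cons t) ∈ hyps (n + 1)

/-- `CtxExt Γ Δ` is inhabited, by at most one element, if `Δ` arises from `Γ` by adding variables
in front. -/
inductive CtxExt (Γ : List Ty) : List Ty → Type
  | refl : CtxExt Γ Γ
  | step {Δ : List Ty} (σ : Ty) : CtxExt Γ Δ → CtxExt Γ (σ :: Δ)

namespace CtxExt

/-- The substitution that regards the variables of a context as variables of an extension. -/
def sub : {Δ : List Ty} → CtxExt Γ Δ → Sub Γ Δ
  | _, refl => Sub.id Γ
  | _, step σ e => e.sub.comp (Sub.shift _ σ)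

theorem length_le (e : CtxExt Γ Δ) : Γ.length ≤ Δ.length := by
  induction e with
  | refl => exact le_rfl
  | step _ _ ih => exact ih.trans (Nat.le_succ _)

theorem not_cons (e : CtxExt (σ :: Γ) Γ) : False :=
  absurd e.length_le (Nat.not_succ_le_self _)

theorem heq_refl (e : CtxExt Γ Δ) (h : Δ = Γ) : HEq e (refl : CtxExt Γ Γ) := by
  cases e with
  | refl => rfl
  | step σ e =>
    subst h
    exact e.not_cons.elim

instance : Subsingleton (CtxExt Γ Δ) := ⟨fun e => by
  induction e with
  | refl => exact fun e' => (eq_of_heq (e'.heq_refl rfl)).symm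
  | step _ e ih =>
    intro e'
    cases e' with
    | refl => exact e.not_cons.elim
    | step _ e' => rw [ih e']⟩

end CtxExt

section HenkinStep

/-- Add a formula, with a new variable as a witness if it is existential, and with an unused new
variable otherwise. -/
def witnessStep (Φ : List (Fm V Γ)) : Fm V Γ → Σ σ : Ty, List (Fm V (σ :: Γ))
  | Fm.ex (σ := σ) h B => ⟨σ, B :: (Fm.ex h B :: Φ).map (Fm.weaken σ)⟩
  | A => ⟨Ty.nat, (A :: Φ).map (Fm.weaken Ty.nat)⟩

open Classical in
/-- Add a formula and a witness for it if this is consistent, otherwise its negation. -/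
noncomputable def henkinStep (T : Theory V) (Φ : List (Fm V Γ)) (A : Fm V Γ) :
    Σ σ : Ty, List (Fm V (σ :: Γ)) :=
  if Der T Γ (A :: Φ) Fm.bot then ⟨Ty.nat, (A.neg :: Φ).map (Fm.weaken Ty.nat)⟩
  else witnessStep Φ A

variable {T : Theory V} {Φ : List (Fm V Γ)} {A B : Fm V Γ}

theorem weaken_mem_witnessStep (h : B ∈ A :: Φ) :
    B.weaken (witnessStep Φ A).1 ∈ (witnessStep Φ A).2 := by
  cases A with
  | ex hσ A => exact List.mem_cons_of_mem _ (List.mem_map_of_mem h)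
  | _ => exact List.mem_map_of_mem h

theorem consistent_weaken (hV : V Ty.nat) (h : ¬ Der T Γ Φ Fm.bot) :
    ¬ Der T (Ty.nat :: Γ) (Φ.map (Fm.weaken Ty.nat)) Fm.bot :=
  fun hd => h (Der.allE (A := Fm.bot) Tm.zero (Der.allI hV hd))

theorem consistent_witnessStep (hV : V Ty.nat) (h : ¬ Der T Γ (A :: Φ) Fm.bot) :
    ¬ Der T ((witnessStep Φ A).1 :: Γ) (witnessStep Φ A).2 Fm.bot := by
  cases A with
  | ex hσ A => exact fun hd => h (Der.exE (Der.hyp List.mem_cons_self) hd)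
  | _ => exact consistent_weaken hV h

theorem henkinStep_of_der (h : Der T Γ (A :: Φ) Fm.bot) :
    henkinStep T Φ A = ⟨Ty.nat, (A.neg :: Φ).map (Fm.weaken Ty.nat)⟩ := if_pos h

theorem henkinStep_of_not_der (h : ¬ Der T Γ (A :: Φ) Fm.bot) :
    henkinStep T Φ A = witnessStep Φ A := if_neg h

theorem weaken_mem_henkinStep (h : B ∈ Φ) :
    B.weaken (henkinStep T Φ A).1 ∈ (henkinStep T Φ A).2 := by
  by_cases hd : Der T Γ (A :: Φ) Fm.bot
  · rw [henkinStep_of_der hd]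
    exact List.mem_map_of_mem (List.mem_cons_of_mem _ h)
  · rw [henkinStep_of_not_der hd]
    exact weaken_mem_witnessStep (List.mem_cons_of_mem _ h)

theorem henkinStep_decides : A.weaken (henkinStep T Φ A).1 ∈ (henkinStep T Φ A).2 ∨
    A.neg.weaken (henkinStep T Φ A).1 ∈ (henkinStep T Φ A).2 := by
  by_cases hd : Der T Γ (A :: Φ) Fm.bot
  · rw [henkinStep_of_der hd]
    exact Or.inr (List.mem_map_of_mem List.mem_cons_self)
  · rw [henkinStep_of_not_der hd]
    exact Or.inl (weaken_mem_witnessStep List.mem_cons_self)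

theorem consistent_henkinStep (hV : V Ty.nat) (h : ¬ Der T Γ Φ Fm.bot) :
    ¬ Der T ((henkinStep T Φ A).1 :: Γ) (henkinStep T Φ A).2 Fm.bot := by
  by_cases hd : Der T Γ (A :: Φ) Fm.bot
  · rw [henkinStep_of_der hd]
    exact consistent_weaken hV fun hd' => h (Der.impE (Der.impI hd') (Der.impI hd))
  · rw [henkinStep_of_not_der hd]
    exact consistent_witnessStep hV hd

theorem henkinStep_ex_witness {hσ : V σ} {B : Fm V (σ :: Γ)} (hΦ : ¬ Der T Γ Φ Fm.bot)
    (h : Fm.ex hσ B ∈ Φ) : ∃ t : Tm ((henkinStep T Φ (Fm.ex hσ B)).1 :: Γ) σ,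
      B.subst ((Sub.shift Γ _).cons t) ∈ (henkinStep T Φ (Fm.ex hσ B)).2 := by
  have consistent : ¬ Der T Γ (Fm.ex hσ B :: Φ) Fm.bot := fun hd =>
    hΦ (Der.impE (Der.impI hd) (Der.hyp h))
  rw [henkinStep_of_not_der consistent]
  refine ⟨Tm.v0, ?_⟩
  change B.subst ((Sub.shift Γ σ).cons Tm.v0) ∈ B :: (Fm.ex hσ B :: Φ).map (Fm.weaken σ)
  rw [Sub.shift_cons_v0, Fm.subst_id]
  exact List.mem_cons_self

end HenkinStep

section Construction

variable {T : Theory V}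

theorem exists_frequently_eq (α : Type*) [Countable α] [Nonempty α] :
    ∃ u : ℕ → α, ∀ a, ∃ᶠ n in atTop, u n = a := by
  obtain ⟨u, hu⟩ := exists_surjective_nat α
  refine ⟨fun n => u n.unpair.1, fun a => frequently_atTop.2 fun N => ?_⟩
  obtain ⟨i, rfl⟩ := hu a
  exact ⟨Nat.pair i N, Nat.right_le_pair i N, congrArg (fun p => u p.1) (Nat.unpair_pair i N)⟩

open Classical in
/-- The formula `p`, regarded as a formula over `Γ` if its variables are among `Γ`, and `⊥`
otherwise. -/
noncomputable def extendOrBot (p : Σ Γ : List Ty, Fm V Γ) (Γ : List Ty) : Fm V Γ :=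
  if h : Nonempty (CtxExt p.1 Γ) then p.2.subst h.some.sub else Fm.bot

theorem extendOrBot_eq (A : Fm V Γ) (e : CtxExt Γ Δ) : extendOrBot ⟨Γ, A⟩ Δ = A.subst e.sub := by
  have h : Nonempty (CtxExt Γ Δ) := ⟨e⟩
  rw [extendOrBot, dif_pos h, Subsingleton.elim h.some e]

/-- The contexts and sets of formulas that arise from the sentence `A` by treating the formulas
`en 0`, `en 1`, … in this order. -/
noncomputable def henkinState (T : Theory V) (A : Fm V []) (en : ℕ → Σ Γ : List Ty, Fm V Γ) :
    ℕ → Σ Γ : List Ty, List (Fm V Γ)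
  | 0 => ⟨[], [A]⟩
  | n + 1 =>
    let S := henkinState T A en n
    ⟨(henkinStep T S.2 (extendOrBot (en n) S.1)).1 :: S.1,
      (henkinStep T S.2 (extendOrBot (en n) S.1)).2⟩

variable {A : Fm V []} {en : ℕ → Σ Γ : List Ty, Fm V Γ}

theorem consistent_henkinState (hV : V Ty.nat) (hA : ¬ Der T [] [A] Fm.bot) (n : ℕ) :
    ¬ Der T (henkinState T A en n).1 (henkinState T A en n).2 Fm.bot := by
  induction n with
  | zero => exact hA
  | succ n ih => exact consistent_henkinStep hV ih

theorem exists_ctxExt_henkinState {B : ∀ n, Fm V (henkinState T A en n).1} {N : ℕ}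
    (hB : ∀ n ≥ N, B (n + 1) = (B n).subst (Sub.shift _ _)) {n : ℕ} (hn : N ≤ n) :
    ∃ e : CtxExt (henkinState T A en N).1 (henkinState T A en n).1,
      B n = (B N).subst e.sub := by
  induction n, hn using Nat.le_induction with
  | base => exact ⟨CtxExt.refl, (Fm.subst_id _).symm⟩
  | succ n hn ih =>
    obtain ⟨e, he⟩ := ih
    refine ⟨CtxExt.step _ e, ?_⟩
    rw [hB n hn, he, Fm.subst_subst]
    rfl

theorem frequently_extendOrBot_eq (hen : ∀ p, ∃ᶠ n in atTop, en n = p)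
    {B : ∀ n, Fm V (henkinState T A en n).1}
    (hB : EventuallyStable (fun _ => Sub.shift _ _) B) :
    ∃ᶠ n in atTop, extendOrBot (en n) (henkinState T A en n).1 = B n := by
  obtain ⟨N, hB⟩ := eventually_atTop.1 hB
  refine ((hen ⟨_, B N⟩).and_eventually (eventually_ge_atTop N)).mono ?_
  rintro n ⟨en_eq, hn⟩
  obtain ⟨e, he⟩ := exists_ctxExt_henkinState hB hn
  rw [en_eq, extendOrBot_eq _ e, he]

/-- The chain that arises from a consistent sentence by treating every formula infinitely often. -/
noncomputable def henkinChain (hV : V Ty.nat) (hA : ¬ Der T [] [A] Fm.bot)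
    (hen : ∀ p, ∃ᶠ n in atTop, en n = p) : HenkinChain T where
  ctx n := (henkinState T A en n).1
  hyps n := (henkinState T A en n).2
  shift _ := Sub.shift _ _
  consistent := consistent_henkinState hV hA
  subst_mem := weaken_mem_henkinStep
  decides {B} hB := (frequently_extendOrBot_eq hen hB).mono fun n hn => by
    rw [← hn]
    exact henkinStep_decides
  witness {σ h B} hB hB' :=
    ((frequently_extendOrBot_eq hen hB).and_eventually hB').mono fun n hn => by
      have exists_witness := henkinStep_ex_witness (consistent_henkinState hV hA n) hn.2
      rwa [← hn.1] at exists_witness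

theorem exists_henkinChain (hV : V Ty.nat) (hA : ¬ Der T [] [A] Fm.bot) :
    ∃ H : HenkinChain T, A.subst (Sub.nil _) ∈ H.hyps 0 := by
  have : Nonempty (Σ Γ : List Ty, Fm V Γ) := ⟨⟨[], Fm.bot⟩⟩
  obtain ⟨en, hen⟩ := exists_frequently_eq (Σ Γ : List Ty, Fm V Γ)
  refine ⟨henkinChain hV hA hen, ?_⟩
  change A.subst (Sub.nil []) ∈ [A]
  rw [← Sub.eq_nil (Sub.id []), Fm.subst_id]
  exact List.mem_cons_self

end Construction

/-! ### The theory of a Henkin chain -/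

/-- Classical theories that contain the axioms of arithmetic in the finite types allowed by `V`,
such as `RCA₀^ω` and `RCA₀`. -/
class IsClassicalArithmetic (T : Theory V) : Prop where
  ha_mem : ∀ {Γ : List Ty} {A : Fm V Γ}, HA V Γ A → A ∈ T Γ
  lem_mem : ∀ {Γ : List Ty} (A : Fm V Γ), A.or A.neg ∈ T Γ

section Instantiation

theorem Fm.subst_lift_inst (A : Fm V (σ :: Γ)) (s : Sub Γ Δ) (t : Tm Δ σ) :
    (A.subst (s.lift σ)).inst t = A.subst (s.cons t) := by
  rw [Fm.inst, Fm.subst_subst]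
  congr 1
  funext τ v
  cases v with
  | zero => rfl
  | succ v => exact (Tm.subst_subst _ _ _).trans (Tm.subst_id _)

theorem Fm.inst_subst (A : Fm V (σ :: Γ)) (s : Sub Γ Δ) (t : Tm Γ σ) :
    (A.inst t).subst s = (A.subst (s.lift σ)).inst (t.subst s) := by
  rw [Fm.subst_lift_inst, Fm.inst, Fm.subst_subst]
  congr 1
  funext τ v
  cases v <;> rfl

theorem Fm.subst_shift_lift_inst_v0 (A : Fm V (σ :: Γ)) :
    (A.subst ((Sub.shift Γ σ).lift σ)).inst Tm.v0 = A := by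
  rw [Fm.subst_lift_inst, Sub.shift_cons_v0, Fm.subst_id]

theorem Fm.subst_suc_subst_lift (A : Fm V (Ty.nat :: Γ)) (s : Sub Γ Δ) :
    (A.subst (Sub.cons (Sub.shift Γ Ty.nat) Tm.v0.suc)).subst (s.lift Ty.nat) =
      (A.subst (s.lift Ty.nat)).subst (Sub.cons (Sub.shift Δ Ty.nat) Tm.v0.suc) := by
  rw [Fm.subst_subst, Fm.subst_subst]
  congr 1
  funext τ v
  cases v with
  | zero => rfl
  | succ v =>
    change (s _ v).weaken Ty.nat = ((s _ v).weaken Ty.nat).subst _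
    rw [Tm.weaken, Tm.subst_subst]
    rfl

theorem Tm.nonempty (Γ : List Ty) (σ : Ty) : Nonempty (Tm Γ σ) := by
  induction σ with
  | nat => exact ⟨Tm.zero⟩
  | arr ρ τ _ h => exact ⟨Tm.app (Tm.proj _ _) h.some⟩

end Instantiation

namespace EventuallyStable

variable {C : ℕ → List Ty} {s : ∀ n, Sub (C n) (C (n + 1))} {A B : ∀ n, Fm V (C n)}
  {A' : ∀ n, Fm V (σ :: C n)}

theorem and (h : EventuallyStable s A) (h' : EventuallyStable s B) :
    EventuallyStable s fun n => (A n).and (B n) := by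
  filter_upwards [h, h'] with n hn hn'
  rw [hn, hn', Fm.subst]

theorem or (h : EventuallyStable s A) (h' : EventuallyStable s B) :
    EventuallyStable s fun n => (A n).or (B n) := by
  filter_upwards [h, h'] with n hn hn'
  rw [hn, hn', Fm.subst]

theorem imp (h : EventuallyStable s A) (h' : EventuallyStable s B) :
    EventuallyStable s fun n => (A n).imp (B n) := by
  filter_upwards [h, h'] with n hn hn'
  rw [hn, hn', Fm.subst]

theorem neg (h : EventuallyStable s A) : EventuallyStable s fun n => (A n).neg := by
  filter_upwards [h] with n hn
  rw [hn, Fm.neg, Fm.neg, Fm.subst, Fm.subst]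

theorem all (h : EventuallyStable (fun n => (s n).lift σ) A') (hσ : V σ) :
    EventuallyStable s fun n => Fm.all hσ (A' n) := by
  filter_upwards [h] with n hn
  rw [hn, Fm.subst]

theorem ex (h : EventuallyStable (fun n => (s n).lift σ) A') (hσ : V σ) :
    EventuallyStable s fun n => Fm.ex hσ (A' n) := by
  filter_upwards [h] with n hn
  rw [hn, Fm.subst]

end EventuallyStable

namespace HenkinChain

variable {T : Theory V} (H : HenkinChain T)

/-- `A` eventually belongs to the chain. -/
def Holds (A : ∀ n, Fm V (H.ctx n)) : Prop := ∀ᶠ n in atTop, A n ∈ H.hyps n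

/-- The objects of the term model before identification of equal numbers: sequences of terms, for
the members of the chain, that eventually stay the same term. -/
structure Elt (σ : Ty) : Type where
  tm : ∀ n, Tm (H.ctx n) σ
  stable : ∀ᶠ n in atTop, tm (n + 1) = (tm n).subst (H.shift n)

variable {H} {A B : ∀ n, Fm V (H.ctx n)} {A' : ∀ n, Fm V (σ :: H.ctx n)}

theorem stable_inst (h : EventuallyStable (fun n => (H.shift n).lift σ) A') (a : H.Elt σ) :
    EventuallyStable H.shift fun n => (A' n).inst (a.tm n) := by
  filter_upwards [h, a.stable] with n hn hn'
  rw [hn, hn', Fm.inst_subst]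

theorem holds_of_mem {m : ℕ} (hA : ∀ n ≥ m, A (n + 1) = (A n).subst (H.shift n))
    (h : A m ∈ H.hyps m) : H.Holds A := by
  refine eventually_atTop.2 ⟨m, fun n hn => ?_⟩
  induction n, hn using Nat.le_induction with
  | base => exact h
  | succ n hn ih =>
    rw [hA n hn]
    exact H.subst_mem ih

theorem holds_of_frequently (hA : EventuallyStable H.shift A)
    (h : ∃ᶠ n in atTop, (A n).subst (H.shift n) ∈ H.hyps (n + 1)) : H.Holds A := by
  obtain ⟨N, hA⟩ := eventually_atTop.1 hA
  obtain ⟨n, hn, h⟩ := frequently_atTop.1 h N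
  refine holds_of_mem (m := n + 1) (fun k hk => hA k ((Nat.le_succ_of_le hn).trans hk)) ?_
  rwa [hA n hn]

theorem holds_or_holds_neg (hA : EventuallyStable H.shift A) :
    H.Holds A ∨ H.Holds fun n => (A n).neg :=
  (frequently_or_distrib.1 (H.decides hA)).imp (holds_of_frequently hA)
    (holds_of_frequently hA.neg)

theorem not_holds_bot : ¬ H.Holds fun _ => Fm.bot := fun h =>
  let ⟨n, hn⟩ := h.exists
  H.consistent n (Der.hyp hn)

theorem not_holds_neg (h : H.Holds A) : ¬ H.Holds fun n => (A n).neg := fun h' =>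
  let ⟨n, hn, hn'⟩ := (h.and h').exists
  H.consistent n (Der.impE (Der.hyp hn') (Der.hyp hn))

theorem holds_of_der (hA : EventuallyStable H.shift A)
    (h : ∀ᶠ n in atTop, Der T (H.ctx n) (H.hyps n) (A n)) : H.Holds A :=
  (holds_or_holds_neg hA).resolve_right fun h' =>
    let ⟨n, hn, hn'⟩ := (h.and h').exists
    H.consistent n (Der.impE (Der.hyp hn') hn)

theorem holds_of_mem_theory (hA : EventuallyStable H.shift A) (h : ∀ n, A n ∈ T (H.ctx n)) :
    H.Holds A :=
  holds_of_der hA (Eventually.of_forall fun n => Der.ax (h n))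

theorem holds_and (hA : EventuallyStable H.shift A) (hB : EventuallyStable H.shift B) :
    (H.Holds fun n => (A n).and (B n)) ↔ H.Holds A ∧ H.Holds B :=
  ⟨fun h => ⟨holds_of_der hA (h.mono fun _ hn => Der.andE1 (Der.hyp hn)),
      holds_of_der hB (h.mono fun _ hn => Der.andE2 (Der.hyp hn))⟩,
    fun h => holds_of_der (hA.and hB)
      ((h.1.and h.2).mono fun _ hn => Der.andI (Der.hyp hn.1) (Der.hyp hn.2))⟩

theorem holds_imp (hA : EventuallyStable H.shift A) (hB : EventuallyStable H.shift B) :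
    (H.Holds fun n => (A n).imp (B n)) ↔ (H.Holds A → H.Holds B) := by
  refine ⟨fun h h' => holds_of_der hB
    ((h.and h').mono fun _ hn => Der.impE (Der.hyp hn.1) (Der.hyp hn.2)), fun h => ?_⟩
  rcases holds_or_holds_neg hA with hA' | hA'
  · exact holds_of_der (hA.imp hB) ((h hA').mono fun _ hn =>
      Der.impI (Der.hyp (List.mem_cons_of_mem _ hn)))
  · exact holds_of_der (hA.imp hB) (hA'.mono fun _ hn => Der.impI (Der.botE
      (Der.impE (Der.hyp (List.mem_cons_of_mem _ hn)) (Der.hyp List.mem_cons_self))))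

theorem holds_or (hA : EventuallyStable H.shift A) (hB : EventuallyStable H.shift B) :
    (H.Holds fun n => (A n).or (B n)) ↔ H.Holds A ∨ H.Holds B := by
  refine ⟨fun h => ?_, ?_⟩
  · refine (holds_or_holds_neg hA).imp_right fun hA' => holds_of_der hB ?_
    filter_upwards [h, hA'] with n hn hn'
    exact Der.orE (Der.hyp hn)
      (Der.botE (Der.impE (Der.hyp (List.mem_cons_of_mem _ hn')) (Der.hyp List.mem_cons_self)))
      (Der.hyp List.mem_cons_self)
  · rintro (h | h)
    · exact holds_of_der (hA.or hB) (h.mono fun _ hn => Der.orI1 (Der.hyp hn))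
    · exact holds_of_der (hA.or hB) (h.mono fun _ hn => Der.orI2 (Der.hyp hn))

theorem exists_elt {m : ℕ} (t : Tm (H.ctx m) σ) : ∃ a : H.Elt σ, a.tm m = t ∧
    ∀ n ≥ m, a.tm (n + 1) = (a.tm n).subst (H.shift n) := by
  let u : ∀ n, Tm (H.ctx n) σ := fun n =>
    if h : m ≤ n then
      Nat.leRecOn (C := fun n => Tm (H.ctx n) σ) h (fun {n} u => u.subst (H.shift n)) t
    else (Tm.nonempty _ σ).some
  have u_succ : ∀ n ≥ m, u (n + 1) = (u n).subst (H.shift n) := fun n hn => by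
    simp only [u]
    rw [dif_pos hn, dif_pos (Nat.le_succ_of_le hn), Nat.leRecOn_succ hn]
  refine ⟨⟨u, eventually_atTop.2 ⟨m, u_succ⟩⟩, ?_, u_succ⟩
  simp only [u]
  rw [dif_pos le_rfl, Nat.leRecOn_self]

theorem exists_holds_inst_of_holds_ex {hσ : V σ}
    (hA : EventuallyStable (fun n => (H.shift n).lift σ) A')
    (h : H.Holds fun n => Fm.ex hσ (A' n)) :
    ∃ a : H.Elt σ, H.Holds fun n => (A' n).inst (a.tm n) := by
  obtain ⟨N, A'_succ⟩ := eventually_atTop.1 hA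
  obtain ⟨n, hn, t, ht⟩ := frequently_atTop.1 (H.witness (hA.ex hσ) h) N
  obtain ⟨a, rfl, a_succ⟩ := exists_elt t
  refine ⟨a, holds_of_mem (m := n + 1) (fun k hk => ?_) ?_⟩
  · rw [A'_succ k ((Nat.le_succ_of_le hn).trans hk), a_succ k hk, Fm.inst_subst]
  · rwa [A'_succ n hn, Fm.subst_lift_inst]

theorem holds_ex (hA : EventuallyStable (fun n => (H.shift n).lift σ) A') (hσ : V σ) :
    (H.Holds fun n => Fm.ex hσ (A' n)) ↔ ∃ a : H.Elt σ, H.Holds fun n => (A' n).inst (a.tm n) :=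
  ⟨exists_holds_inst_of_holds_ex hA, fun ⟨a, h⟩ =>
    holds_of_der (hA.ex hσ) (h.mono fun n hn => Der.exI hσ (a.tm n) (Der.hyp hn))⟩

theorem holds_all [IsClassicalArithmetic T]
    (hA : EventuallyStable (fun n => (H.shift n).lift σ) A') (hσ : V σ) :
    (H.Holds fun n => Fm.all hσ (A' n)) ↔
      ∀ a : H.Elt σ, H.Holds fun n => (A' n).inst (a.tm n) := by
  refine ⟨fun h a => holds_of_der (stable_inst hA a)
    (h.mono fun n hn => Der.allE (a.tm n) (Der.hyp hn)), fun h => ?_⟩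
  rcases holds_or_holds_neg (hA.neg.ex hσ) with ex_neg | not_ex_neg
  · obtain ⟨a, ha⟩ := (holds_ex hA.neg hσ).1 ex_neg
    exact absurd ha (not_holds_neg (h a))
  · refine holds_of_der (hA.all hσ) (not_ex_neg.mono fun n hn => Der.allI hσ ?_)
    refine Der.orE (Der.ax (IsClassicalArithmetic.lem_mem (A' n))) (Der.hyp List.mem_cons_self)
      (Der.botE (Der.impE (A := (Fm.ex hσ (A' n).neg).weaken σ) (Der.hyp ?_) (Der.exI hσ Tm.v0 ?_)))
    · exact List.mem_cons_of_mem _ (List.mem_map_of_mem (f := Fm.weaken σ) hn)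
    · rw [Fm.subst_shift_lift_inst_v0]
      exact Der.hyp List.mem_cons_self

end HenkinChain

open TypeStructure

theorem Fm.QFree.subst {A : Fm V Γ} (hA : A.QFree) (s : Sub Γ Δ) : (A.subst s).QFree := by
  induction A generalizing Δ with
  | eq | bot => trivial
  | and A B ihA ihB | or A B ihA ihB | imp A B ihA ihB => exact ⟨ihA hA.1 s, ihB hA.2 s⟩
  | all | ex => exact hA.elim

namespace HenkinChain

variable {T : Theory V} {H : HenkinChain T}

/-! ### The term model -/

theorem Elt.stable_eq (a b : H.Elt Ty.nat) :
    EventuallyStable H.shift fun n => (Fm.eq (a.tm n) (b.tm n) : Fm V _) := by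
  filter_upwards [a.stable, b.stable] with n ha hb
  rw [ha, hb, Fm.subst]

section TermModel

variable [IsClassicalArithmetic T]

open IsClassicalArithmetic

variable (H)

/-- Provable equality of numbers. -/
def natSetoid : Setoid (H.Elt Ty.nat) where
  r a b := H.Holds fun n => Fm.eq (a.tm n) (b.tm n)
  iseqv :=
    { refl := fun a => holds_of_mem_theory (a.stable_eq a) fun _ => ha_mem (HA.eq_refl _)
      symm := fun {a b} =>
        (holds_imp (a.stable_eq b) (b.stable_eq a)).1
          (holds_of_mem_theory ((a.stable_eq b).imp (b.stable_eq a))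
            fun _ => ha_mem (HA.eq_symm _ _))
      trans := fun {a b c} h h' =>
        (holds_imp ((a.stable_eq b).and (b.stable_eq c)) (a.stable_eq c)).1
          (holds_of_mem_theory (((a.stable_eq b).and (b.stable_eq c)).imp (a.stable_eq c))
            fun _ => ha_mem (HA.eq_trans _ _ _))
          ((holds_and (a.stable_eq b) (b.stable_eq c)).2 ⟨h, h'⟩) }

/-- The object denoted by a closed term, which is the same term `t Γ` in all contexts `Γ`. -/
def const (t : ∀ Γ, Tm Γ σ) (ht : ∀ n, t (H.ctx (n + 1)) = (t (H.ctx n)).subst (H.shift n)) :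
    H.Elt σ where
  tm _ := t _
  stable := Eventually.of_forall ht

/-- The term model of a Henkin chain: its objects are the terms of the chain, and two terms of
type `0` denote the same number if the chain proves them equal. -/
def termModel : TypeStructure where
  D := H.Elt
  N := Quotient H.natSetoid
  val := Quotient.mk _
  app f a :=
    { tm := fun n => Tm.app (f.tm n) (a.tm n)
      stable := by
        filter_upwards [f.stable, a.stable] with n hf ha
        rw [hf, ha, Tm.subst] }
  zero := H.const (fun _ => Tm.zero) fun _ => rfl
  succ := H.const (fun _ => Tm.succ) fun _ => rfl
  add := H.const (fun _ => Tm.add) fun _ => rfl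
  mul := H.const (fun _ => Tm.mul) fun _ => rfl
  proj ρ τ := H.const (fun _ => Tm.proj ρ τ) fun _ => rfl
  comb δ ρ τ := H.const (fun _ => Tm.comb δ ρ τ) fun _ => rfl
  recr := H.const (fun _ => Tm.recr) fun _ => rfl

variable {H}

theorem val_eq_val_iff {a b : H.Elt Ty.nat} :
    H.termModel.val a = H.termModel.val b ↔ H.Holds fun n => Fm.eq (a.tm n) (b.tm n) :=
  Quotient.eq (r := H.natSetoid)

/-- The substitutions, one for each member of the chain, that are given by an environment of the
term model. -/
def envSub (e : H.termModel.Env Γ) (n : ℕ) : Sub Γ (H.ctx n) := fun σ v => Elt.tm (e σ v) n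

theorem stable_envSub (e : H.termModel.Env Γ) :
    ∀ᶠ n in atTop, envSub e (n + 1) = (envSub e n).comp (H.shift n) := by
  induction Γ with
  | nil => exact Eventually.of_forall fun _ => (Sub.eq_nil _).trans (Sub.eq_nil _).symm
  | cons ρ Γ ih =>
    filter_upwards [ih e.tail, Elt.stable e.head] with n htail hhead
    funext σ v
    cases v with
    | zero => exact hhead
    | succ v => exact congrFun (congrFun htail σ) v

theorem envSub_cons (e : H.termModel.Env Γ) (a : H.termModel.D ρ) (n : ℕ) :
    envSub (e.cons a) n = (envSub e n).cons (Elt.tm a n) := by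
  funext σ v
  cases v <;> rfl

theorem tm_eval (e : H.termModel.Env Γ) (t : Tm Γ σ) (n : ℕ) :
    Elt.tm (H.termModel.eval e t) n = t.subst (envSub e n) := by
  induction t with
  | app f a hf ha =>
    change Tm.app _ _ = _
    rw [hf, ha, Tm.subst]
  | _ => rfl

theorem stable_subst (e : H.termModel.Env Γ) (A : Fm V Γ) :
    EventuallyStable H.shift fun n => A.subst (envSub e n) := by
  filter_upwards [stable_envSub e] with n hn
  rw [hn, Fm.subst_subst]

theorem stable_subst_lift (e : H.termModel.Env Γ) (A : Fm V (σ :: Γ)) :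
    EventuallyStable (fun n => (H.shift n).lift σ) fun n => A.subst ((envSub e n).lift σ) := by
  filter_upwards [stable_envSub e] with n hn
  rw [hn, Fm.subst_subst, Sub.lift_comp_lift]

theorem holds_iff_sat (A : Fm V Γ) (e : H.termModel.Env Γ) :
    (H.Holds fun n => A.subst (envSub e n)) ↔ H.termModel.Sat e A := by
  induction A with
  | eq a b =>
    refine Iff.trans ?_ val_eq_val_iff.symm
    simp only [tm_eval, Fm.subst]
  | bot => exact iff_of_false not_holds_bot fun h => h
  | and A B hA hB =>
    exact (holds_and (stable_subst e A) (stable_subst e B)).trans (and_congr (hA e) (hB e))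
  | or A B hA hB =>
    exact (holds_or (stable_subst e A) (stable_subst e B)).trans (or_congr (hA e) (hB e))
  | imp A B hA hB =>
    exact (holds_imp (stable_subst e A) (stable_subst e B)).trans (imp_congr (hA e) (hB e))
  | all h A hA =>
    refine (holds_all (stable_subst_lift e A) h).trans (forall_congr' fun a => ?_)
    simp only [Fm.subst_lift_inst, ← hA, envSub_cons e a]
  | ex h A hA =>
    refine (holds_ex (stable_subst_lift e A) h).trans (exists_congr fun a => ?_)
    simp only [Fm.subst_lift_inst, ← hA, envSub_cons e a]

theorem sat_of_ha {A : Fm V Γ} (e : H.termModel.Env Γ)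
    (h : ∀ n, HA V (H.ctx n) (A.subst (envSub e n))) : H.termModel.Sat e A :=
  (holds_iff_sat A e).1 (holds_of_mem_theory (stable_subst e A) fun n => ha_mem (h n))

theorem ptEq_of_ha {f g : H.Elt σ} (h : ∀ n (u : Args (H.ctx n) σ),
    HA V (H.ctx n) (Fm.eq ((f.tm n).applyArgs u) ((g.tm n).applyArgs u))) :
    H.termModel.PtEq σ f g := by
  induction σ with
  | nat =>
    exact val_eq_val_iff.2 (holds_of_mem_theory (f.stable_eq g) fun n => ha_mem (h n Args.nil))
  | arr σ τ _ ih => exact fun a => ih fun n u => h n (Args.cons (Elt.tm a n) u)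

theorem termModel_ext (hρ : ArgsIn V ρ) (hτ : ArgsIn V τ) (s t : H.termModel.D ρ)
    (r : H.termModel.D (Ty.arr ρ τ)) (h : H.termModel.PtEq ρ s t) :
    H.termModel.PtEq τ (r s) (r t) := by
  have h_ext := sat_of_ha (H := H) (A := Fm.imp (Fm.eqAt ρ hρ Tm.v0 Tm.v1)
      (Fm.eqAt τ hτ (Tm.app Tm.v2 Tm.v0) (Tm.app Tm.v2 Tm.v1)))
    ((((Env.nil _).cons r).cons t).cons s) fun n => by
      rw [Fm.subst, Fm.eqAt_subst, Fm.eqAt_subst]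
      exact HA.ext _ _ _ _ _
  rw [Sat, sat_eqAt, sat_eqAt] at h_ext
  exact h_ext h

theorem sat_of_induction (hV : V Ty.nat) {A : Fm V (Ty.nat :: Γ)} (hA : A.QFree)
    {e : H.termModel.Env Γ} (h_zero : H.termModel.Sat (e.cons H.termModel.zero) A)
    (h_succ : ∀ a, H.termModel.Sat (e.cons a) A →
      H.termModel.Sat (e.cons (H.termModel.succ a)) A) (a : H.termModel.D Ty.nat) :
    H.termModel.Sat (e.cons a) A := by
  have h_ind := sat_of_ha (H := H) (A := Fm.imp (Fm.and (A.inst Tm.zero)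
      (Fm.all hV (Fm.imp A (A.subst (Sub.cons (Sub.shift _ Ty.nat) Tm.v0.suc))))) (Fm.all hV A))
    e fun n => by
      simp only [Fm.subst, Fm.inst_subst, Fm.subst_suc_subst_lift]
      exact HA.induction hV _ (hA.subst _)
  simp only [Sat, Fm.inst, sat_subst, Env.sub_cons] at h_ind
  exact h_ind ⟨h_zero, h_succ⟩ a

theorem isModel_termModel (hV : V Ty.nat) : IsModel V H.termModel where
  nat_mem := hV
  val_surj := Quotient.mk_surjective
  ext := termModel_ext
  succ_ne_zero a := sat_of_ha (A := Fm.neg (Fm.eq Tm.v0.suc Tm.zero))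
    ((Env.nil _).cons a) fun _ => HA.succ_ne_zero _
  succ_inj a b := sat_of_ha (A := Fm.imp (Fm.eq Tm.v1.suc Tm.v0.suc) (Fm.eq Tm.v1 Tm.v0))
    (((Env.nil _).cons a).cons b) fun _ => HA.succ_inj _ _
  add_zero a := sat_of_ha (A := Fm.eq (Tm.v0.plus Tm.zero) Tm.v0)
    ((Env.nil _).cons a) fun _ => HA.add_zero _
  add_succ a b := sat_of_ha (A := Fm.eq (Tm.v1.plus Tm.v0.suc) (Tm.v1.plus Tm.v0).suc)
    (((Env.nil _).cons a).cons b) fun _ => HA.add_succ _ _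
  mul_zero a := sat_of_ha (A := Fm.eq (Tm.v0.times Tm.zero) Tm.zero)
    ((Env.nil _).cons a) fun _ => HA.mul_zero _
  mul_succ a b := sat_of_ha (A := Fm.eq (Tm.v1.times Tm.v0.suc) ((Tm.v1.times Tm.v0).plus Tm.v1))
    (((Env.nil _).cons a).cons b) fun _ => HA.mul_succ _ _
  proj_eq _ _ := ptEq_of_ha fun _ u => HA.proj _ _ u
  comb_eq _ _ _ := ptEq_of_ha fun _ u => HA.comb _ _ _ u
  rec_zero y z := sat_of_ha (A := Fm.eq (Tm.rec0 Tm.zero Tm.v1 Tm.v0) Tm.v1)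
    (((Env.nil _).cons y).cons z) fun _ => HA.rec_zero _ _
  rec_succ k y z := sat_of_ha (A := Fm.eq (Tm.rec0 Tm.v2.suc Tm.v1 Tm.v0)
      (Tm.app (Tm.app Tm.v0 (Tm.rec0 Tm.v2 Tm.v1 Tm.v0)) Tm.v2))
    ((((Env.nil _).cons k).cons y).cons z) fun _ => HA.rec_succ _ _ _
  ind f g f' g' := sat_of_induction hV
    (A := Fm.or (Fm.eq (Tm.app Tm.v1 Tm.v0) (Tm.app Tm.v2 Tm.v0))
      (Fm.eq (Tm.app (Tm.var Var.zero.succ.succ.succ) Tm.v0)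
        (Tm.app (Tm.var Var.zero.succ.succ.succ.succ) Tm.v0)))
    (by exact ⟨trivial, trivial⟩) (e := ((((Env.nil _).cons g').cons f').cons g).cons f)

end TermModel

end HenkinChain

theorem exists_model_not_sat {T : Theory V} [IsClassicalArithmetic T] (hV : V Ty.nat)
    {A : Fm V []} (h : ¬ Provable T A) : ∃ M, IsModel V M ∧ ¬ M.Sat (Env.nil M) A := by
  have not_der : ¬ Der T [] [A.neg] Fm.bot := fun hd => h (Der.orE
    (Der.ax (IsClassicalArithmetic.lem_mem A)) (Der.hyp List.mem_cons_self) (Der.botE hd))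
  obtain ⟨H, hH⟩ := exists_henkinChain hV not_der
  refine ⟨H.termModel, HenkinChain.isModel_termModel hV, ?_⟩
  have sat_neg : H.termModel.Sat (Env.nil _) A.neg := by
    simp only [← HenkinChain.holds_iff_sat, Sub.eq_nil (HenkinChain.envSub _ _)]
    refine HenkinChain.holds_of_mem (fun n _ => ?_) hH
    rw [Fm.subst_subst, Sub.eq_nil (Sub.comp _ _)]
  exact sat_neg

end Completeness

namespace TypeStructure

variable {M : TypeStructure}

/-! ### Sequential forms in extensional models -/

theorem val_eval_pair [IsModel V M] (e : M.Env Γ) (s t : Tm Γ Ty.nat) :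
    M.val (M.eval e (Tm.pair s t)) =
      PrimRecArith.pair (M.val (M.eval e s)) (M.val (M.eval e t)) := by
  simp only [Tm.pair, Tm.plus, Tm.times, eval, val_add, val_mul, PrimRecArith.pair]

section ExtModel

variable [IsExtModel M]

theorem exists_unpair (M : TypeStructure) [IsExtModel M] :
    ∃ p q : M.D Ty.one, ∀ {Γ : List Ty} (e : M.Env Γ) (s t : Tm Γ Ty.nat),
      p (M.eval e (Tm.pair s t)) = M.eval e s ∧ q (M.eval e (Tm.pair s t)) = M.eval e t := by
  obtain ⟨p, hp⟩ := PrimRecArith.fun₁_unpairFst (N := M.N)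
  obtain ⟨q, hq⟩ := PrimRecArith.fun₁_unpairSnd (N := M.N)
  refine ⟨p, q, fun e s t => ⟨val_inj ?_, val_inj ?_⟩⟩
  · rw [hp, val_eval_pair, PrimRecArith.unpairFst_pair]
  · rw [hq, val_eval_pair, PrimRecArith.unpairSnd_pair]

/-- The sequence of functions that is coded by a single one, in the way of `Tm.row`. -/
def rows (X : M.D Ty.one) : M.D (Ty.arr Ty.nat Ty.one) :=
  M.eval ((Env.nil M).cons X) (Tm.row Tm.v1 Tm.v0).lam

theorem eval_row (e : M.Env Γ) (X : Tm Γ Ty.one) (n : Tm Γ Ty.nat) :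
    M.eval e (X.row n) = rows (M.eval e X) (M.eval e n) := by
  refine fun_ext fun m => ?_
  rw [rows, eval_lam, Tm.row, Tm.row, eval_lam, eval_lam]
  simp only [Tm.pair, Tm.plus, Tm.times, eval, eval_weaken, Env.tail_cons, Env.cons_zero,
    Env.cons_succ]

theorem rows_surjective : Function.Surjective (rows (M := M)) := by
  intro y
  obtain ⟨p, q, h⟩ := exists_unpair M
  let Y : M.D Ty.one := M.eval ((((Env.nil M).cons p).cons q).cons y)
    (Tm.app (Tm.app Tm.v1 (Tm.app (Tm.var Var.zero.succ.succ.succ) Tm.v0))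
      (Tm.app Tm.v2 Tm.v0)).lam
  have Y_app (k) : Y k = y (p k) (q k) := eval_lam _ _ _
  refine ⟨Y, fun_ext fun n => fun_ext fun m => ?_⟩
  rw [rows, eval_lam, Tm.row, eval_lam]
  change Y (M.eval _ _) = _
  rw [Y_app, (h _ _ _).1, (h _ _ _).2]
  rfl

theorem exists_choice_seq {A : Fm AnyType [τ, ρ]} (hA : (allEx A).Gamma1)
    (h : Provable I0 (allEx A)) (x : M.D (Ty.arr Ty.nat ρ)) :
    ∃ y : M.D (Ty.arr Ty.nat τ), ∀ n, M.Sat (((Env.nil M).cons (x n)).cons (y n)) A := by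
  obtain ⟨t, ht⟩ := exists_choice M hA h
  let y : M.D (Ty.arr Ty.nat τ) :=
    M.eval (((Env.nil M).cons t).cons x) (Tm.app Tm.v2 (Tm.app Tm.v1 Tm.v0)).lam
  have y_app (n) : y n = t (x n) := eval_lam _ _ _
  exact ⟨y, fun n => y_app n ▸ ht (x n)⟩

theorem sat_seqForm {A : Fm AnyType [τ, ρ]} (hA : (allEx A).Gamma1)
    (h : Provable I0 (allEx A)) : M.Sat (Env.nil M) (seqForm A) := by
  intro x
  obtain ⟨y, hy⟩ := exists_choice_seq hA h x
  refine ⟨y, fun n => ?_⟩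
  rw [sat_subst, Env.sub_cons, Env.sub_cons, Env.eq_nil (Env.sub _ _)]
  exact hy n

theorem sat_seqForm2 {A : Fm SecondOrder [Ty.one, Ty.one]} (hA : (allEx2 A).toAny.Gamma1)
    (h : Provable I0 (allEx2 A).toAny) : M.Sat (Env.nil M) (seqForm2 A) := by
  intro X
  obtain ⟨y, hy⟩ := exists_choice_seq (A := A.toAny) hA h (rows X)
  obtain ⟨Y, rfl⟩ := rows_surjective y
  refine ⟨Y, fun n => ?_⟩
  rw [sat_subst, Env.sub_cons, Env.sub_cons, Env.eq_nil (Env.sub _ _), eval_row, eval_row]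
  exact (sat_mono _ A _).1 (hy n)

end ExtModel

/-! ### The extensional quotient of a model -/

/-- Pointwise equality as a setoid. -/
def ptEqSetoid (M : TypeStructure) (σ : Ty) : Setoid (M.D σ) where
  r := M.PtEq σ
  iseqv := ⟨PtEq.refl, PtEq.symm, PtEq.trans⟩

section Quotient

variable [IsModel AnyType M]

theorem argsIn_anyType : ∀ σ : Ty, ArgsIn AnyType σ
  | Ty.nat => trivial
  | Ty.arr σ τ => ⟨anyType σ, argsIn_anyType τ⟩

theorem PtEq.app {f g : M.D (Ty.arr σ τ)} {a b : M.D σ} (hf : M.PtEq (Ty.arr σ τ) f g)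
    (ha : M.PtEq σ a b) : M.PtEq τ (f a) (g b) :=
  PtEq.trans (IsModel.ext (argsIn_anyType σ) (argsIn_anyType τ) a b f ha) (hf b)

/-- The extensional quotient of a model, in which pointwise equal objects are identified. -/
def extQuotient (M : TypeStructure) [IsModel AnyType M] : TypeStructure where
  D σ := Quotient (M.ptEqSetoid σ)
  N := M.N
  val := Quotient.lift M.val fun _ _ h => h
  app := Quotient.map₂ M.app fun _ _ hf _ _ ha => PtEq.app hf ha
  zero := Quotient.mk _ M.zero
  succ := Quotient.mk _ M.succ
  add := Quotient.mk _ M.add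
  mul := Quotient.mk _ M.mul
  proj ρ τ := Quotient.mk _ (M.proj ρ τ)
  comb δ ρ τ := Quotient.mk _ (M.comb δ ρ τ)
  recr := Quotient.mk _ M.recr

/-- The class of an object in the extensional quotient. -/
def toExtQuotient (a : M.D σ) : M.extQuotient.D σ := Quotient.mk (M.ptEqSetoid σ) a

theorem toExtQuotient_surjective :
    Function.Surjective (toExtQuotient : M.D σ → M.extQuotient.D σ) :=
  Quotient.mk_surjective

theorem ptEq_toExtQuotient {a b : M.D σ} :
    M.extQuotient.PtEq σ (toExtQuotient a) (toExtQuotient b) ↔ M.PtEq σ a b := by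
  induction σ with
  | nat => rfl
  | arr σ τ _ ih => exact toExtQuotient_surjective.forall.trans (forall_congr' fun _ => ih)

instance : IsModel AnyType M.extQuotient where
  nat_mem := trivial
  val_surj x := (IsModel.val_surj (M := M) x).imp' toExtQuotient fun _ h => h
  ext {ρ τ} hρ hτ := by
    rintro ⟨s⟩ ⟨t⟩ ⟨r⟩ h
    exact ptEq_toExtQuotient.2 (IsModel.ext hρ hτ s t r (ptEq_toExtQuotient.1 h))
  succ_ne_zero := by rintro ⟨a⟩; exact IsModel.succ_ne_zero a
  succ_inj := by rintro ⟨a⟩ ⟨b⟩; exact IsModel.succ_inj a b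
  add_zero := by rintro ⟨a⟩; exact IsModel.add_zero a
  add_succ := by rintro ⟨a⟩ ⟨b⟩; exact IsModel.add_succ a b
  mul_zero := by rintro ⟨a⟩; exact IsModel.mul_zero a
  mul_succ := by rintro ⟨a⟩ ⟨b⟩; exact IsModel.mul_succ a b
  proj_eq := by rintro ρ τ ⟨a⟩ ⟨b⟩; exact ptEq_toExtQuotient.2 (IsModel.proj_eq a b)
  comb_eq := by rintro δ ρ τ ⟨a⟩ ⟨b⟩ ⟨c⟩; exact ptEq_toExtQuotient.2 (IsModel.comb_eq a b c)
  rec_zero := by rintro ⟨a⟩ ⟨b⟩; exact IsModel.rec_zero a b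
  rec_succ := by rintro ⟨a⟩ ⟨b⟩ ⟨c⟩; exact IsModel.rec_succ a b c
  ind := by
    rintro ⟨f⟩ ⟨g⟩ ⟨f'⟩ ⟨g'⟩ h0 hs ⟨a⟩
    exact IsModel.ind f g f' g' h0 (fun a => hs (toExtQuotient a)) a

instance : IsExtModel M.extQuotient where
  eq_of_ptEq {σ f g} h := by
    obtain ⟨f, rfl⟩ := toExtQuotient_surjective f
    obtain ⟨g, rfl⟩ := toExtQuotient_surjective g
    exact Quotient.sound (ptEq_toExtQuotient.1 h)

/-- An environment, read in the extensional quotient. -/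
def Env.toExtQuotient (e : M.Env Γ) : M.extQuotient.Env Γ :=
  fun σ v => TypeStructure.toExtQuotient (e σ v)

theorem Env.toExtQuotient_cons (e : M.Env Γ) (d : M.D ρ) :
    (e.cons d).toExtQuotient = e.toExtQuotient.cons (TypeStructure.toExtQuotient d) := by
  funext σ v
  cases v <;> rfl

theorem eval_toExtQuotient (e : M.Env Γ) (t : Tm Γ σ) :
    M.extQuotient.eval e.toExtQuotient t = toExtQuotient (M.eval e t) := by
  induction t with
  | app f a hf ha =>
    rw [eval, hf, ha]
    rfl
  | _ => rfl

theorem sat_toExtQuotient (A : Fm V Γ) (e : M.Env Γ) :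
    M.extQuotient.Sat e.toExtQuotient A ↔ M.Sat e A := by
  induction A with
  | eq a b =>
    rw [Sat, eval_toExtQuotient, eval_toExtQuotient]
    rfl
  | all h A hA =>
    simp only [Sat, toExtQuotient_surjective.forall, ← Env.toExtQuotient_cons, hA]
  | ex h A hA =>
    simp only [Sat, toExtQuotient_surjective.exists, ← Env.toExtQuotient_cons, hA]
  | _ => simp only [Sat, *]

end Quotient

end TypeStructure

section PlotModel

open PrimRecArith

/-! ### Plot-preserving functionals -/

/-- A space of points with a class of distinguished sequences of points, its plots. -/
structure PlotSpace (N : Type) where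
  Point : Type
  IsPlot : (N → Point) → Prop

/-- The functionals of finite type over an arithmetic that preserve plots. The plots of type `0`
are the unary functions of the arithmetic; a sequence of functionals is a plot if it takes plots
to plots along every unary reindexing, which makes plots closed under reindexing and
application. -/
def plotSpace (N : Type) [PrimRecArith N] : Ty → PlotSpace N
  | Ty.nat => ⟨N, Fun₁⟩
  | Ty.arr σ τ =>
    ⟨{f : (plotSpace N σ).Point → (plotSpace N τ).Point //
        ∀ x, (plotSpace N σ).IsPlot x → (plotSpace N τ).IsPlot fun k => f (x k)},
      fun f => ∀ α, Fun₁ α → ∀ x, (plotSpace N σ).IsPlot x →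
        (plotSpace N τ).IsPlot fun k => (f (α k)).1 (x k)⟩

section Plots

variable {N : Type} [PrimRecArith N]

theorem isPlot_const : ∀ {σ : Ty} (c : (plotSpace N σ).Point), (plotSpace N σ).IsPlot fun _ => c
  | Ty.nat, c => fun₁_const (N := N) c
  | Ty.arr _ _, f => fun _ _ x hx => f.2 x hx

theorem isPlot_comp : ∀ {σ : Ty} {x : N → (plotSpace N σ).Point} {α : N → N},
    (plotSpace N σ).IsPlot x → Fun₁ α → (plotSpace N σ).IsPlot fun k => x (α k)
  | Ty.nat, _, _, hx, hα => Fun₁.comp (N := N) hx hα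
  | Ty.arr _ _, _, _, hf, hα => fun _ hβ x hx => hf _ (hα.comp hβ) x hx

theorem isPlot_app {f : N → (plotSpace N (Ty.arr σ τ)).Point} {x : N → (plotSpace N σ).Point}
    (hf : (plotSpace N (Ty.arr σ τ)).IsPlot f) (hx : (plotSpace N σ).IsPlot x) :
    (plotSpace N τ).IsPlot fun k => (f k).1 (x k) :=
  hf _ fun₁_id x hx

theorem fun₂_uncurry (z : (plotSpace N (Ty.arr Ty.nat Ty.one)).Point) :
    Fun₂ fun a b : N => (z.1 a).1 b := by
  have h : Fun₁ fun k : N => (z.1 (unpairFst (N := N) k)).1 (unpairSnd (N := N) k) :=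
    isPlot_app (σ := Ty.nat) (τ := Ty.nat) (z.2 _ (fun₁_unpairFst (N := N)))
      (fun₁_unpairSnd (N := N))
  simpa only [unpairFst_pair, unpairSnd_pair] using fun₂_comp₁ h fun₂_pair

/-- The value of the recursor at a functional `z`: it starts with `y` and applies `z` `n` times. -/
noncomputable def plotRec (z : (plotSpace N (Ty.arr Ty.nat Ty.one)).Point) : N → N → N :=
  (exists_rec (fun₂_uncurry z)).choose

theorem fun₂_plotRec (z : (plotSpace N (Ty.arr Ty.nat Ty.one)).Point) : Fun₂ (plotRec z) :=
  (exists_rec (fun₂_uncurry z)).choose_spec.1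

theorem plotRec_zero (z : (plotSpace N (Ty.arr Ty.nat Ty.one)).Point) (y : N) :
    plotRec z 0 y = y :=
  (exists_rec (fun₂_uncurry z)).choose_spec.2.1 y

theorem plotRec_add_one (z : (plotSpace N (Ty.arr Ty.nat Ty.one)).Point) (n y : N) :
    plotRec z (n + 1) y = (z.1 (plotRec (N := N) z n y)).1 n :=
  (exists_rec (fun₂_uncurry z)).choose_spec.2.2 n y

theorem fun₁_app_app {z : N → (plotSpace N (Ty.arr Ty.nat Ty.one)).Point} {i a b : N → N}
    (hz : (plotSpace N (Ty.arr Ty.nat Ty.one)).IsPlot z) (hi : Fun₁ i) (ha : Fun₁ a)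
    (hb : Fun₁ b) : Fun₁ fun k : N => ((z (i k)).1 (a k)).1 (b k) :=
  isPlot_app (σ := Ty.nat) (τ := Ty.nat)
    (isPlot_app (σ := Ty.nat) (τ := Ty.one) (isPlot_comp hz hi) ha) hb

/- All the recursions along a plot are done at once, by a recursion on coded pairs that carries the
index of the functional along. -/
theorem exists_rec_pair {z : N → (plotSpace N (Ty.arr Ty.nat Ty.one)).Point}
    (hz : (plotSpace N (Ty.arr Ty.nat Ty.one)).IsPlot z) :
    ∃ R : N → N → N, Fun₂ R ∧ ∀ n k y, R n (pair k y) = pair k (plotRec (z k) n y) := by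
  have hidx : Fun₂ fun s _ : N => unpairFst s := fun₂_comp₁ fun₁_unpairFst fun₂_fst
  have hval : Fun₂ fun s _ : N => unpairSnd s := fun₂_comp₁ fun₁_unpairSnd fun₂_fst
  have happ := fun₂_comp₁ (fun₁_app_app hz fun₁_unpairFst (fun₁_unpairFst.comp fun₁_unpairSnd)
      (fun₁_unpairSnd.comp fun₁_unpairSnd))
    (fun₂_comp₂ fun₂_pair hidx (fun₂_comp₂ fun₂_pair hval fun₂_snd))
  have hstep := fun₂_comp₂ fun₂_pair hidx happ
  simp only [unpairFst_pair, unpairSnd_pair] at hstep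
  obtain ⟨R, hR, hR0, hR1⟩ := exists_rec hstep
  refine ⟨R, hR, fun n k y => ?_⟩
  refine induct (hR.left (pair k y))
    (fun₁_comp₂ fun₂_pair (fun₁_const k) ((fun₂_plotRec (z k)).left y)) ?_ (fun n ih => ?_) n
  · rw [hR0, plotRec_zero]
  · rw [hR1, ih, plotRec_add_one, unpairFst_pair, unpairSnd_pair]

theorem fun₁_plotRec {z : N → (plotSpace N (Ty.arr Ty.nat Ty.one)).Point} {n y : N → N}
    (hz : (plotSpace N (Ty.arr Ty.nat Ty.one)).IsPlot z) (hn : Fun₁ n) (hy : Fun₁ y) :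
    Fun₁ fun k => plotRec (z k) (n k) (y k) := by
  obtain ⟨R, hR, hR'⟩ := exists_rec_pair hz
  have h := fun₁_unpairSnd.comp (fun₁_comp₂ hR hn (fun₁_comp₂ fun₂_pair fun₁_id hy))
  simpa only [hR', unpairSnd_pair] using h

variable (N) in
/-- The structure of the functionals that preserve plots. -/
noncomputable def plotStructure : TypeStructure where
  D σ := (plotSpace N σ).Point
  N := N
  val a := a
  app f a := f.1 a
  zero := (0 : N)
  succ := ⟨fun x : N => x + 1, fun _ hx => Fun₁.add (N := N) hx (fun₁_const 1)⟩
  add := ⟨fun x : N => ⟨fun y : N => x + y, fun _ hy => Fun₁.add (N := N) (fun₁_const x) hy⟩,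
    fun _ hx _ hα _ hy => Fun₁.add (N := N) (Fun₁.comp (N := N) hx hα) hy⟩
  mul := ⟨fun x : N => ⟨fun y : N => x * y, fun _ hy => Fun₁.mul (N := N) (fun₁_const x) hy⟩,
    fun _ hx _ hα _ hy => Fun₁.mul (N := N) (Fun₁.comp (N := N) hx hα) hy⟩
  proj _ _ := ⟨fun s => ⟨fun _ => s, fun _ _ => isPlot_const s⟩,
    fun _ hs _ hα _ _ => isPlot_comp hs hα⟩
  comb _ _ _ := ⟨fun r => ⟨fun s => ⟨fun t => (r.1 t).1 (s.1 t),
        fun t ht => isPlot_app (r.2 t ht) (s.2 t ht)⟩,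
      fun s hs α hα t ht => isPlot_app (f := fun k => r.1 (t k)) (x := fun k => (s (α k)).1 (t k))
        (r.2 t ht) (isPlot_app (isPlot_comp hs hα) ht)⟩,
    fun r hr α hα s hs β hβ t ht => isPlot_app (f := fun k => (r (α (β k))).1 (t k))
      (x := fun k => (s (β k)).1 (t k)) (isPlot_app (isPlot_comp hr (hα.comp hβ)) ht)
      (isPlot_app (isPlot_comp hs hβ) ht)⟩
  recr := ⟨fun n : N => ⟨fun y : N => ⟨fun z => plotRec (N := N) z n y,
        fun _ hz => fun₁_plotRec (N := N) hz (fun₁_const n) (fun₁_const y)⟩,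
      fun _ hy _ hα _ hz => fun₁_plotRec (N := N) hz (fun₁_const n) (Fun₁.comp (N := N) hy hα)⟩,
    fun _ hn _ hα _ hy _ hβ _ hz => fun₁_plotRec (N := N) hz
      (Fun₁.comp (N := N) hn (hα.comp hβ)) (Fun₁.comp (N := N) hy hβ)⟩

theorem eq_of_ptEq_plotStructure : ∀ {σ : Ty} {f g : (plotStructure N).D σ},
    (plotStructure N).PtEq σ f g → f = g
  | Ty.nat, _, _, h => h
  | Ty.arr _ _, _, _, h => Subtype.ext (funext fun a => eq_of_ptEq_plotStructure (h a))

instance : TypeStructure.IsExtModel (plotStructure N) where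
  nat_mem := trivial
  val_surj a := ⟨a, rfl⟩
  ext _ _ _ _ _ h := by
    rw [eq_of_ptEq_plotStructure h]
    exact TypeStructure.PtEq.refl _
  succ_ne_zero := add_one_ne_zero (N := N)
  succ_inj _ _ h := add_one_inj (N := N) h
  add_zero := AddZeroClass.add_zero (M := N)
  add_succ := fun (a b : N) => show a + (b + 1) = a + b + 1 by ring
  mul_zero := MulZeroClass.mul_zero (M₀ := N)
  mul_succ := fun (a b : N) => show a * (b + 1) = a * b + a by ring
  proj_eq _ _ := TypeStructure.PtEq.refl _
  comb_eq _ _ _ := TypeStructure.PtEq.refl _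
  rec_zero y z := plotRec_zero (N := N) z y
  rec_succ n y z := plotRec_add_one (N := N) z n y
  ind f g f' g' h0 h := ind_or (N := N) (f.2 _ fun₁_id) (g.2 _ fun₁_id) (f'.2 _ fun₁_id)
    (g'.2 _ fun₁_id) h0 fun x hx => by
      rw [succ_eq_add_one]
      exact h x hx
  eq_of_ptEq := eq_of_ptEq_plotStructure

end Plots

namespace TypeStructure

variable {M : TypeStructure}

section PlotRel

variable [IsModel V M]

/-- The logical relation between a model and the plot-preserving functionals over its numbers. -/
def PlotRel : (σ : Ty) → M.D σ → (plotSpace M.N σ).Point → Prop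
  | Ty.nat, a, d => M.val a = d
  | Ty.arr σ τ, f, F => ∀ a d, PlotRel σ a d → PlotRel τ (f a) (F.1 d)

theorem PlotRel.congr : ∀ {σ : Ty} {a b : M.D σ} {d : (plotSpace M.N σ).Point},
    M.PtEq σ a b → PlotRel σ b d → PlotRel σ a d
  | Ty.nat, _, _, _, h, h' => Eq.trans h h'
  | Ty.arr _ _, _, _, _, h, h' => fun a d had => PlotRel.congr (h a) (h' a d had)

theorem plotRel_recr : PlotRel _ M.recr (plotStructure M.N).recr := by
  rintro n _ rfl y _ rfl z z' hz
  have val_app_app (a b) : M.val (z a b) = (z'.1 (M.val a)).1 (M.val b) := hz a _ rfl b _ rfl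
  obtain ⟨R, hR, hR'⟩ := fun₂_recr z
  refine (hR' n y).trans (induct (N := M.N) (Fun₂.left hR (M.val y))
    ((fun₂_plotRec z').left (M.val y)) ?_ (fun k ih => ?_) (M.val n))
  · rw [plotRec_zero, ← val_zero, ← hR', IsModel.rec_zero]
  · obtain ⟨a, rfl⟩ := IsModel.val_surj k
    rw [plotRec_add_one, ← ih, ← val_succ, ← hR', ← hR', IsModel.rec_succ]
    exact val_app_app _ _

theorem plotRel_eval (t : Tm Γ σ) {e : M.Env Γ} {e' : (plotStructure M.N).Env Γ}
    (he : ∀ σ v, PlotRel σ (e σ v) (e' σ v)) :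
    PlotRel σ (M.eval e t) ((plotStructure M.N).eval e' t) := by
  induction t with
  | var v => exact he _ v
  | app _ _ hf ha => exact hf _ _ ha
  | zero => exact val_zero
  | succ =>
    rintro a _ rfl
    exact val_succ a
  | add =>
    rintro a _ rfl b _ rfl
    exact val_add a b
  | mul =>
    rintro a _ rfl b _ rfl
    exact val_mul a b
  | proj ρ τ => exact fun a _ ha b _ _ => PlotRel.congr (IsModel.proj_eq a b) ha
  | comb δ ρ τ =>
    exact fun r _ hr s _ hs t _ ht =>
      PlotRel.congr (IsModel.comb_eq r s t) (hr _ _ ht _ _ (hs _ _ ht))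
  | recr => exact plotRel_recr

theorem exists_plotRel_right (hσ : SecondOrder σ) (a : M.D σ) :
    ∃ d : (plotStructure M.N).D σ, PlotRel σ a d := by
  rcases hσ with rfl | rfl
  · exact ⟨M.val a, rfl⟩
  · refine ⟨⟨toFun₁ a, fun x hx => Fun₁.comp (N := M.N) (fun₁_toFun₁ a) hx⟩, ?_⟩
    rintro b _ rfl
    exact val_app a b

theorem exists_plotRel_left (hσ : SecondOrder σ) (d : (plotStructure M.N).D σ) :
    ∃ a : M.D σ, PlotRel σ a d := by
  rcases hσ with rfl | rfl
  · exact IsModel.val_surj d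
  · obtain ⟨a, ha⟩ : M.Fun₁ d.1 := d.2 _ (PrimRecArith.fun₁_id (N := M.N))
    refine ⟨a, ?_⟩
    rintro b _ rfl
    exact ha b

theorem plotRel_cons {e : M.Env Γ} {e' : (plotStructure M.N).Env Γ}
    (he : ∀ σ v, PlotRel σ (e σ v) (e' σ v)) {a : M.D ρ} {d : (plotStructure M.N).D ρ}
    (h : PlotRel ρ a d) (σ : Ty) (v : Var (ρ :: Γ) σ) :
    PlotRel σ (e.cons a σ v) (e'.cons d σ v) := by
  cases v with
  | zero => exact h
  | succ v => exact he _ v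

theorem sat_iff_plotStructure_sat (A : Fm SecondOrder Γ) {e : M.Env Γ}
    {e' : (plotStructure M.N).Env Γ} (he : ∀ σ v, PlotRel σ (e σ v) (e' σ v)) :
    M.Sat e A ↔ (plotStructure M.N).Sat e' A := by
  induction A with
  | eq a b =>
    have ha : M.val (M.eval e a) = _ := plotRel_eval a he
    have hb : M.val (M.eval e b) = _ := plotRel_eval b he
    rw [Sat, ha, hb]
    rfl
  | bot => rfl
  | and A B hA hB => exact and_congr (hA he) (hB he)
  | or A B hA hB => exact or_congr (hA he) (hB he)
  | imp A B hA hB => exact imp_congr (hA he) (hB he)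
  | all h A hA =>
    refine ⟨fun H d => ?_, fun H a => ?_⟩
    · obtain ⟨a, ha⟩ := exists_plotRel_left h d
      exact (hA (plotRel_cons he ha)).1 (H a)
    · obtain ⟨d, hd⟩ := exists_plotRel_right h a
      exact (hA (plotRel_cons he hd)).2 (H d)
  | ex h A hA =>
    constructor
    · rintro ⟨a, H⟩
      obtain ⟨d, hd⟩ := exists_plotRel_right h a
      exact ⟨d, (hA (plotRel_cons he hd)).1 H⟩
    · rintro ⟨d, H⟩
      obtain ⟨a, ha⟩ := exists_plotRel_left h d
      exact ⟨a, (hA (plotRel_cons he ha)).2 H⟩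

end PlotRel

end TypeStructure

end PlotModel

/-! ### Provability of sequential forms -/

instance : IsClassicalArithmetic RCA0omega where
  ha_mem := Or.inl
  lem_mem A := Or.inr (Or.inr (LEM.mk A))

instance : IsClassicalArithmetic RCA0 where
  ha_mem := Or.inl
  lem_mem A := Or.inr (Or.inr (LEM.mk A))

theorem provable_seqForm (T : Theory AnyType) [IsClassicalArithmetic T] {A : Fm AnyType [τ, ρ]}
    (hA : (allEx A).Gamma1) (h : Provable I0 (allEx A)) : Provable T (seqForm A) := by
  by_contra hn
  obtain ⟨M, hM, hMA⟩ := exists_model_not_sat (anyType _) hn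
  refine hMA ((TypeStructure.sat_toExtQuotient _ _).1 ?_)
  rw [TypeStructure.Env.eq_nil (TypeStructure.Env.toExtQuotient _)]
  exact TypeStructure.sat_seqForm hA h

theorem provable_seqForm2 (T : Theory SecondOrder) [IsClassicalArithmetic T]
    {A : Fm SecondOrder [Ty.one, Ty.one]} (hA : (allEx2 A).toAny.Gamma1)
    (h : Provable I0 (allEx2 A).toAny) : Provable T (seqForm2 A) := by
  by_contra hn
  obtain ⟨M, hM, hMA⟩ := exists_model_not_sat secondOrder_nat hn
  exact hMA ((TypeStructure.sat_iff_plotStructure_sat _ (e' := TypeStructure.Env.nil _) nofun).2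
    (TypeStructure.sat_seqForm2 (M := plotStructure M.N) hA h))

end FiniteType

theorem mainTheorem1_general :
    (∀ (T : FiniteType.Theory FiniteType.AnyType) [FiniteType.IsClassicalArithmetic T]
      (ρ τ : FiniteType.Ty) (A : FiniteType.Fm FiniteType.AnyType [τ, ρ]),
      (FiniteType.allEx A).Gamma1 →
      FiniteType.Provable FiniteType.I0 (FiniteType.allEx A) →
      FiniteType.Provable T (FiniteType.seqForm A)) ∧
    (∀ (T : FiniteType.Theory FiniteType.SecondOrder) [FiniteType.IsClassicalArithmetic T]
      (A : FiniteType.Fm FiniteType.SecondOrder [FiniteType.Ty.one, FiniteType.Ty.one]),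
      (FiniteType.allEx2 A).toAny.Gamma1 →
      FiniteType.Provable FiniteType.I0 (FiniteType.allEx2 A).toAny →
      FiniteType.Provable T (FiniteType.seqForm2 A)) :=
  ⟨fun T _ _ _ _ => FiniteType.provable_seqForm T,
    fun T _ _ => FiniteType.provable_seqForm2 T⟩

theorem mainTheorem1 :
    (∀ (ρ τ : FiniteType.Ty) (A : FiniteType.Fm FiniteType.AnyType [τ, ρ]),
      (FiniteType.allEx A).Gamma1 →
      FiniteType.Provable FiniteType.I0 (FiniteType.allEx A) →
      FiniteType.Provable FiniteType.RCA0omega (FiniteType.seqForm A)) ∧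
    (∀ A : FiniteType.Fm FiniteType.SecondOrder [FiniteType.Ty.one, FiniteType.Ty.one],
      (FiniteType.allEx2 A).toAny.Gamma1 →
      FiniteType.Provable FiniteType.I0 (FiniteType.allEx2 A).toAny →
      FiniteType.Provable FiniteType.RCA0 (FiniteType.seqForm2 A)) :=
  ⟨mainTheorem1_general.1 FiniteType.RCA0omega, mainTheorem1_general.2 FiniteType.RCA0⟩
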